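/- Let $G$ be a finite (additive) abelian group. A sequence over $G$ is a finite list, in which repetitions are allowed and order is irrelevant, of nonzero elements of $G$; it is zero-sum free if no nonempty subsequence has sum $0$. The cross number of $S$ is $\mathsf{k}(S)=\sum_{g\in S}\frac{1}{\operatorname{ord}(g)}$ (summed with multiplicity), and the little cross number of $G$ is $$\mathsf{k}(G)=\max\{\mathsf{k}(S): S \text{ is a zero-sum free sequence over } G\}.$$ If $G\cong\bigoplus_{j=1}^{t}C_{q_j^{e_j}}$ with $q_1,\dots,q_t$ (not necessarily distinct) primes, where $C_m$ denotes the cyclic group of order $m$, put $\mathsf{k}^*(G)=\sum_{j=1}^{t}\bigl(1-q_j^{-e_j}\bigr)$, which does not depend on the decomposition. For a prime $p$ and a positive integer $n=\prod_{j}q_j^{a_j}$ (prime factorization), write $p\prec n$ if $p\nmid n$ and $$\frac{p}{p-1}\ \ge\ \prod_{j}\frac{q_j^{a_j+1}-1}{q_j^{a_j+1}-q_j^{a_j}},$$ the empty product being $1$. Corollary. Let $r\ge 2$, let $p_1,\dots,p_r$ be distinct primes, let $\alpha_1,\dots,\alpha_{r-1},\alpha'_{r-1},s$ be nonnegative integers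 with $\alpha_{r-1}\ge\alpha'_{r-1}$, and suppose that $$p_i\prec p_{i+1}^{\alpha_{i+1}}\cdots p_{r-1}^{\alpha_{r-1}}\,p_r\qquad\text{for all } 1\le i\le r-2 .$$ If $G$ is a finite abelian group of the form $$G\cong C_{p_1^{\alpha_1}}\oplus\cdots\oplus C_{p_{r-2}^{\alpha_{r-2}}}\oplus C_{p_{r-1}^{\alpha_{r-1}}}\oplus C_{p_{r-1}^{\alpha'_{r-1}}}\oplus C_{p_r}^{\,s},$$ then $\mathsf{k}(G)=\mathsf{k}^*(G)$. -/

import Mathlib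

noncomputable section

namespace CrossNumber

/-- An indexed (squarefree) sequence over `G`: a finite set of pairs `(g, n)` with `g` a nonzero
element of `G` and `n` a natural number; the labels `n` allow repeated group elements. -/
abbrev IndexedSeq (G : Type*) [AddCommGroup G] : Type _ := Finset ({g : G // g ≠ 0} × ℕ)

namespace IndexedSeq

variable {G : Type*} [AddCommGroup G]

/-- The sum of the terms of an indexed sequence. -/
def sum (S : IndexedSeq G) : G := ∑ x ∈ S, (x.1 : G)

/-- No nonempty subsequence has sum zero. -/
def IsZeroSumFree (S : IndexedSeq G) : Prop :=
  ∀ T : IndexedSeq G, T ⊆ S → T.Nonempty → T.sum ≠ 0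

/-- The sum of the inverse orders of the terms. -/
def crossNumber (S : IndexedSeq G) : ℝ := ∑ x ∈ S, 1 / (addOrderOf (x.1 : G) : ℝ)

end IndexedSeq

/-- The cross numbers of the zero-sum free indexed sequences over `G`. -/
def zeroSumFreeCrossNumbers (G : Type*) [AddCommGroup G] : Set ℝ :=
  {x | ∃ S : IndexedSeq G, S.IsZeroSumFree ∧ S.crossNumber = x}

/-- The little cross number `k(G)`; by `isGreatest_littleCrossNumber` it is a maximum when `G` is
finite. -/
def littleCrossNumber (G : Type*) [AddCommGroup G] : ℝ := sSup (zeroSumFreeCrossNumbers G)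

theorem finite_zeroSumFreeCrossNumbers (G : Type*) [AddCommGroup G] [Finite G] :
    (zeroSumFreeCrossNumbers G).Finite := by
  classical
  cases nonempty_fintype G
  let B : Multiset {g : G // g ≠ 0} := Nat.card G • Finset.univ.val
  refine (Set.Finite.image
    (fun M : Multiset {g : G // g ≠ 0} => (M.map fun g : {g : G // g ≠ 0} => 1 / (addOrderOf (g : G) : ℝ)).sum)
    (Multiset.finite_toSet B.powerset)).subset ?_
  rintro _ ⟨S, hS, rfl⟩
  refine ⟨S.val.map Prod.fst, ?_, ?_⟩
  · change S.val.map Prod.fst ∈ B.powerset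
    rw [Multiset.mem_powerset, Multiset.le_iff_count]
    intro g
    have hB : B.count g = Nat.card G := by simp [B]
    rw [hB, Multiset.count_map]
    by_contra! hlt
    have hc : addOrderOf (g : G) ≤ (S.filter fun x => g = x.1).card := by
      refine le_trans ?_ hlt.le
      exact Nat.le_of_dvd Nat.card_pos (addOrderOf_dvd_natCard _)
    obtain ⟨T, hTS, hT⟩ := Finset.exists_subset_card_eq hc
    refine hS T (hTS.trans (Finset.filter_subset _ _)) ?_ ?_
    · rw [← Finset.card_pos, hT]
      exact addOrderOf_pos _
    · have : ∀ x ∈ T, (x.1 : G) = g := fun x hx => by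
        rw [← (Finset.mem_filter.1 (hTS hx)).2]
      rw [IndexedSeq.sum, Finset.sum_congr rfl this, Finset.sum_const, hT, addOrderOf_nsmul_eq_zero]
  · simp only [Multiset.map_map]
    rfl

theorem isGreatest_littleCrossNumber (G : Type*) [AddCommGroup G] [Finite G] :
    IsGreatest (zeroSumFreeCrossNumbers G) (littleCrossNumber G) := by
  have hne : (zeroSumFreeCrossNumbers G).Nonempty :=
    ⟨_, ∅, fun T hT hT' => absurd (Finset.subset_empty.1 hT) hT'.ne_empty, rfl⟩
  have hf := finite_zeroSumFreeCrossNumbers G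
  exact ⟨hne.csSup_mem hf, fun x hx => le_csSup hf.bddAbove hx⟩

/-- `x` is the sum of `1 - 1 / q_i ^ e_i` over some decomposition of `G` as a direct sum of cyclic
groups of prime power orders `q_i ^ e_i`. -/
def IsCrossNumberBound (G : Type*) [AddCommGroup G] (x : ℝ) : Prop :=
  ∃ (ι : Type) (_ : Fintype ι) (q e : ι → ℕ), (∀ i, (q i).Prime) ∧
    Nonempty (G ≃+ ((i : ι) → ZMod (q i ^ e i))) ∧ x = ∑ i, (1 - 1 / (q i : ℝ) ^ e i)

theorem exists_isCrossNumberBound (G : Type*) [AddCommGroup G] [Finite G] :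
    ∃ x, IsCrossNumberBound G x := by
  obtain ⟨ι, hι, q, hq, e, ⟨f⟩⟩ := AddCommGroup.equiv_directSum_zmod_of_finite G
  exact ⟨_, ι, hι, q, e, hq, ⟨f.trans (DirectSum.addEquivProd _)⟩, rfl⟩

/-- The invariant `k*(G)`: the sum of `1 - 1 / q_i ^ e_i` over a decomposition of `G` as a direct
sum of cyclic groups of prime power orders `q_i ^ e_i`. It does not depend on the decomposition,
see `kStar_eq`. -/
def kStar (G : Type*) [AddCommGroup G] [Finite G] : ℝ :=
  Classical.choose (exists_isCrossNumberBound G)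

/-- The number of solutions of `m • x = 0` in a direct sum of cyclic groups. -/
theorem card_torsion {G : Type*} [AddCommGroup G] {ι : Type*} [Fintype ι] (q e : ι → ℕ)
    (hq : ∀ i, (q i).Prime) (f : G ≃+ ((i : ι) → ZMod (q i ^ e i))) (m : ℕ) :
    Nat.card {x : G // m • x = 0} = ∏ i, (q i ^ e i).gcd m := by
  have h1 : {x : G // m • x = 0} ≃ ((i : ι) → {y : ZMod (q i ^ e i) // m • y = 0}) :=
    (f.toEquiv.subtypeEquiv (p := fun x => m • x = 0)
      (q := fun y => ∀ i, m • y i = 0) (fun x => by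
        rw [← f.map_eq_zero_iff, map_nsmul, funext_iff]; rfl)).trans
      (Equiv.subtypePiEquivPi (p := fun i (y : ZMod (q i ^ e i)) => m • y = 0))
  rw [Nat.card_congr h1, Nat.card_pi]
  refine Finset.prod_congr rfl fun i _ => ?_
  have : NeZero (q i ^ e i) := ⟨pow_ne_zero _ (hq i).ne_zero⟩
  have h2 := IsAddCyclic.card_nsmulAddMonoidHom_ker (G := ZMod (q i ^ e i)) m
  rw [Nat.card_zmod] at h2
  rw [← h2]
  rfl

/-- The sum attached to a decomposition, in terms of the numbers of solutions of `m • x = 0`. -/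
theorem sum_eq_of_decomposition {G : Type*} [AddCommGroup G] {ι : Type*} [Fintype ι] (q e : ι → ℕ)
    (hq : ∀ i, (q i).Prime) (f : G ≃+ ((i : ι) → ZMod (q i ^ e i))) (N : ℕ)
    (hqN : ∀ i, q i < N) (heN : ∀ i, e i ≤ N) :
    ∑ i, (1 - 1 / (q i : ℝ) ^ e i) = ∑ p ∈ (Finset.range N).filter Nat.Prime,
      ∑ k ∈ Finset.range N,
        (((Nat.card {x : G // p ^ (k + 1) • x = 0}).factorization p : ℝ) -
          (Nat.card {x : G // p ^ k • x = 0}).factorization p) *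
        (1 / (p : ℝ) ^ k - 1 / (p : ℝ) ^ (k + 1)) := by
  have key : ∀ p : ℕ, p.Prime → ∀ k : ℕ,
      (Nat.card {x : G // p ^ k • x = 0}).factorization p =
        ∑ i, if q i = p then min (e i) k else 0 := by
    intro p hp k
    rw [card_torsion q e hq f, Nat.factorization_prod (fun i _ =>
      (Nat.gcd_pos_of_pos_right _ (pow_pos hp.pos _)).ne'), Finset.sum_apply']
    refine Finset.sum_congr rfl fun i _ => ?_
    rw [Nat.factorization_gcd (pow_ne_zero _ (hq i).ne_zero) (pow_ne_zero _ hp.ne_zero),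
      Finsupp.inf_apply, (hq i).factorization_pow, hp.factorization_pow]
    split_ifs with h
    · subst h; simp
    · simp [h]
  have tel : ∀ i, (1 - 1 / (q i : ℝ) ^ e i) = ∑ k ∈ Finset.range N,
      (((min (e i) (k + 1) : ℕ) : ℝ) - (min (e i) k : ℕ)) *
        (1 / (q i : ℝ) ^ k - 1 / (q i : ℝ) ^ (k + 1)) := by
    intro i
    have h1 : ∀ M, ∑ k ∈ Finset.range M,
        (((min (e i) (k + 1) : ℕ) : ℝ) - (min (e i) k : ℕ)) *
        (1 / (q i : ℝ) ^ k - 1 / (q i : ℝ) ^ (k + 1)) = 1 - 1 / (q i : ℝ) ^ (min (e i) M) := by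
      intro M
      induction M with
      | zero => simp
      | succ M ih =>
        rw [Finset.sum_range_succ, ih]
        rcases le_or_gt (e i) M with h | h
        · rw [min_eq_left h, min_eq_left (by omega)]; ring
        · rw [min_eq_right h.le, min_eq_right (by omega)]; push_cast; ring
    rw [h1 N, min_eq_left (heN i)]
  have hterm : ∀ p ∈ (Finset.range N).filter Nat.Prime, ∑ k ∈ Finset.range N,
        (((Nat.card {x : G // p ^ (k + 1) • x = 0}).factorization p : ℝ) -
          (Nat.card {x : G // p ^ k • x = 0}).factorization p) *
        (1 / (p : ℝ) ^ k - 1 / (p : ℝ) ^ (k + 1)) =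
        ∑ i, if q i = p then (1 - 1 / (q i : ℝ) ^ e i) else 0 := by
    intro p hp
    have hp' := (Finset.mem_filter.1 hp).2
    simp only [key p hp', Nat.cast_sum, ← Finset.sum_sub_distrib, Finset.sum_mul]
    rw [Finset.sum_comm]
    refine Finset.sum_congr rfl fun i _ => ?_
    split_ifs with h
    · rw [tel i, h]
    · simp
  rw [Finset.sum_congr rfl hterm, Finset.sum_comm]
  refine Finset.sum_congr rfl fun i _ => ?_
  rw [Finset.sum_ite_eq, if_pos]
  exact Finset.mem_filter.2 ⟨Finset.mem_range.2 (hqN i), hq i⟩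

/-- `k*(G)` may be computed from any decomposition into cyclic groups of prime power order. -/
theorem kStar_eq {G : Type*} [AddCommGroup G] [Finite G] {ι : Type*} [Fintype ι] (q e : ι → ℕ)
    (hq : ∀ i, (q i).Prime) (f : G ≃+ ((i : ι) → ZMod (q i ^ e i))) :
    kStar G = ∑ i, (1 - 1 / (q i : ℝ) ^ e i) := by
  obtain ⟨κ, _, q', e', hq', ⟨f'⟩, hx⟩ := Classical.choose_spec (exists_isCrossNumberBound G)
  have hb : ∀ {α : Type _} [Fintype α] (g : α → ℕ) (a : α), g a ≤ ∑ i, g i :=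
    fun g a => Finset.single_le_sum (f := g) (fun _ _ => Nat.zero_le _) (Finset.mem_univ a)
  have hb' : ∀ {α : Type} [Fintype α] (g : α → ℕ) (a : α), g a ≤ ∑ i, g i :=
    fun g a => Finset.single_le_sum (f := g) (fun _ _ => Nat.zero_le _) (Finset.mem_univ a)
  set N := ∑ i, q i + ∑ i, e i + ∑ i, q' i + ∑ i, e' i + 1 with hN
  refine hx.trans ?_
  rw [sum_eq_of_decomposition q e hq f N (fun i => by have := hb q i; omega)
      (fun i => by have := hb e i; omega),
    sum_eq_of_decomposition q' e' hq' f' N (fun i => by have := hb' q' i; omega)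
      (fun i => by have := hb' e' i; omega)]

/-- For a prime `p` and a positive integer `n`, `p` is wide with respect to `n` (`p ≺ n`): `p` does
not divide `n` and `p / (p - 1)` is at least the product of
`(q ^ (a + 1) - 1) / (q ^ (a + 1) - q ^ a)` over the prime powers `q ^ a` exactly dividing `n`. -/
def IsWide (p n : ℕ) : Prop :=
  ¬ p ∣ n ∧
    ∏ q ∈ n.primeFactors, (((q : ℝ) ^ (n.factorization q + 1) - 1) /
      ((q : ℝ) ^ (n.factorization q + 1) - (q : ℝ) ^ n.factorization q)) ≤ (p : ℝ) / ((p : ℝ) - 1)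

end CrossNumber

end

/-! Write k* for the expected value. The inequality k* ≤ k(G) comes from taking, for every component
C_{q^e} and every k from 1 to e, q - 1 copies of an element of order q^k (`exists_zeroSumFree_pi`).

The upper bound is proved for all subgroups H of G, by induction on the exponents. The tool is
averaging at a prime r (`exists_average`). Summing a pointwise identity for 1/ord(x) gives k(S) =
n/r + (1 - 1/r) k(S') + k(Q)/r, where n counts the elements of order r, S' consists of the elements
of order prime to r, and Q is r times the elements not killed by r. If every R + 1 elements of H[r]
contain a zero-sum subsequence and S is zero-sum free, then Q has at most R - n disjoint zero-sum
subsequences. Since k* obeys the matching recursion (`Reduction.kBound_eq`), the bound for S follows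
from the bound for S' and a packing bound k(Q) ≤ k* + u for sequences with at most u disjoint
zero-sum subsequences.

For the packing bound (`packBound_of_mainBound`), zero-sum subsequences of cross number at most 1
are split off, and a subsequence T with k(T) ≤ 1/ord(σ(T)) is replaced by its sum σ(T). What remains
has few elements of each order (`exists_isDense`). Charging each order to its least chain prime then
bounds the part outside the q-component by its share of k* plus `excess`. Hence the packing bound
holds with an error e whenever the excess is at most 1 + e; the rank two component at q needs the
short zero-sum constant 3q - 2 of C_q ⊕ C_q.

The relation ≺ says that the sum of the reciprocals of the divisors of the later part is at most
p/(p - 1). It forces excess ≤ 1, hence e = 0, unless 2 is a chain prime with positive exponent. In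
the remaining case the sequence is made dense. If it contains an element of order two, averaging at
2 produces a zero-sum free Q, and no packing bound is needed. If not, its 2-part stays 1/2 below k*;
this slack pays for the errors e/r met when the other primes are restored one at a time
(`SlackBound.complete`), by a numerical check according to the smallest chain primes. -/

namespace CrossNumber

/-! ### Disjoint zero-sum subsequences and averaging at a prime -/

section ZeroSums

open scoped Classical

variable {G : Type*} [AddCommGroup G]

/-- `S` contains `t` disjoint nonempty subsequences of sum zero. -/
def HasZeroSums (t : ℕ) (S : Multiset G) : Prop :=
  ∃ F : Multiset (Multiset G), F.card = t ∧ F.sum ≤ S ∧ ∀ T ∈ F, T ≠ 0 ∧ T.sum = 0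

/-- The cross number of a sequence, written as a multiset. -/
noncomputable def crossSum (S : Multiset G) : ℝ := (S.map fun x => 1 / (addOrderOf x : ℝ)).sum

theorem HasZeroSums.mono {t : ℕ} {S S' : Multiset G} (h : HasZeroSums t S) (hS : S ≤ S') :
    HasZeroSums t S' := by
  obtain ⟨F, h1, h2, h3⟩ := h
  exact ⟨F, h1, h2.trans hS, h3⟩

theorem exists_le_card_eq_of_le_card {α : Type*} {S : Multiset α} {n : ℕ} (h : n ≤ S.card) :
    ∃ T ≤ S, T.card = n := by
  induction S using Quotient.inductionOn with
  | h l => exact ⟨(l.take n : List α), (List.take_sublist n l).subperm,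
      by simpa using h⟩

theorem mem_sum_iff {α : Type*} {F : Multiset (Multiset α)} {x : α} :
    x ∈ F.sum ↔ ∃ T ∈ F, x ∈ T := by
  induction F using Multiset.induction_on <;> simp_all

theorem HasZeroSums.add {t u : ℕ} {S U : Multiset G} (h : HasZeroSums t S)
    (h' : HasZeroSums u U) : HasZeroSums (t + u) (S + U) := by
  obtain ⟨F, h1, h2, h3⟩ := h
  obtain ⟨F', h1', h2', h3'⟩ := h'
  refine ⟨F + F', by simp [h1, h1'], by simpa using add_le_add h2 h2', fun T hT => ?_⟩
  rcases Multiset.mem_add.1 hT with hT | hT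
  exacts [h3 T hT, h3' T hT]

theorem hasZeroSums_one {S : Multiset G} :
    HasZeroSums 1 S ↔ ∃ T ≤ S, T ≠ 0 ∧ T.sum = 0 := by
  constructor
  · rintro ⟨F, h1, h2, h3⟩
    obtain ⟨T, rfl⟩ := Multiset.card_eq_one.1 h1
    exact ⟨T, by simpa using h2, h3 T (by simp)⟩
  · rintro ⟨T, h1, h2⟩
    exact ⟨{T}, by simp, by simpa using h1, by simpa using h2⟩

theorem HasZeroSums.of_mem_zero {S : Multiset G} (h : (0 : G) ∈ S) : HasZeroSums 1 S :=
  hasZeroSums_one.2 ⟨{0}, by simpa using h, by simp, by simp⟩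

/-- At most one of the disjoint zero-sum subsequences uses the added term `T.sum`, and there the
term can be expanded back into `T`. -/
theorem HasZeroSums.merge {t : ℕ} {T U : Multiset G} (hT : T ≠ 0)
    (h : HasZeroSums t (T.sum ::ₘ U)) : HasZeroSums t (T + U) := by
  obtain ⟨F, h1, h2, h3⟩ := h
  by_cases hm : T.sum ∈ F.sum
  · obtain ⟨M, hM, hσ⟩ := mem_sum_iff.1 hm
    obtain ⟨F', rfl⟩ := Multiset.exists_cons_of_mem hM
    obtain ⟨M', hM'⟩ := Multiset.exists_cons_of_mem hσ
    refine ⟨(T + M') ::ₘ F', by simpa using h1, ?_, ?_⟩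
    · rw [Multiset.sum_cons, hM', Multiset.cons_add, Multiset.cons_le_cons_iff] at h2
      rw [Multiset.sum_cons, add_assoc]
      gcongr
    · intro A hA
      rcases Multiset.mem_cons.1 hA with rfl | hA
      · refine ⟨by simp [hT], ?_⟩
        have := (h3 M (by simp)).2
        rwa [hM', Multiset.sum_cons, ← Multiset.sum_add] at this
      · exact h3 A (Multiset.mem_cons_of_mem hA)
  · exact ⟨F, h1, ((Multiset.le_cons_of_notMem hm).1 h2).trans (Multiset.le_add_left _ _), h3⟩

theorem HasZeroSums.merge_family {t : ℕ} (A : Multiset (Multiset G)) (hA : ∀ T ∈ A, T ≠ 0) :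
    ∀ {P : Multiset G}, HasZeroSums t (P + A.map Multiset.sum) → HasZeroSums t (P + A.sum) := by
  induction A using Multiset.induction_on with
  | empty => simp
  | cons T A ih =>
    intro P h
    rw [Multiset.sum_cons, add_left_comm]
    refine HasZeroSums.merge (hA T (by simp)) ?_
    rw [← Multiset.cons_add]
    refine ih (fun T hT => hA T (by simp [hT])) ?_
    simpa using h

theorem exists_le_map_eq {α β : Type*} (f : α → β) {M : Multiset β} :
    ∀ {Q : Multiset α}, M ≤ Q.map f → ∃ A ≤ Q, A.map f = M := by
  induction M using Multiset.induction_on with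
  | empty => exact fun _ => ⟨0, Multiset.zero_le _, rfl⟩
  | cons m M ih =>
    intro Q h
    obtain ⟨a, ha, rfl⟩ := Multiset.mem_map.1 (Multiset.mem_of_le h (Multiset.mem_cons_self m M))
    obtain ⟨Q, rfl⟩ := Multiset.exists_cons_of_mem ha
    rw [Multiset.map_cons, Multiset.cons_le_cons_iff] at h
    obtain ⟨A, hA, rfl⟩ := ih h
    exact ⟨a ::ₘ A, Multiset.cons_le_cons _ hA, by simp⟩

/-- Lets disjoint zero-sum subsequences of a multiple p • Q be pulled back to disjoint subsequences
of Q. -/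
theorem exists_sum_le_map_eq {α β : Type*} (f : α → β) {F : Multiset (Multiset β)} :
    ∀ {Q : Multiset α}, F.sum ≤ Q.map f →
      ∃ A : Multiset (Multiset α), A.sum ≤ Q ∧ A.map (Multiset.map f) = F := by
  induction F using Multiset.induction_on with
  | empty => exact fun _ => ⟨0, by simp, rfl⟩
  | cons m F ih =>
    intro Q h
    obtain ⟨B, hB, hBm⟩ := exists_le_map_eq f ((Multiset.le_add_right _ _).trans
      (by simpa using h : m + F.sum ≤ Q.map f))
    obtain ⟨Q, rfl⟩ := Multiset.le_iff_exists_add.1 hB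
    rw [Multiset.sum_cons, Multiset.map_add, hBm] at h
    obtain ⟨A, hA, rfl⟩ := ih (le_of_add_le_add_left h)
    exact ⟨B ::ₘ A, by simpa using hA, by simp [hBm]⟩

@[simp] theorem crossSum_zero : crossSum (0 : Multiset G) = 0 := by simp [crossSum]

@[simp] theorem crossSum_add (S T : Multiset G) :
    crossSum (S + T) = crossSum S + crossSum T := by simp [crossSum]

@[simp] theorem crossSum_cons (a : G) (S : Multiset G) :
    crossSum (a ::ₘ S) = 1 / (addOrderOf a : ℝ) + crossSum S := by simp [crossSum]

/-- The order of a multiple by a prime. -/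
theorem one_div_addOrderOf_eq [Finite G] {p : ℕ} (hp : p.Prime) (x : G) :
    1 / (addOrderOf x : ℝ) = (1 - 1 / (p : ℝ)) * (if p ∣ addOrderOf x then 0 else
      1 / (addOrderOf x : ℝ)) + (1 / p) * (1 / (addOrderOf (p • x) : ℝ)) := by
  have h0 := addOrderOf_pos x
  have hp0 : (p : ℝ) ≠ 0 := by exact_mod_cast hp.ne_zero
  have hx : (addOrderOf x : ℝ) ≠ 0 := by exact_mod_cast h0.ne'
  rw [addOrderOf_nsmul' x hp.ne_zero]
  split_ifs with h
  · obtain ⟨k, hk⟩ := h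
    have hk0 : (k : ℝ) ≠ 0 := by
      rintro h; norm_cast at h; simp [hk, h] at h0
    rw [hk, Nat.gcd_eq_right (Dvd.intro _ rfl), Nat.mul_div_cancel_left _ hp.pos]
    push_cast
    field_simp
    ring
  · rw [Nat.Coprime.gcd_eq_one ((hp.coprime_iff_not_dvd.2 h).symm), Nat.div_one]
    field_simp
    ring

/-- The averaging step: split off the elements killed by `p` and multiply the others by `p`. -/
theorem exists_average [Finite G] {p : ℕ} [hp : Fact p.Prime] {t R : ℕ} {S : Multiset G}
    (H : AddSubgroup G) (hS : ∀ x ∈ S, x ∈ H) (h0 : (0 : G) ∉ S) (ht : ¬ HasZeroSums (t + 1) S)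
    (hR : ∀ M : Multiset G, (∀ x ∈ M, x ∈ H ∧ p • x = 0) → R < M.card → HasZeroSums (t + 1) M) :
    ∃ n Q, n = (S.filter fun x => p • x = 0).card ∧ n ≤ R ∧ ¬ HasZeroSums (R - n + 1) Q ∧
      (∀ x ∈ Q, x ∈ H.map (nsmulAddMonoidHom p)) ∧
      crossSum S = n / p + (1 - 1 / (p : ℝ)) * crossSum (S.filter fun x => ¬ p ∣ addOrderOf x) +
        (1 / p) * crossSum Q := by
  set P := S.filter fun x => p • x = 0 with hP
  set Q := S.filter fun x => ¬ p • x = 0 with hQ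
  have hPQ : P + Q = S := Multiset.filter_add_not _ _
  have hPR : P.card ≤ R := by
    by_contra! h
    refine ht ((hR P (fun x hx => ?_) h).mono (Multiset.filter_le _ _))
    rw [hP, Multiset.mem_filter] at hx
    exact ⟨hS x hx.1, hx.2⟩
  refine ⟨P.card, Q.map (p • ·), rfl, hPR, ?_, ?_, ?_⟩
  · rintro ⟨F, h1, h2, h3⟩
    obtain ⟨A, hA, rfl⟩ := exists_sum_le_map_eq _ h2
    -- The sums of the R - n + 1 lifted subsequences are killed by p. Together with the n terms of
    -- `P` they are R + 1 elements of H[p], so `hR` applies, and expanding the sums contradicts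
    -- `ht`.
    refine ht (HasZeroSums.mono (HasZeroSums.merge_family (P := P) A ?_ (hR _ ?_ ?_)) ?_)
    · rintro T hT rfl
      exact (h3 _ (Multiset.mem_map_of_mem _ hT)).1 rfl
    · intro x hx
      rcases Multiset.mem_add.1 hx with hx | hx
      · rw [hP, Multiset.mem_filter] at hx
        exact ⟨hS x hx.1, hx.2⟩
      · obtain ⟨T, hT, rfl⟩ := Multiset.mem_map.1 hx
        constructor
        · refine AddSubgroup.multiset_sum_mem _ _ fun x hx => hS x ?_
          exact Multiset.mem_of_le (Multiset.filter_le _ _)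
            (Multiset.mem_of_le hA (mem_sum_iff.2 ⟨T, hT, hx⟩))
        · have := (h3 _ (Multiset.mem_map_of_mem _ hT)).2
          rwa [Multiset.sum_map_nsmul, Multiset.map_id'] at this
    · rw [Multiset.card_add, Multiset.card_map]
      rw [Multiset.card_map] at h1
      omega
    · rw [← hPQ]
      gcongr
  · intro x hx
    obtain ⟨y, hy, rfl⟩ := Multiset.mem_map.1 hx
    exact ⟨y, hS y (Multiset.mem_filter.1 hy).1, rfl⟩
  · have hcP : crossSum P = P.card / p := by
      have : ∀ x ∈ P, 1 / (addOrderOf x : ℝ) = 1 / p := fun x hx => by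
        rw [hP, Multiset.mem_filter] at hx
        rw [addOrderOf_eq_prime hx.2 (fun h => h0 (h ▸ hx.1))]
      rw [crossSum, Multiset.map_congr rfl this]
      simp [div_eq_mul_inv]
    have hcQ : ∀ U : Multiset G, crossSum U = (1 - 1 / (p : ℝ)) *
        crossSum (U.filter fun x => ¬ p ∣ addOrderOf x) +
        (1 / p) * crossSum (U.map (p • ·)) := by
      intro U
      induction U using Multiset.induction_on with
      | empty => simp
      | cons x U ih =>
        rw [crossSum_cons, ih, one_div_addOrderOf_eq hp.out x, Multiset.map_cons, crossSum_cons,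
          Multiset.filter_cons]
        split_ifs with h
        · simp; ring
        · simp; ring
    have hA : (S.filter fun x => ¬ p ∣ addOrderOf x) = Q.filter fun x => ¬ p ∣ addOrderOf x := by
      rw [hQ, Multiset.filter_filter]
      refine Multiset.filter_congr fun x hx => ⟨fun h => ⟨h, fun h' => ?_⟩, fun h => h.1⟩
      exact h (addOrderOf_eq_prime h' (fun h => h0 (h ▸ hx)) ▸ dvd_rfl)
    rw [← hPQ, crossSum_add, hPQ, hcP, hA, hcQ Q]
    ring

end ZeroSums

/-! ### Davenport constants of elementary groups and short zero-sums in rank two -/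

section Davenport

open scoped Classical

theorem HasZeroSums.map_one {G G' : Type*} [AddCommGroup G] [AddCommGroup G'] (f : G →+ G')
    {S : Multiset G} (h : HasZeroSums 1 S) : HasZeroSums 1 (S.map f) := by
  obtain ⟨T, h1, h2, h3⟩ := hasZeroSums_one.1 h
  exact hasZeroSums_one.2 ⟨T.map f, Multiset.map_le_map h1, by simpa using h2, by
    rw [← map_multiset_sum, h3, map_zero]⟩

/-- The Davenport constant of an elementary abelian group, by the Chevalley–Warning theorem. -/
theorem hasZeroSums_of_module {p : ℕ} [hp : Fact p.Prime] {V : Type*} [AddCommGroup V]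
    [Finite V] [Module (ZMod p) V] {d : ℕ} (hd : Nat.card V ≤ p ^ d) (M : Multiset V)
    (hM : d * (p - 1) < M.card) : HasZeroSums 1 M := by
  cases nonempty_fintype V
  have hfd : Module.finrank (ZMod p) V ≤ d := by
    have := Module.card_eq_pow_finrank (K := ZMod p) (V := V)
    rw [ZMod.card] at this
    rw [Nat.card_eq_fintype_card, this] at hd
    exact (Nat.pow_le_pow_iff_right hp.out.one_lt).1 hd
  let b : Module.Basis (Fin (Module.finrank (ZMod p) V)) (ZMod p) V := Module.finBasis (ZMod p) V
  induction M using Quotient.inductionOn with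
  | h l =>
  set v : Fin l.length → V := l.get with hv
  have hl : Finset.univ.val.map v = (l : Multiset V) := by
    rw [Fin.univ_val_map, hv]; simp
  change HasZeroSums 1 (l : Multiset V)
  have hlen : d * (p - 1) < l.length := hM
  -- On ZMod p the power X^(p-1) is the indicator of X ≠ 0, so the support of a nontrivial common
  -- zero indexes a zero-sum subsequence.
  let f : Fin (Module.finrank (ZMod p) V) → MvPolynomial (Fin l.length) (ZMod p) := fun k =>
    ∑ i, MvPolynomial.C (b.repr (v i) k) * MvPolynomial.X i ^ (p - 1)
  have hdeg : (∑ k, (f k).totalDegree) < Fintype.card (Fin l.length) := by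
    rw [Fintype.card_fin]
    refine lt_of_le_of_lt (Finset.sum_le_card_nsmul _ _ (p - 1) fun k _ => ?_) ?_
    · refine MvPolynomial.totalDegree_finsetSum_le fun i _ => ?_
      refine (MvPolynomial.totalDegree_mul _ _).trans ?_
      rw [MvPolynomial.totalDegree_C, MvPolynomial.totalDegree_X_pow, zero_add]
    · refine lt_of_le_of_lt ?_ hlen
      simpa using Nat.mul_le_mul_right _ hfd
  have hdvd := char_dvd_card_solutions_of_fintype_sum_lt p hdeg
  have hp1 : p - 1 ≠ 0 := by have := hp.out.two_le; omega
  let z : { x : Fin l.length → ZMod p // ∀ k, MvPolynomial.eval x (f k) = 0 } :=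
    ⟨0, fun k => by simp [f, hp1]⟩
  have hcard : 1 < Fintype.card { x : Fin l.length → ZMod p //
      ∀ k, MvPolynomial.eval x (f k) = 0 } :=
    lt_of_lt_of_le hp.out.one_lt (Nat.le_of_dvd (Fintype.card_pos_iff.2 ⟨z⟩) (by convert hdvd))
  obtain ⟨⟨x, hx⟩, hne⟩ := Fintype.exists_ne_of_one_lt_card hcard z
  have hx0 : x ≠ 0 := fun h => hne (Subtype.ext h)
  obtain ⟨i, hi⟩ := Function.ne_iff.1 hx0
  let s : Finset (Fin l.length) := Finset.univ.filter fun i => x i ≠ 0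
  refine hasZeroSums_one.2 ⟨s.val.map v, ?_, ?_, ?_⟩
  · rw [← hl]
    exact Multiset.map_le_map (Finset.val_le_iff.2 (Finset.filter_subset _ _))
  · have : i ∈ s := by simpa [s] using hi
    simpa using Finset.ne_empty_of_mem this
  · change ∑ i ∈ s, v i = 0
    refine b.ext_elem fun k => ?_
    have h1 := hx k
    simp only [f, map_sum, map_mul, MvPolynomial.eval_C, map_pow, MvPolynomial.eval_X] at h1
    rw [map_zero, map_sum, Finsupp.finsetSum_apply, Finset.sum_filter, Finsupp.zero_apply]
    refine Eq.trans ?_ h1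
    refine Finset.sum_congr rfl fun j _ => ?_
    split_ifs with h
    · rw [ZMod.pow_card_sub_one_eq_one h, mul_one]
    · rw [not_not.1 h, zero_pow hp1, mul_zero]

theorem hasZeroSums_of_elementary {p : ℕ} [hp : Fact p.Prime] {V : Type*} [AddCommGroup V]
    [Finite V] (hV : ∀ x : V, p • x = 0) {d : ℕ} (hd : Nat.card V ≤ p ^ d) (M : Multiset V)
    (hM : d * (p - 1) < M.card) : HasZeroSums 1 M :=
  @hasZeroSums_of_module p _ V _ _ (AddCommGroup.zmodModule hV) d hd M hM

theorem hasZeroSums_of_torsion {p : ℕ} [hp : Fact p.Prime] {G : Type*} [AddCommGroup G]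
    [Finite G] {K : AddSubgroup G} (hK : ∀ x ∈ K, p • x = 0) {d : ℕ} (hd : Nat.card K ≤ p ^ d)
    (M : Multiset G) (hMK : ∀ x ∈ M, x ∈ K) (hM : d * (p - 1) < M.card) : HasZeroSums 1 M := by
  lift M to Multiset K using hMK
  exact HasZeroSums.map_one K.subtype
    (hasZeroSums_of_elementary (fun x => Subtype.ext (hK x x.2)) hd M (by simpa using hM))

/-- In an elementary abelian group of rank two, `3p - 2` elements contain a short zero-sum
subsequence. -/
theorem exists_short_zeroSum {p : ℕ} [hp : Fact p.Prime] {G : Type*} [AddCommGroup G]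
    [Finite G] {K : AddSubgroup G} (hK : ∀ x ∈ K, p • x = 0) (hd : Nat.card K ≤ p ^ 2)
    (M : Multiset G) (hMK : ∀ x ∈ M, x ∈ K) (hM : 3 * p - 2 ≤ M.card) :
    ∃ T ≤ M, T ≠ 0 ∧ T.sum = 0 ∧ T.card ≤ p := by
  have hp2 := hp.out.two_le
  obtain ⟨M₀, hM₀, hc⟩ := exists_le_card_eq_of_le_card hM
  -- The extra coordinate 1 forces p to divide the length. The Davenport bound for p-rank three
  -- needs exactly 3(p - 1) + 1 = 3p - 2 terms, so the length is p or 2p.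
  have hz : HasZeroSums 1 (M₀.map fun x => (x, (1 : ZMod p))) := by
    refine hasZeroSums_of_torsion (p := p) (K := K.prod ⊤) (d := 3) ?_ ?_ _ ?_ ?_
    · rintro ⟨x, y⟩ hx
      exact Prod.ext (hK x hx.1) (by simp)
    · rw [Nat.card_congr (AddSubgroup.prodEquiv K ⊤).toEquiv, Nat.card_prod,
        AddSubgroup.card_top, Nat.card_zmod, pow_succ]
      gcongr
    · intro x hx
      obtain ⟨y, hy, rfl⟩ := Multiset.mem_map.1 hx
      exact ⟨hMK y (Multiset.mem_of_le hM₀ hy), trivial⟩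
    · rw [Multiset.card_map, hc]; omega
  obtain ⟨T', hT', hT0, hTs⟩ := hasZeroSums_one.1 hz
  obtain ⟨T, hT, rfl⟩ := exists_le_map_eq _ hT'
  have hs1 : T.sum = 0 := by
    have := congrArg (AddMonoidHom.fst G (ZMod p)) hTs
    rw [map_multiset_sum, Multiset.map_map] at this
    simpa using this
  have hs2 : p ∣ T.card := by
    have := congrArg (AddMonoidHom.snd G (ZMod p)) hTs
    rw [map_multiset_sum, Multiset.map_map] at this
    rw [← ZMod.natCast_eq_zero_iff]
    simpa using this
  have hT0' : T ≠ 0 := by rintro rfl; simp at hT0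
  have hle := Multiset.card_le_card hT
  obtain ⟨k, hk⟩ := hs2
  have hk0 : 0 < T.card := Multiset.card_pos.2 hT0'
  have hk3 : k < 3 := by
    by_contra! h
    have : p * 3 ≤ p * k := Nat.mul_le_mul_left _ h
    omega
  have hk1 : k ≠ 0 := by rintro rfl; omega
  obtain rfl | rfl : k = 1 ∨ k = 2 := by omega
  · exact ⟨T, hT.trans hM₀, hT0', hs1, by omega⟩
  -- A zero-sum of length 2p splits: any 2p - 1 of its terms contain a zero-sum `U`, whose
  -- complement in `T` is nonempty and also zero-sum. One of the two has length at most p.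
  · obtain ⟨T₁, hT₁, hc₁⟩ := exists_le_card_eq_of_le_card (S := T) (n := 2 * p - 1) (by omega)
    obtain ⟨U, hU, hU0, hUs⟩ := hasZeroSums_one.1 (hasZeroSums_of_torsion hK hd T₁ (fun x hx =>
      hMK x (Multiset.mem_of_le (hT₁.trans (hT.trans hM₀)) hx)) (by omega))
    obtain ⟨U', hU'⟩ := Multiset.le_iff_exists_add.1 (hU.trans hT₁)
    have hcU := Multiset.card_le_card hU
    have hcard : T.card = U.card + U'.card := by rw [hU', Multiset.card_add]
    have hUT : U ≤ T := hU.trans hT₁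
    by_cases h : U.card ≤ p
    · exact ⟨U, hUT.trans (hT.trans hM₀), hU0, hUs, h⟩
    · refine ⟨U', le_trans ?_ (hT.trans hM₀), ?_, ?_, by omega⟩
      · rw [hU']; exact Multiset.le_add_left _ _
      · rintro rfl; simp at hcard; omega
      · rw [hU', Multiset.sum_add, hUs, zero_add] at hs1
        exact hs1

end Davenport

/-! ### Reciprocal divisor sums and the excess of the counting bound -/

section Arithmetic

/-- The sum of the reciprocals of the divisors of `p ^ a`. -/
noncomputable def recipSum (p a : ℕ) : ℝ := ∑ j ∈ Finset.range (a + 1), 1 / (p : ℝ) ^ j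

/-- The sum of the reciprocals of the divisors of `∏ p ∈ C, p ^ β p`. -/
noncomputable def recipProd (C : Finset ℕ) (β : ℕ → ℕ) : ℝ := ∏ p ∈ C, recipSum p (β p)

/-- The amount by which the trivial bound for the cross number exceeds `∑ p ∈ C, (1 - 1 / p ^ β p)`
when every order divisible by `p` is taken at most `p - 1` times. -/
noncomputable def excess (C : Finset ℕ) (β : ℕ → ℕ) (y : ℝ) : ℝ :=
  ∑ p ∈ C, (1 - 1 / (p : ℝ) ^ β p) * (recipProd (C.filter (p < ·)) β * y - 1)

@[simp] theorem recipSum_zero (p : ℕ) : recipSum p 0 = 1 := by simp [recipSum]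

theorem recipSum_succ (p a : ℕ) : recipSum p (a + 1) = recipSum p a + 1 / (p : ℝ) ^ (a + 1) := by
  rw [recipSum, Finset.sum_range_succ]; rfl

theorem recipSum_mono {p a b : ℕ} (h : a ≤ b) : recipSum p a ≤ recipSum p b :=
  Finset.sum_le_sum_of_subset_of_nonneg (Finset.range_mono (by omega)) fun _ _ _ => by positivity

theorem one_le_recipSum (p a : ℕ) : 1 ≤ recipSum p a :=
  (recipSum_zero p).symm.trans_le (recipSum_mono (Nat.zero_le a))

theorem recipSum_one (p : ℕ) : recipSum p 1 = 1 + 1 / (p : ℝ) := by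
  rw [recipSum_succ]; simp

theorem one_add_le_recipSum {p a : ℕ} (ha : 1 ≤ a) : 1 + 1 / (p : ℝ) ≤ recipSum p a :=
  (recipSum_one p).symm.trans_le (recipSum_mono ha)

theorem sub_one_mul_recipSum {p : ℕ} (hp : 2 ≤ p) (a : ℕ) :
    1 - 1 / (p : ℝ) ^ a = (p - 1) * (recipSum p a - 1) := by
  have hp0 : (p : ℝ) ≠ 0 := by positivity
  induction a with
  | zero => simp
  | succ a ih =>
    rw [recipSum_succ, add_sub_right_comm, mul_add, ← ih]
    field_simp
    ring

theorem recipSum_eq {p : ℕ} (hp : 2 ≤ p) (a : ℕ) :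
    recipSum p a = 1 + (1 - 1 / (p : ℝ) ^ a) / (p - 1) := by
  have : (2 : ℝ) ≤ p := by exact_mod_cast hp
  have h1 : (p : ℝ) - 1 ≠ 0 := by linarith
  rw [sub_one_mul_recipSum hp]
  field_simp
  ring

theorem recipSum_le {p : ℕ} (hp : 2 ≤ p) (a : ℕ) : recipSum p a ≤ p / (p - 1) := by
  have : (2 : ℝ) ≤ p := by exact_mod_cast hp
  have h1 : (0 : ℝ) < p - 1 := by linarith
  rw [recipSum_eq hp, show (p : ℝ) / (p - 1) = 1 + 1 / (p - 1) by field_simp; ring]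
  gcongr
  have : 0 ≤ 1 / (p : ℝ) ^ a := by positivity
  linarith

theorem one_sub_pow_nonneg {p : ℕ} (hp : 2 ≤ p) (a : ℕ) : 0 ≤ 1 - 1 / (p : ℝ) ^ a := by
  have : (2 : ℝ) ≤ p := by exact_mod_cast hp
  rw [sub_one_mul_recipSum hp]
  exact mul_nonneg (by linarith) (by linarith [one_le_recipSum p a])

theorem one_sub_pow_le_one (p : ℕ) (a : ℕ) : 1 - 1 / (p : ℝ) ^ a ≤ 1 := by
  have : 0 ≤ 1 / (p : ℝ) ^ a := by positivity
  linarith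

theorem one_le_recipProd (C : Finset ℕ) (β : ℕ → ℕ) : 1 ≤ recipProd C β :=
  Finset.prod_induction _ (fun x => 1 ≤ x) (fun _ _ ha hb => one_le_mul_of_one_le_of_one_le ha hb)
    le_rfl fun _ _ => one_le_recipSum _ _

theorem recipProd_mono {C D : Finset ℕ} {β γ : ℕ → ℕ} (hC : C ⊆ D) (hβ : ∀ p ∈ C, β p ≤ γ p) :
    recipProd C β ≤ recipProd D γ := by
  refine (Finset.prod_le_prod (fun p _ => by linarith [one_le_recipSum p (β p)])
    fun p hp => recipSum_mono (hβ p hp)).trans ?_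
  exact Finset.prod_le_prod_of_subset_of_one_le hC
    (fun p _ => by linarith [one_le_recipSum p (γ p)]) fun p _ _ => one_le_recipSum _ _

theorem filter_lt_insert {a : ℕ} {C : Finset ℕ} (h : ∀ x ∈ C, a < x) :
    (insert a C).filter (a < ·) = C := by
  rw [Finset.filter_insert, if_neg (lt_irrefl a), Finset.filter_eq_self.2 h]

theorem sum_insert_min {a : ℕ} {C : Finset ℕ} (h : ∀ x ∈ C, a < x) (f : ℕ → Finset ℕ → ℝ) :
    ∑ p ∈ insert a C, f p ((insert a C).filter (p < ·)) =
      f a C + ∑ p ∈ C, f p (C.filter (p < ·)) := by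
  rw [Finset.sum_insert fun ha => lt_irrefl a (h a ha), filter_lt_insert h]
  congr 1
  refine Finset.sum_congr rfl fun p hp => ?_
  rw [Finset.filter_insert, if_neg (h p hp).not_gt]

theorem excess_insert {a : ℕ} {C : Finset ℕ} (h : ∀ x ∈ C, a < x) (β : ℕ → ℕ) (y : ℝ) :
    excess (insert a C) β y =
      (1 - 1 / (a : ℝ) ^ β a) * (recipProd C β * y - 1) + excess C β y :=
  sum_insert_min h fun p D => (1 - 1 / (p : ℝ) ^ β p) * (recipProd D β * y - 1)

theorem recipProd_insert {a : ℕ} {C : Finset ℕ} (h : ∀ x ∈ C, a < x) (β : ℕ → ℕ) :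
    recipProd (insert a C) β = recipSum a (β a) * recipProd C β :=
  Finset.prod_insert fun ha => lt_irrefl a (h a ha)

theorem excess_mono {C : Finset ℕ} (hC : ∀ p ∈ C, 2 ≤ p) {β γ : ℕ → ℕ} {y z : ℝ} (hy : 1 ≤ y)
    (hyz : y ≤ z) (hβ : ∀ p ∈ C, β p ≤ γ p) : excess C β y ≤ excess C γ z := by
  refine Finset.sum_le_sum fun p hp => ?_
  have h1 := recipProd_mono (Finset.Subset.refl (C.filter (p < ·)))
    (fun x hx => hβ x (Finset.mem_filter.1 hx).1)
  have h2 := one_le_recipProd (C.filter (p < ·)) β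
  have h3 : recipSum p (β p) ≤ recipSum p (γ p) := recipSum_mono (hβ p hp)
  have h4 : (2 : ℝ) ≤ p := by exact_mod_cast hC p hp
  refine mul_le_mul ?_ ?_ ?_ (one_sub_pow_nonneg (hC p hp) _)
  · rw [sub_one_mul_recipSum (hC p hp), sub_one_mul_recipSum (hC p hp)]
    exact mul_le_mul_of_nonneg_left (by linarith) (by linarith)
  · have := mul_le_mul h1 hyz (by linarith) (by linarith)
    linarith
  · nlinarith

/-- If `(p - 1) (P_p - 1) ≤ 1` for all `p`, where `P_p` is the product over the larger primes,
then the excess is at most the full product minus one. -/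
theorem excess_le_recipProd_sub_one {C : Finset ℕ} (hC : ∀ p ∈ C, 2 ≤ p) {β : ℕ → ℕ} {y : ℝ}
    (h : ∀ p ∈ C, 1 ≤ β p → ((p : ℝ) - 1) * (recipProd (C.filter (p < ·)) β * y - 1) ≤ 1) :
    excess C β y ≤ recipProd C β - 1 := by
  have h1 : excess C β y ≤ ∑ p ∈ C, (recipSum p (β p) - 1) := by
    refine Finset.sum_le_sum fun p hp => ?_
    rw [sub_one_mul_recipSum (hC p hp)]
    rcases Nat.eq_zero_or_pos (β p) with h0 | h0
    · simp [h0]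
    · have := one_le_recipSum p (β p)
      nlinarith [h p hp h0]
  refine h1.trans ?_
  clear h h1 hC
  induction C using Finset.induction_on with
  | empty => simp [recipProd]
  | insert a C ha ih =>
    rw [Finset.sum_insert ha, recipProd, Finset.prod_insert ha]
    have h2 := one_le_recipProd C β
    rw [recipProd] at h2 ih
    nlinarith [one_le_recipSum a (β a)]

theorem sum_divisors_pow_mul {p : ℕ} (hp : p.Prime) {n : ℕ} (hn : ¬ p ∣ n) (a : ℕ) (f : ℕ → ℝ) :
    ∑ d ∈ (p ^ a * n).divisors, f d =
      ∑ i ∈ Finset.range (a + 1), ∑ d ∈ n.divisors, f (p ^ i * d) := by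
  have hc : (p ^ a).Coprime n := Nat.Coprime.pow_left _ ((hp.coprime_iff_not_dvd).2 hn)
  rw [Nat.divisors_mul, Finset.mul_def, Finset.sum_image hc.mul_injOn_divisors,
    Finset.sum_product, Nat.sum_divisors_prime_pow hp]

theorem sum_recip_divisors {C : Finset ℕ} (hC : ∀ p ∈ C, p.Prime) (β : ℕ → ℕ) {m : ℕ}
    (hm : ∀ p ∈ C, ¬ p ∣ m) : ∑ d ∈ ((∏ p ∈ C, p ^ β p) * m).divisors, 1 / (d : ℝ) =
      recipProd C β * ∑ d ∈ m.divisors, 1 / (d : ℝ) := by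
  induction C using Finset.induction_on with
  | empty => simp [recipProd]
  | insert a C ha ih =>
    have hpa := hC a (by simp)
    have hna : ¬ a ∣ (∏ p ∈ C, p ^ β p) * m := by
      rw [hpa.dvd_mul, hpa.prime.dvd_finsetProd_iff]
      rintro (⟨p, hp, h⟩ | h)
      · exact ha ((Nat.prime_dvd_prime_iff_eq hpa (hC p (by simp [hp]))).1
          (hpa.dvd_of_dvd_pow h) ▸ hp)
      · exact hm a (by simp) h
    rw [Finset.prod_insert ha, mul_assoc, sum_divisors_pow_mul hpa hna, recipProd,
      Finset.prod_insert ha, recipSum, mul_assoc, Finset.sum_mul]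
    refine Finset.sum_congr rfl fun i _ => ?_
    rw [← recipProd, ← ih (fun p hp => hC p (by simp [hp])) (fun p hp => hm p (by simp [hp])),
      Finset.mul_sum]
    refine Finset.sum_congr rfl fun d _ => ?_
    push_cast
    rw [one_div_mul_one_div]

/-- Each divisor that involves a prime of `C` is charged to the least such prime p, where the cap p
- 1 is strongest. The divisors charged to p are p^i d with i ≥ 1 and d composed of the larger primes
and `m`; this is why `excess` contains products over larger primes only. -/
theorem sum_weights_le {C : Finset ℕ} (hC : ∀ p ∈ C, p.Prime) (β : ℕ → ℕ) {m : ℕ}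
    (hm : ∀ p ∈ C, ¬ p ∣ m) (w : ℕ → ℝ) (hw : ∀ p ∈ C, ∀ d, p ∣ d → w d ≤ ((p : ℝ) - 1) / d) :
    ∑ d ∈ ((∏ p ∈ C, p ^ β p) * m).divisors, w d ≤ ∑ d ∈ m.divisors, w d +
      ∑ p ∈ C, (1 - 1 / (p : ℝ) ^ β p) *
        (recipProd (C.filter (p < ·)) β * ∑ d ∈ m.divisors, 1 / (d : ℝ)) := by
  induction C using Finset.induction_on_min with
  | empty => simp
  | insert a C ha ih =>
    have hpa := hC a (by simp)
    have ha' : a ∉ C := fun h => lt_irrefl a (ha a h)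
    have hna : ¬ a ∣ (∏ p ∈ C, p ^ β p) * m := by
      rw [hpa.dvd_mul, hpa.prime.dvd_finsetProd_iff]
      rintro (⟨p, hp, h⟩ | h)
      · exact ha' ((Nat.prime_dvd_prime_iff_eq hpa (hC p (by simp [hp]))).1
          (hpa.dvd_of_dvd_pow h) ▸ hp)
      · exact hm a (by simp) h
    have hC' : ∀ p ∈ C, p.Prime := fun p hp => hC p (by simp [hp])
    have hm' : ∀ p ∈ C, ¬ p ∣ m := fun p hp => hm p (by simp [hp])
    rw [Finset.prod_insert ha', mul_assoc, sum_divisors_pow_mul hpa hna,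
      Finset.sum_range_succ', sum_insert_min ha fun p D => (1 - 1 / (p : ℝ) ^ β p) *
        (recipProd D β * ∑ d ∈ m.divisors, 1 / (d : ℝ))]
    have h1 := ih hC' hm' fun p hp => hw p (by simp [hp])
    have h2 : ∑ k ∈ Finset.range (β a), ∑ d ∈ ((∏ p ∈ C, p ^ β p) * m).divisors,
        w (a ^ (k + 1) * d) ≤ (1 - 1 / (a : ℝ) ^ β a) *
          (recipProd C β * ∑ d ∈ m.divisors, 1 / (d : ℝ)) := by
      rw [← sum_recip_divisors hC' β hm', sub_one_mul_recipSum hpa.two_le, recipSum,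
        Finset.sum_range_succ', pow_zero, div_one, add_sub_cancel_right, mul_assoc,
        Finset.sum_mul, Finset.mul_sum]
      refine Finset.sum_le_sum fun k _ => ?_
      rw [Finset.mul_sum, Finset.mul_sum]
      refine Finset.sum_le_sum fun d _ => ?_
      refine (hw a (by simp) _ (Dvd.intro _ (by rw [pow_succ', mul_assoc]))).trans (le_of_eq ?_)
      push_cast
      rw [div_eq_mul_one_div, ← one_div_mul_one_div]
    simp only [pow_zero, one_mul]
    linarith

end Arithmetic

/-! ### Reduced sequences, merging and counting by orders -/

section Dense

open scoped Classical

variable {G : Type*} [AddCommGroup G]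

/-- Exponents describing a group with the given chain primes (`β`), a rank two component (`b`,
`b'`) and an elementary component (`c`). -/
structure Exponents where
  β : ℕ → ℕ
  b : ℕ
  b' : ℕ
  c : ℕ

/-- The conditions on the torsion of the ambient group. -/
structure ChainGroup (G : Type*) [AddCommGroup G] (C : Finset ℕ) (q ℓ s : ℕ) : Prop where
  prime : ∀ p ∈ C, p.Prime
  prime_q : q.Prime
  prime_l : ℓ.Prime
  q_notMem : q ∉ C
  l_notMem : ℓ ∉ C
  q_ne_l : q ≠ ℓ
  zeroSum : ∀ p ∈ C, ∀ M : Multiset G, (∀ x ∈ M, p • x = 0) → p ≤ M.card → HasZeroSums 1 M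
  zeroSum_q : ∀ M : Multiset G, (∀ x ∈ M, q • x = 0) → 2 * q ≤ M.card + 1 → HasZeroSums 1 M
  short_q : ∀ M : Multiset G, (∀ x ∈ M, q • x = 0) → 3 * q ≤ M.card + 2 →
    ∃ T ≤ M, T ≠ 0 ∧ T.sum = 0 ∧ T.card ≤ q
  zeroSum_l : ∀ M : Multiset G, (∀ x ∈ M, ℓ • x = 0) → s * (ℓ - 1) < M.card → HasZeroSums 1 M

/-- The exponents bound the structure of the subgroup `H`. -/
structure Shape (H : AddSubgroup G) (C : Finset ℕ) (q ℓ : ℕ) (E : Exponents) : Prop where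
  le : E.b' ≤ E.b
  kill : ∀ x ∈ H, ((∏ p ∈ C, p ^ E.β p) * (q ^ E.b * ℓ ^ E.c)) • x = 0
  zeroSum : ∀ M : Multiset G, (∀ x ∈ M, q • x = 0 ∧ ∃ y ∈ H, x = q ^ E.b' • y) → q ≤ M.card →
    HasZeroSums 1 M

/-- The expected value of the little cross number. -/
noncomputable def kBound (C : Finset ℕ) (q ℓ s : ℕ) (E : Exponents) : ℝ :=
  ∑ p ∈ C, (1 - 1 / (p : ℝ) ^ E.β p) + ((1 - 1 / (q : ℝ) ^ E.b) + (1 - 1 / (q : ℝ) ^ E.b')) +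
    s * (1 - 1 / (ℓ : ℝ) ^ E.c)

/-- `S` lies in `H`, has at most `t` disjoint zero-sum subsequences, and all of these have cross
number greater than one. -/
structure IsReduced (H : AddSubgroup G) (t : ℕ) (S : Multiset G) : Prop where
  mem : ∀ x ∈ S, x ∈ H
  not_hasZeroSums : ¬ HasZeroSums (t + 1) S
  one_lt : ∀ T ≤ S, T ≠ 0 → T.sum = 0 → 1 < crossSum T

/-- No order is taken by many elements. -/
structure IsDense (C : Finset ℕ) (q b' : ℕ) (W : Multiset G) : Prop where
  card_lt : ∀ p ∈ C, ∀ d, p ∣ d → (W.filter fun x => addOrderOf x = d).card < p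
  card_q_le : ∀ j, (W.filter fun x => addOrderOf x = q ^ (j + 1)).card + 3 ≤ 3 * q
  card_q_lt : ∀ j, b' ≤ j → (W.filter fun x => addOrderOf x = q ^ (j + 1)).card < q

theorem IsReduced.zero_notMem {H : AddSubgroup G} {t : ℕ} {S : Multiset G}
    (h : IsReduced H t S) : (0 : G) ∉ S := fun h0 => by
  have := h.one_lt {0} (by simpa using h0) (by simp) (by simp)
  simp [crossSum] at this

theorem IsReduced.mono {H : AddSubgroup G} {t : ℕ} {S T : Multiset G}
    (h : IsReduced H t S) (hT : T ≤ S) : IsReduced H t T :=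
  ⟨fun x hx => h.mem x (Multiset.mem_of_le hT hx), fun h' => h.not_hasZeroSums (h'.mono hT),
    fun U hU => h.one_lt U (hU.trans hT)⟩

/-- A zero-sum subsequence through the new term expands to one through `T`. By `hc` this does not
increase its cross number, so it stays above one. -/
theorem IsReduced.merge {H : AddSubgroup G} {t : ℕ} {T U : Multiset G}
    (h : IsReduced H t (T + U)) (hT : T ≠ 0) (hc : crossSum T ≤ 1 / (addOrderOf T.sum : ℝ)) :
    IsReduced H t (T.sum ::ₘ U) := by
  refine ⟨fun x hx => ?_, fun h' => h.not_hasZeroSums (h'.merge hT), fun V hV hV0 hVs => ?_⟩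
  · rcases Multiset.mem_cons.1 hx with rfl | hx
    · exact AddSubgroup.multiset_sum_mem _ _ fun x hx => h.mem x (by simp [hx])
    · exact h.mem x (by simp [hx])
  · by_cases hm : T.sum ∈ V
    · obtain ⟨V, rfl⟩ := Multiset.exists_cons_of_mem hm
      rw [Multiset.cons_le_cons_iff] at hV
      rw [Multiset.sum_cons, ← Multiset.sum_add] at hVs
      have := h.one_lt (T + V) (by gcongr) (by simp [hT]) hVs
      rw [crossSum_add] at this
      rw [crossSum_cons]
      linarith
    · exact h.one_lt V (((Multiset.le_cons_of_notMem hm).1 hV).trans (Multiset.le_add_left _ _))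
        hV0 hVs

theorem crossSum_eq_of_order {M : Multiset G} {d : ℕ} (hM : ∀ x ∈ M, addOrderOf x = d) :
    crossSum M = M.card / (d : ℝ) := by
  have : ∀ x ∈ M, 1 / (addOrderOf x : ℝ) = 1 / d := fun x hx => by rw [hM x hx]
  rw [crossSum, Multiset.map_congr rfl this]
  simp [div_eq_mul_inv]

/-- If at most p elements of order d have a sum killed by d/p, their cross number is at most p/d,
while the sum has order at most d/p. A single element of order d is not killed by d/p, so there are
at least two terms. -/
theorem exists_mergeable [Finite G] {p d : ℕ} (hp : p.Prime) (hpd : p ∣ d) {M : Multiset G}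
    (hM : ∀ x ∈ M, addOrderOf x = d)
    (h : ∃ T ≤ M.map ((d / p) • ·), T ≠ 0 ∧ T.sum = 0 ∧ T.card ≤ p) :
    ∃ T ≤ M, 2 ≤ T.card ∧ crossSum T ≤ 1 / (addOrderOf T.sum : ℝ) := by
  obtain ⟨_, hT, hT0, hTs, hTc⟩ := h
  obtain ⟨A, hA, rfl⟩ := exists_le_map_eq _ hT
  obtain ⟨k, rfl⟩ := hpd
  rw [Nat.mul_div_cancel_left _ hp.pos] at hTs
  rw [Multiset.sum_map_nsmul, Multiset.map_id'] at hTs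
  rw [Multiset.card_map] at hTc
  have hA0 : A ≠ 0 := by rintro rfl; simp at hT0
  obtain ⟨x, hx⟩ := Multiset.exists_mem_of_ne_zero hA0
  have hk : 0 < k := Nat.pos_of_mul_pos_left
    ((hM x (Multiset.mem_of_le hA hx)) ▸ addOrderOf_pos x)
  refine ⟨A, hA, ?_, ?_⟩
  · by_contra! hlt
    have h1 : A.card = 1 := by have := Multiset.card_pos.2 hA0; omega
    obtain ⟨y, rfl⟩ := Multiset.card_eq_one.1 h1
    rw [Multiset.sum_singleton] at hTs
    have := Nat.le_of_dvd hk (addOrderOf_dvd_of_nsmul_eq_zero hTs)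
    rw [hM y (Multiset.mem_of_le hA (by simp))] at this
    nlinarith [hp.two_le]
  · rw [crossSum_eq_of_order fun x hx => hM x (Multiset.mem_of_le hA hx)]
    have h1 : addOrderOf A.sum ≤ k := Nat.le_of_dvd hk (addOrderOf_dvd_of_nsmul_eq_zero hTs)
    have h2 := addOrderOf_pos A.sum
    have hp0 : (0 : ℝ) < p := by exact_mod_cast hp.pos
    have hk0 : (0 : ℝ) < k := by exact_mod_cast hk
    calc (A.card : ℝ) / (p * k : ℕ) ≤ p / (p * k : ℕ) := by gcongr
      _ = 1 / k := by push_cast; field_simp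
      _ ≤ _ := by gcongr

theorem nsmul_div_eq_zero {p d : ℕ} (hpd : p ∣ d) {x : G} (hx : addOrderOf x = d) :
    p • (d / p) • x = 0 := by
  rw [← mul_nsmul, Nat.div_mul_cancel hpd, ← hx, addOrderOf_nsmul_eq_zero]

/-- Each merge shortens the sequence without lowering its cross number, so the process stops. If
some order d were taken too often, the multiples by d/p would contain a zero-sum of length at most
p, and `exists_mergeable` would allow another merge. -/
theorem exists_isDense [Finite G] {C : Finset ℕ} {q ℓ s : ℕ} (hG : ChainGroup G C q ℓ s)
    {H : AddSubgroup G} {E : Exponents} (hH : Shape H C q ℓ E) {t : ℕ} :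
    ∀ {S : Multiset G}, IsReduced H t S →
      ∃ W, IsReduced H t W ∧ IsDense C q E.b' W ∧ crossSum S ≤ crossSum W := by
  suffices ∀ n, ∀ S : Multiset G, S.card = n → IsReduced H t S →
      ∃ W, IsReduced H t W ∧ IsDense C q E.b' W ∧ crossSum S ≤ crossSum W from
    fun {S} => this _ S rfl
  intro n
  induction n using Nat.strong_induction_on with
  | _ n ih =>
  intro S hn hS
  by_cases hm : ∃ T ≤ S, 2 ≤ T.card ∧ crossSum T ≤ 1 / (addOrderOf T.sum : ℝ)
  · obtain ⟨T, hT, h2, hc⟩ := hm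
    obtain ⟨U, rfl⟩ := Multiset.le_iff_exists_add.1 hT
    rw [Multiset.card_add] at hn
    obtain ⟨W, h3, h4, h5⟩ := ih (T.sum ::ₘ U).card (by rw [Multiset.card_cons]; omega) _ rfl
      (hS.merge (by rintro rfl; simp at h2) hc)
    refine ⟨W, h3, h4, le_trans ?_ h5⟩
    rw [crossSum_add, crossSum_cons]
    linarith
  · have key : ∀ {p d : ℕ}, p.Prime → p ∣ d → ¬ ∃ T ≤ (S.filter fun x => addOrderOf x = d).map
        ((d / p) • ·), T ≠ 0 ∧ T.sum = 0 ∧ T.card ≤ p := fun hp hpd h => by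
      obtain ⟨T, hT, h⟩ := exists_mergeable hp hpd (fun x hx => (Multiset.mem_filter.1 hx).2) h
      exact hm ⟨T, hT.trans (Multiset.filter_le _ _), h⟩
    have key' : ∀ {p d : ℕ}, p.Prime → p ∣ d → p ≤ (S.filter fun x => addOrderOf x = d).card →
        (∀ M ≤ (S.filter fun x => addOrderOf x = d).map ((d / p) • ·), p ≤ M.card →
          HasZeroSums 1 M) → False := fun {p d} hp hpd hle h => by
      obtain ⟨M, hM, hMc⟩ := exists_le_card_eq_of_le_card (n := p)
        (S := (S.filter fun x => addOrderOf x = d).map ((d / p) • ·)) (by simpa using hle)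
      obtain ⟨T, hT, hT0, hTs⟩ := hasZeroSums_one.1 (h M hM hMc.ge)
      exact key hp hpd ⟨T, hT.trans hM, hT0, hTs, hMc ▸ Multiset.card_le_card hT⟩
    refine ⟨S, hS, ⟨fun p hp d hpd => ?_, fun j => ?_, fun j hj => ?_⟩, le_rfl⟩
    · by_contra! hle
      refine key' (hG.prime p hp) hpd hle fun M hM hMc => hG.zeroSum p hp M (fun x hx => ?_) hMc
      obtain ⟨y, hy, rfl⟩ := Multiset.mem_map.1 (Multiset.mem_of_le hM hx)
      exact nsmul_div_eq_zero hpd (Multiset.mem_filter.1 hy).2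
    · by_contra! hle
      have hd : q ∣ q ^ (j + 1) := dvd_pow_self q j.succ_ne_zero
      refine key hG.prime_q hd (hG.short_q _ (fun x hx => ?_) (by rw [Multiset.card_map]; omega))
      obtain ⟨y, hy, rfl⟩ := Multiset.mem_map.1 hx
      exact nsmul_div_eq_zero hd (Multiset.mem_filter.1 hy).2
    · by_contra! hle
      have hd : q ∣ q ^ (j + 1) := dvd_pow_self q j.succ_ne_zero
      refine key' hG.prime_q hd hle fun M hM hMc => hH.zeroSum M (fun x hx => ?_) hMc
      obtain ⟨y, hy, rfl⟩ := Multiset.mem_map.1 (Multiset.mem_of_le hM hx)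
      rw [Multiset.mem_filter] at hy
      -- For order q^(j+1) the multiple is q^j y, which lies in q^b' H because j ≥ b'. There the
      -- q-torsion behaves as in rank one, so q elements suffice.
      refine ⟨nsmul_div_eq_zero hd hy.2, q ^ (j - E.b') • y,
        H.nsmul_mem (hS.mem y hy.1) _, ?_⟩
      rw [← mul_nsmul', ← pow_add, pow_succ, Nat.mul_div_cancel _ hG.prime_q.pos,
        Nat.add_sub_cancel' hj]

theorem crossSum_eq_sum {D : Finset ℕ} {W : Multiset G} (hW : ∀ x ∈ W, addOrderOf x ∈ D) :
    crossSum W = ∑ d ∈ D, crossSum (W.filter fun x => addOrderOf x = d) := by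
  induction W using Multiset.induction_on with
  | empty => simp
  | cons x W ih =>
    rw [crossSum_cons, ih fun y hy => hW y (by simp [hy])]
    simp only [Multiset.filter_cons, crossSum_add, Finset.sum_add_distrib]
    congr 1
    rw [Finset.sum_eq_single_of_mem _ (hW x (by simp))]
    · simp [crossSum]
    · intro d _ hd
      rw [if_neg hd.symm, crossSum_zero]

theorem crossSum_filter_order (W : Multiset G) (d : ℕ) :
    crossSum (W.filter fun x => addOrderOf x = d) =
      (W.filter fun x => addOrderOf x = d).card / (d : ℝ) :=
  crossSum_eq_of_order fun _ hx => (Multiset.mem_filter.1 hx).2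

theorem Shape.addOrderOf_dvd {H : AddSubgroup G} {C : Finset ℕ} {q ℓ : ℕ} {E : Exponents}
    (hH : Shape H C q ℓ E) {x : G} (hx : x ∈ H) :
    addOrderOf x ∣ (∏ p ∈ C, p ^ E.β p) * (q ^ E.b * ℓ ^ E.c) :=
  addOrderOf_dvd_of_nsmul_eq_zero (hH.kill x hx)

theorem IsDense.crossSum_le {C : Finset ℕ} {q ℓ s : ℕ} (hG : ChainGroup G C q ℓ s)
    {H : AddSubgroup G} {E : Exponents} (hH : Shape H C q ℓ E) (hc : E.c = 0) {W : Multiset G}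
    (hW : IsDense C q E.b' W) (hWH : ∀ x ∈ W, x ∈ H) :
    crossSum W ≤ crossSum (W.filter fun x => addOrderOf x ∣ q ^ E.b) +
      (∑ p ∈ C, (1 - 1 / (p : ℝ) ^ E.β p) + excess C E.β (recipSum q E.b)) := by
  have hq := hG.prime_q
  have hqm : ∀ p ∈ C, ¬ p ∣ q ^ E.b := fun p hp h => hG.q_notMem
    ((Nat.prime_dvd_prime_iff_eq (hG.prime p hp) hq).1 ((hG.prime p hp).dvd_of_dvd_pow h) ▸ hp)
  have hN : ((∏ p ∈ C, p ^ E.β p) * q ^ E.b) ≠ 0 :=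
    mul_ne_zero (Finset.prod_ne_zero_iff.2 fun p hp => pow_ne_zero _ (hG.prime p hp).ne_zero)
      (pow_ne_zero _ hq.ne_zero)
  rw [crossSum_eq_sum (D := ((∏ p ∈ C, p ^ E.β p) * q ^ E.b).divisors) fun x hx =>
    Nat.mem_divisors.2 ⟨by simpa [hc] using hH.addOrderOf_dvd (hWH x hx), hN⟩]
  refine (sum_weights_le hG.prime E.β hqm _ fun p hp d hpd => ?_).trans (add_le_add ?_ ?_)
  · rw [crossSum_filter_order]
    have := hW.card_lt p hp d hpd
    have h1 : ((W.filter fun x => addOrderOf x = d).card : ℝ) + 1 ≤ p := by exact_mod_cast this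
    gcongr
    linarith
  · rw [crossSum_eq_sum (D := (q ^ E.b).divisors) fun x hx =>
      Nat.mem_divisors.2 ⟨(Multiset.mem_filter.1 hx).2, pow_ne_zero _ hq.ne_zero⟩]
    refine le_of_eq (Finset.sum_congr rfl fun d hd => ?_)
    rw [Multiset.filter_filter]
    congr 1
    refine Multiset.filter_congr fun x _ => ⟨fun h => ⟨h, ?_⟩, fun h => h.1⟩
    rw [h]; exact Nat.dvd_of_mem_divisors hd
  · rw [excess, ← Finset.sum_add_distrib]
    refine le_of_eq (Finset.sum_congr rfl fun p _ => ?_)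
    rw [Nat.sum_divisors_prime_pow hq, recipSum]
    push_cast
    ring

theorem sum_range_one_sub {q : ℕ} (hq : 2 ≤ q) (b : ℕ) :
    ∑ k ∈ Finset.range b, ((q : ℝ) - 1) / (q : ℝ) ^ (k + 1) = 1 - 1 / (q : ℝ) ^ b := by
  rw [sub_one_mul_recipSum hq, recipSum, Finset.sum_range_succ', pow_zero, div_one,
    add_sub_cancel_right, Finset.mul_sum]
  exact Finset.sum_congr rfl fun k _ => div_eq_mul_one_div _ _

/-- Orders up to q^b' are taken at most 3(q - 1) times and higher ones at most q - 1 times. The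
result exceeds the q-part of k* by 1 - q^(-b') < 1. -/
theorem IsDense.crossSum_q_le {C : Finset ℕ} {q ℓ s : ℕ} (hG : ChainGroup G C q ℓ s)
    {b b' : ℕ} (hb : b' ≤ b) {W : Multiset G} (hW : IsDense C q b' W) (h0 : (0 : G) ∉ W) :
    crossSum (W.filter fun x => addOrderOf x ∣ q ^ b) ≤
      (1 - 1 / (q : ℝ) ^ b) + 2 * (1 - 1 / (q : ℝ) ^ b') := by
  have hq := hG.prime_q
  rw [crossSum_eq_sum (D := (q ^ b).divisors) fun x hx =>
      Nat.mem_divisors.2 ⟨(Multiset.mem_filter.1 hx).2, pow_ne_zero _ hq.ne_zero⟩,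
    Nat.sum_divisors_prime_pow hq, Finset.sum_range_succ']
  have h1 : (W.filter fun x => addOrderOf x ∣ q ^ b).filter (fun x => addOrderOf x = q ^ 0) = 0 := by
    refine Multiset.filter_eq_nil.2 fun x hx hx1 => h0 ?_
    rw [pow_zero, AddMonoid.addOrderOf_eq_one_iff] at hx1
    exact hx1 ▸ (Multiset.mem_filter.1 hx).1
  rw [h1, crossSum_zero, add_zero, ← sum_range_one_sub hq.two_le, ← sum_range_one_sub hq.two_le,
    Finset.mul_sum]
  have h2 : ∑ k ∈ Finset.range b', 2 * (((q : ℝ) - 1) / (q : ℝ) ^ (k + 1)) =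
      ∑ k ∈ Finset.range b, if k < b' then 2 * (((q : ℝ) - 1) / (q : ℝ) ^ (k + 1)) else 0 := by
    rw [← Finset.sum_filter]
    refine Finset.sum_congr ?_ fun _ _ => rfl
    ext k; simp; omega
  rw [h2, ← Finset.sum_add_distrib]
  refine Finset.sum_le_sum fun k _ => ?_
  rw [crossSum_filter_order]
  have h3 : ((W.filter fun x => addOrderOf x ∣ q ^ b).filter
      fun x => addOrderOf x = q ^ (k + 1)).card ≤
      (W.filter fun x => addOrderOf x = q ^ (k + 1)).card :=
    Multiset.card_le_card (Multiset.filter_le_filter _ (Multiset.filter_le _ _))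
  rw [Nat.cast_pow]
  split_ifs with hk
  · have h4 := hW.card_q_le k
    rw [mul_div_assoc', ← add_div]
    gcongr
    have : (((W.filter fun x => addOrderOf x ∣ q ^ b).filter
      fun x => addOrderOf x = q ^ (k + 1)).card : ℝ) + 3 ≤ 3 * q := by
      exact_mod_cast (by omega)
    linarith
  · have h4 := hW.card_q_lt k (by omega)
    rw [add_zero]
    gcongr
    have : (((W.filter fun x => addOrderOf x ∣ q ^ b).filter
      fun x => addOrderOf x = q ^ (k + 1)).card : ℝ) + 1 ≤ q := by
      exact_mod_cast (by omega)
    linarith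

end Dense

/-! ### Averaging data at the chain primes, at q and at ℓ -/

section Reduction

open scoped Classical

variable {G : Type*} [AddCommGroup G]

/-- The exponent of the group described by `E`. -/
def Exponents.period (C : Finset ℕ) (q ℓ : ℕ) (E : Exponents) : ℕ :=
  (∏ p ∈ C, p ^ E.β p) * (q ^ E.b * ℓ ^ E.c)

/-- The sum of all exponents. -/
def Exponents.size (C : Finset ℕ) (E : Exponents) : ℕ := ∑ p ∈ C, E.β p + E.b + E.b' + E.c

/-- Componentwise comparison. -/
structure Exponents.Le (E E' : Exponents) : Prop where
  β : ∀ p, E.β p ≤ E'.β p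
  b : E.b ≤ E'.b
  b' : E.b' ≤ E'.b'
  c : E.c ≤ E'.c

theorem Exponents.Le.size_le {E E' : Exponents} (h : E.Le E') (C : Finset ℕ) :
    E.size C ≤ E'.size C :=
  add_le_add (add_le_add (add_le_add (Finset.sum_le_sum fun p _ => h.β p) h.b) h.b') h.c

theorem Exponents.Le.trans {E E' E'' : Exponents} (h : E.Le E') (h' : E'.Le E'') : E.Le E'' :=
  ⟨fun p => (h.β p).trans (h'.β p), h.b.trans h'.b, h.b'.trans h'.b', h.c.trans h'.c⟩

theorem Exponents.Le.refl (E : Exponents) : E.Le E := ⟨fun _ => le_rfl, le_rfl, le_rfl, le_rfl⟩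

/-- Replace the exponent of the chain prime `p`. -/
def Exponents.setChain (E : Exponents) (p a : ℕ) : Exponents :=
  { E with β := Function.update E.β p a }

/-- Replace the exponents of the component of rank two. -/
def Exponents.setRankTwo (E : Exponents) (b b' : ℕ) : Exponents := { E with b := b, b' := b' }

/-- Remove the elementary component. -/
def Exponents.dropElementary (E : Exponents) : Exponents := { E with c := 0 }

theorem Exponents.setChain_le {E : Exponents} {p a : ℕ} (h : a ≤ E.β p) : (E.setChain p a).Le E :=
  ⟨fun x => by
    by_cases hx : x = p
    · subst hx; simpa [setChain] using h
    · simp [setChain, hx], le_rfl, le_rfl, le_rfl⟩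

theorem Exponents.setRankTwo_le {E : Exponents} {b b' : ℕ} (h : b ≤ E.b) (h' : b' ≤ E.b') :
    (E.setRankTwo b b').Le E := ⟨fun _ => le_rfl, h, h', le_rfl⟩

theorem Exponents.dropElementary_le {E : Exponents} : E.dropElementary.Le E :=
  ⟨fun _ => le_rfl, le_rfl, le_rfl, Nat.zero_le _⟩

theorem prod_setChain {M : Type*} [CommMonoid M] {C : Finset ℕ} {p : ℕ} (hp : p ∈ C)
    (E : Exponents) (a : ℕ) (f : ℕ → ℕ → M) :
    ∏ r ∈ C, f r ((E.setChain p a).β r) = f p a * ∏ r ∈ C.erase p, f r (E.β r) := by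
  rw [← Finset.mul_prod_erase C _ hp]
  congr 1
  · simp [Exponents.setChain]
  · refine Finset.prod_congr rfl fun r hr => ?_
    simp [Exponents.setChain, Finset.ne_of_mem_erase hr]

theorem sum_setChain {M : Type*} [AddCommMonoid M] {C : Finset ℕ} {p : ℕ} (hp : p ∈ C)
    (E : Exponents) (a : ℕ) (f : ℕ → ℕ → M) :
    ∑ r ∈ C, f r ((E.setChain p a).β r) = f p a + ∑ r ∈ C.erase p, f r (E.β r) :=
  prod_setChain (M := Multiplicative M) hp E a f

/-- The elements of `H` killed by `n`. -/
def torsionIn (H : AddSubgroup G) (n : ℕ) : AddSubgroup G :=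
  H ⊓ (nsmulAddMonoidHom n : G →+ G).ker

theorem mem_torsionIn {H : AddSubgroup G} {n : ℕ} {x : G} :
    x ∈ torsionIn H n ↔ x ∈ H ∧ n • x = 0 := Iff.rfl

/-- The rank two component is either kept or dropped entirely. When it is dropped, the new period is
prime to q, so the only element killed by q is 0, and `HasZeroSums` is immediate. -/
theorem Shape.restrict {C : Finset ℕ} {q ℓ s : ℕ} (hG : ChainGroup G C q ℓ s)
    {H : AddSubgroup G} {E E' : Exponents} (hH : Shape H C q ℓ E)
    (h : E'.b = E.b ∧ E'.b' = E.b' ∨ E'.b = 0 ∧ E'.b' = 0) :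
    Shape (torsionIn H (E'.period C q ℓ)) C q ℓ E' := by
  refine ⟨?_, fun x hx => hx.2, fun M hM hMc => ?_⟩
  · have := hH.le; omega
  · rcases h with ⟨hb, hb'⟩ | ⟨hb, hb'⟩
    · refine hH.zeroSum M (fun x hx => ⟨(hM x hx).1, ?_⟩) hMc
      obtain ⟨y, hy, h⟩ := (hM x hx).2
      exact ⟨y, hy.1, hb' ▸ h⟩
    · obtain ⟨x, hx⟩ := Multiset.card_pos_iff_exists_mem.1 (hG.prime_q.pos.trans_le hMc)
      refine HasZeroSums.of_mem_zero (?_ : (0 : G) ∈ M)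
      obtain ⟨h1, y, hy, h2⟩ := hM x hx
      rw [hb', pow_zero, one_nsmul] at h2
      subst h2
      have hq := hG.prime_q
      have hcop : q.Coprime (E'.period C q ℓ) := by
        rw [hq.coprime_iff_not_dvd, Exponents.period, hb, pow_zero, one_mul, hq.dvd_mul,
          hq.prime.dvd_finsetProd_iff]
        rintro (⟨p, hp, h⟩ | h)
        · exact hG.q_notMem ((Nat.prime_dvd_prime_iff_eq hq (hG.prime p hp)).1
            (hq.dvd_of_dvd_pow h) ▸ hp)
        · exact hG.q_ne_l ((Nat.prime_dvd_prime_iff_eq hq hG.prime_l).1 (hq.dvd_of_dvd_pow h))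
      have h3 := Nat.dvd_gcd (addOrderOf_dvd_of_nsmul_eq_zero h1)
        (addOrderOf_dvd_of_nsmul_eq_zero hy.2)
      rw [hcop.gcd_eq_one, Nat.dvd_one, AddMonoid.addOrderOf_eq_one_iff] at h3
      exact h3 ▸ hx

theorem Shape.mem_torsionIn {C : Finset ℕ} {q ℓ : ℕ} {H : AddSubgroup G} {E E' : Exponents}
    (hH : Shape H C q ℓ E) {r a : ℕ} (hr : r.Prime)
    (hN : E.period C q ℓ = r ^ a * E'.period C q ℓ) {x : G} (hx : x ∈ H)
    (hrx : ¬ r ∣ addOrderOf x) : x ∈ torsionIn H (E'.period C q ℓ) := by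
  refine ⟨hx, addOrderOf_dvd_iff_nsmul_eq_zero.1 ?_⟩
  have h := hH.addOrderOf_dvd hx
  rw [← Exponents.period, hN] at h
  exact ((Nat.Coprime.pow_left a ((hr.coprime_iff_not_dvd).2 hrx)).symm).dvd_of_dvd_mul_left h

/-- The data of one averaging step at the prime `r`: `E` describes `H`, the elements of order
prime to `r` are described by `Ed`, and `r • H` is described by `Ep`. -/
structure Reduction (H : AddSubgroup G) (C : Finset ℕ) (q ℓ s : ℕ) (E : Exponents) (r R : ℕ)
    (Ed Ep : Exponents) : Prop where
  prime : r.Prime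
  mem : ∀ x ∈ H, ¬ r ∣ addOrderOf x → x ∈ torsionIn H (Ed.period C q ℓ)
  shape_drop : Shape (torsionIn H (Ed.period C q ℓ)) C q ℓ Ed
  shape_map : Shape (H.map (nsmulAddMonoidHom r)) C q ℓ Ep
  zeroSum : ∀ M : Multiset G, (∀ x ∈ M, x ∈ H ∧ r • x = 0) → R < M.card → HasZeroSums 1 M
  kBound_eq : kBound C q ℓ s E =
    R / r + (1 - 1 / (r : ℝ)) * kBound C q ℓ s Ed + (1 / r) * kBound C q ℓ s Ep
  drop_le : Ed.Le E
  map_le : Ep.Le E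
  drop_size_lt : Ed.size C < E.size C
  map_size_lt : Ep.size C < E.size C

theorem one_div_pow_pred {r : ℕ} (hr : 2 ≤ r) {a : ℕ} (ha : 1 ≤ a) :
    1 - 1 / (r : ℝ) ^ a = (r - 1) / r + (1 / r) * (1 - 1 / (r : ℝ) ^ (a - 1)) := by
  obtain ⟨a, rfl⟩ := Nat.exists_eq_add_of_le' ha
  have hr0 : (r : ℝ) ≠ 0 := by positivity
  rw [Nat.add_sub_cancel]
  field_simp
  ring

theorem Shape.reduction_chain {C : Finset ℕ} {q ℓ s : ℕ} (hG : ChainGroup G C q ℓ s)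
    {H : AddSubgroup G} {E : Exponents} (hH : Shape H C q ℓ E) {p : ℕ} (hp : p ∈ C)
    (hβ : 1 ≤ E.β p) :
    Reduction H C q ℓ s E p (p - 1) (E.setChain p 0) (E.setChain p (E.β p - 1)) := by
  have hpp := hG.prime p hp
  have hE : E.setChain p (E.β p) = E := by simp [Exponents.setChain]
  have hN : ∀ a, (E.setChain p a).period C q ℓ = p ^ a * (E.setChain p 0).period C q ℓ := by
    intro a
    rw [Exponents.period, Exponents.period, prod_setChain hp E a fun r k => r ^ k,
      prod_setChain hp E 0 fun r k => r ^ k]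
    simp only [Exponents.setChain, pow_zero, one_mul, mul_assoc]
  have hK : ∀ a, kBound C q ℓ s (E.setChain p a) =
      (1 - 1 / (p : ℝ) ^ a) + kBound C q ℓ s (E.setChain p 0) := by
    intro a
    rw [kBound, kBound, sum_setChain hp E a fun r k => 1 - 1 / (r : ℝ) ^ k,
      sum_setChain hp E 0 fun r k => 1 - 1 / (r : ℝ) ^ k]
    simp only [Exponents.setChain, pow_zero]
    ring
  have hS : ∀ a, (E.setChain p a).size C = a + (E.setChain p 0).size C := by
    intro a
    rw [Exponents.size, Exponents.size, sum_setChain hp E a fun r k => k,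
      sum_setChain hp E 0 fun r k => k]
    simp only [Exponents.setChain]
    ring
  have hNE := hE ▸ hN (E.β p)
  refine ⟨hpp, fun x hx hpx => hH.mem_torsionIn hpp hNE hx hpx, ?_, ?_, ?_, ?_, ?_, ?_, ?_, ?_⟩
  · exact hH.restrict hG (Or.inl ⟨rfl, rfl⟩)
  · refine ⟨hH.le, ?_, fun M hM hMc => hH.zeroSum M (fun x hx => ⟨(hM x hx).1, ?_⟩) hMc⟩
    · rintro _ ⟨y, hy, rfl⟩
      have h1 := hH.kill y hy
      rw [← Exponents.period] at h1 ⊢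
      rw [hN, nsmulAddMonoidHom_apply, ← mul_nsmul, ← mul_assoc, mul_comm p, ← pow_succ,
        Nat.sub_add_cancel hβ, ← hNE]
      exact h1
    · obtain ⟨_, ⟨y, hy, rfl⟩, h⟩ := (hM x hx).2
      exact ⟨_, H.nsmul_mem hy p, h⟩
  · intro M hM hMc
    exact hG.zeroSum p hp M (fun x hx => (hM x hx).2) (by omega)
  · rw [hK (E.β p - 1), show kBound C q ℓ s E = _ from hE ▸ hK (E.β p),
      one_div_pow_pred hpp.two_le hβ, Nat.cast_sub hpp.one_le]
    push_cast
    ring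
  · exact Exponents.setChain_le (Nat.zero_le _)
  · exact Exponents.setChain_le (Nat.sub_le _ _)
  · have := hS (E.β p)
    rw [hE] at this
    omega
  · have := hS (E.β p)
    have := hS (E.β p - 1)
    rw [hE] at *
    omega

/-- The q-torsion of H has rank at most one when b' = 0 and at most two otherwise, whence the two
values of R. For b' = 0 the truncated `E.b' - 1` is 0, as it should be. -/
theorem Shape.reduction_q {C : Finset ℕ} {q ℓ s : ℕ} (hG : ChainGroup G C q ℓ s)
    {H : AddSubgroup G} {E : Exponents} (hH : Shape H C q ℓ E) (hb : 1 ≤ E.b) :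
    Reduction H C q ℓ s E q (if E.b' = 0 then q - 1 else 2 * (q - 1)) (E.setRankTwo 0 0)
      (E.setRankTwo (E.b - 1) (E.b' - 1)) := by
  have hq := hG.prime_q
  have hN : ∀ a a', (E.setRankTwo a a').period C q ℓ = q ^ a *
      (E.setRankTwo 0 0).period C q ℓ := by
    intro a a'
    simp only [Exponents.period, Exponents.setRankTwo]
    ring
  have hNE : E.period C q ℓ = _ := hN E.b E.b'
  refine ⟨hq, fun x hx hpx => hH.mem_torsionIn hq hNE hx hpx, ?_, ?_, ?_, ?_, ?_, ?_, ?_, ?_⟩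
  · exact hH.restrict hG (Or.inr ⟨rfl, rfl⟩)
  · refine ⟨Nat.sub_le_sub_right hH.le 1, ?_,
      fun M hM hMc => hH.zeroSum M (fun x hx => ⟨(hM x hx).1, ?_⟩) hMc⟩
    · rintro _ ⟨y, hy, rfl⟩
      have h1 := hH.kill y hy
      rw [← Exponents.period] at h1 ⊢
      rw [hN, nsmulAddMonoidHom_apply, ← mul_nsmul, ← mul_assoc, mul_comm q, ← pow_succ,
        Nat.sub_add_cancel hb, ← hNE]
      exact h1
    · obtain ⟨_, ⟨y, hy, rfl⟩, h⟩ := (hM x hx).2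
      rw [nsmulAddMonoidHom_apply] at h
      rcases Nat.eq_zero_or_pos E.b' with h0 | h0
      · refine ⟨_, H.nsmul_mem hy q, h.trans ?_⟩
        simp [Exponents.setRankTwo, h0]
      · refine ⟨y, hy, h.trans ?_⟩
        simp only [Exponents.setRankTwo]
        rw [← mul_nsmul', ← pow_succ, Nat.sub_add_cancel h0]
  · intro M hM hMc
    have := hq.two_le
    split_ifs at hMc with h0
    · refine hH.zeroSum M (fun x hx => ⟨(hM x hx).2, x, (hM x hx).1, ?_⟩) (by omega)
      rw [h0, pow_zero, one_nsmul]
    · exact hG.zeroSum_q M (fun x hx => (hM x hx).2) (by omega)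
  · have h1 := hq.one_le
    simp only [kBound, Exponents.setRankTwo, pow_zero]
    rw [one_div_pow_pred hq.two_le hb]
    have hq0 : (q : ℝ) ≠ 0 := by exact_mod_cast hq.ne_zero
    split_ifs with h0
    · rw [h0, Nat.cast_sub h1]
      simp
      ring
    · rw [one_div_pow_pred hq.two_le (Nat.one_le_iff_ne_zero.2 h0), Nat.cast_mul, Nat.cast_sub h1]
      push_cast
      ring
  · exact Exponents.setRankTwo_le (Nat.zero_le _) (Nat.zero_le _)
  · exact Exponents.setRankTwo_le (Nat.sub_le _ _) (Nat.sub_le _ _)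
  · simp only [Exponents.size, Exponents.setRankTwo]
    omega
  · simp only [Exponents.size, Exponents.setRankTwo]
    omega

/-- The ℓ-component is elementary, so multiplying by ℓ removes it just as restricting to orders
prime to ℓ does; both exponents coincide. The case s = 0 is included, with R = 0. -/
theorem Shape.reduction_l {C : Finset ℕ} {q ℓ s : ℕ} (hG : ChainGroup G C q ℓ s)
    {H : AddSubgroup G} {E : Exponents} (hH : Shape H C q ℓ E) (hc : E.c = 1) :
    Reduction H C q ℓ s E ℓ (s * (ℓ - 1)) E.dropElementary E.dropElementary := by
  have hl := hG.prime_l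
  have hNE : E.period C q ℓ = ℓ ^ 1 * E.dropElementary.period C q ℓ := by
    simp only [Exponents.period, Exponents.dropElementary, hc]
    ring
  refine ⟨hl, fun x hx hpx => hH.mem_torsionIn hl hNE hx hpx, ?_, ?_, ?_, ?_, ?_, ?_, ?_, ?_⟩
  · exact hH.restrict hG (Or.inl ⟨rfl, rfl⟩)
  · refine ⟨hH.le, ?_, fun M hM hMc => hH.zeroSum M (fun x hx => ⟨(hM x hx).1, ?_⟩) hMc⟩
    · rintro _ ⟨y, hy, rfl⟩
      have h1 := hH.kill y hy
      rw [← Exponents.period] at h1 ⊢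
      rw [nsmulAddMonoidHom_apply, ← mul_nsmul]
      rwa [hNE, pow_one] at h1
    · obtain ⟨_, ⟨y, hy, rfl⟩, h⟩ := (hM x hx).2
      exact ⟨_, H.nsmul_mem hy ℓ, h⟩
  · intro M hM hMc
    exact hG.zeroSum_l M (fun x hx => (hM x hx).2) hMc
  · have hl0 : (ℓ : ℝ) ≠ 0 := by exact_mod_cast hl.ne_zero
    simp only [kBound, Exponents.dropElementary, hc, pow_zero, pow_one]
    rw [Nat.cast_mul, Nat.cast_sub hl.one_le]
    field_simp
    ring
  · exact Exponents.dropElementary_le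
  · exact Exponents.dropElementary_le
  · simp only [Exponents.size, Exponents.dropElementary]
    omega
  · simp only [Exponents.size, Exponents.dropElementary]
    omega

end Reduction

/-! ### The packing bound for few disjoint zero-sums -/

section Packing

open scoped Classical

/-- The bound for zero-sum free sequences. -/
def MainBound (G : Type*) [AddCommGroup G] (C : Finset ℕ) (q ℓ s : ℕ) (E : Exponents) : Prop :=
  ∀ H : AddSubgroup G, Shape H C q ℓ E → ∀ S : Multiset G, (∀ x ∈ S, x ∈ H) →
    ¬ HasZeroSums 1 S → crossSum S ≤ kBound C q ℓ s E

/-- The bound, with error `e`, for sequences with few disjoint zero-sum subsequences. -/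
def PackBound (G : Type*) [AddCommGroup G] (C : Finset ℕ) (q ℓ s : ℕ) (E : Exponents)
    (e : ℝ) : Prop :=
  ∀ H : AddSubgroup G, Shape H C q ℓ E → ∀ (u : ℕ) (S : Multiset G), (∀ x ∈ S, x ∈ H) →
    ¬ HasZeroSums (u + 1) S → crossSum S ≤ kBound C q ℓ s E + u + if u = 0 then 0 else e

variable {G : Type*} [AddCommGroup G]

/-- The packing bound for Q costs R - n + e. The R - n is absorbed exactly by `kBound_eq`, so slack
on the part of order prime to r is scaled by 1 - 1/r and only e/r is lost. -/
theorem Reduction.le_slack [Finite G] {H : AddSubgroup G} {C : Finset ℕ} {q ℓ s : ℕ}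
    {E Ed Ep : Exponents} {r R : ℕ} (h : Reduction H C q ℓ s E r R Ed Ep) {e : ℝ} (he : 0 ≤ e)
    (hP : PackBound G C q ℓ s Ep e) {S : Multiset G} (hS : ∀ x ∈ S, x ∈ H)
    (h1 : ¬ HasZeroSums 1 S) {L : ℝ}
    (hL : L ≤ kBound C q ℓ s Ed - crossSum (S.filter fun x => ¬ r ∣ addOrderOf x)) :
    (1 - 1 / (r : ℝ)) * L - e / r ≤ kBound C q ℓ s E - crossSum S := by
  have : Fact r.Prime := ⟨h.prime⟩
  obtain ⟨n, Q, -, hn, hQ, hQm, hc⟩ := exists_average (p := r) (t := 0) (R := R) H hS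
    (fun h0 => h1 (.of_mem_zero h0)) h1 h.zeroSum
  have h2 := hP _ h.shape_map _ _ hQm hQ
  rw [Nat.cast_sub hn] at h2
  have h3 : crossSum Q ≤ kBound C q ℓ s Ep + (R - n) + e := by
    refine h2.trans ?_
    split_ifs <;> linarith
  have hr1 : (1 : ℝ) ≤ r := by exact_mod_cast h.prime.one_le
  have hr0 : (r : ℝ) ≠ 0 := by linarith
  have h4 : 0 ≤ 1 - 1 / (r : ℝ) := by
    rw [sub_nonneg, div_le_one (by linarith)]; exact hr1
  have h5 := mul_le_mul_of_nonneg_left hL h4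
  have h6 := mul_le_mul_of_nonneg_left h3 (by positivity : 0 ≤ 1 / (r : ℝ))
  rw [h.kBound_eq, hc]
  have h7 : (1 / (r : ℝ)) * (kBound C q ℓ s Ep + (R - n) + e) =
      (1 / r) * kBound C q ℓ s Ep + R / r - n / r + e / r := by ring
  linarith

theorem kBound_eq_of_c {C : Finset ℕ} {q ℓ s : ℕ} {E : Exponents} (hc : E.c = 0) :
    kBound C q ℓ s E = ∑ p ∈ C, (1 - 1 / (p : ℝ) ^ E.β p) +
      ((1 - 1 / (q : ℝ) ^ E.b) + (1 - 1 / (q : ℝ) ^ E.b')) := by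
  simp [kBound, hc]

/-- The exponents of the `q`-component. -/
def Exponents.rankTwoPart (E : Exponents) : Exponents := ⟨fun _ => 0, E.b, E.b', 0⟩

theorem Exponents.rankTwoPart_le (E : Exponents) : E.rankTwoPart.Le E :=
  ⟨fun _ => Nat.zero_le _, le_rfl, le_rfl, Nat.zero_le _⟩

/-- Counting in a dense sequence loses at most 1 + e through the excess and less than 1 at q, which
suffices for u ≥ 2 or b' = 0. For u = 1 and b' > 0 the loss at q is avoided: either the q-part is
zero-sum free and obeys the main bound, or the part of order prime to q is zero-sum free and one
averages at q. -/
theorem packBound_of_mainBound [Finite G] {C : Finset ℕ} {q ℓ s : ℕ}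
    (hG : ChainGroup G C q ℓ s) {E : Exponents} (hc : E.c = 0) {e : ℝ} (he : 0 ≤ e)
    (hZ : excess C E.β (recipSum q E.b) ≤ 1 + e)
    (hM : ∀ E' : Exponents, E'.Le E → MainBound G C q ℓ s E')
    (hP : 1 ≤ E.b' → PackBound G C q ℓ s (E.setRankTwo (E.b - 1) (E.b' - 1)) e) :
    PackBound G C q ℓ s E e := by
  intro H hH u
  have hq := hG.prime_q
  have hq2 := hq.two_le
  induction u with
  | zero =>
    intro S hS h1
    simpa using hM E (.refl E) H hH S hS h1
  | succ v ih =>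
  intro S hS hv
  rw [if_neg v.succ_ne_zero]
  -- Splitting off such a `T` lowers u by one and the cross number by at most one.
  by_cases hshort : ∃ T ≤ S, T ≠ 0 ∧ T.sum = 0 ∧ crossSum T ≤ 1
  · obtain ⟨T, hT, hT0, hTs, hT1⟩ := hshort
    obtain ⟨S, rfl⟩ := Multiset.le_iff_exists_add.1 hT
    have := ih S (fun x hx => hS x (by simp [hx])) fun h => hv <| by
      rw [add_comm]
      exact (hasZeroSums_one.2 ⟨T, le_rfl, hT0, hTs⟩).add h
    rw [crossSum_add]
    push_cast
    split_ifs at this <;> linarith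
  push Not at hshort
  obtain ⟨W, hW, hWd, hle⟩ := exists_isDense hG hH (⟨hS, hv, hshort⟩ : IsReduced H (v + 1) S)
  refine hle.trans ?_
  have hcW := hWd.crossSum_le hG hH hc hW.mem
  have hcq := hWd.crossSum_q_le hG hH.le hW.zero_notMem
  have hv0 : (0 : ℝ) ≤ v := Nat.cast_nonneg v
  have hkE := kBound_eq_of_c (C := C) (q := q) (ℓ := ℓ) (s := s) hc
  push_cast
  by_cases hb' : E.b' = 0
  · have : (1 - 1 / (q : ℝ) ^ E.b') = 0 := by simp [hb']
    linarith
  by_cases hv1 : 1 ≤ v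
  · have h1 : (1 : ℝ) ≤ v := by exact_mod_cast hv1
    have := one_sub_pow_le_one q E.b'
    linarith
  obtain rfl : v = 0 := by omega
  set V := W.filter fun x => addOrderOf x ∣ q ^ E.b with hV
  by_cases hVz : HasZeroSums 1 V
  · have hb1 : 1 ≤ E.b := (Nat.one_le_iff_ne_zero.2 hb').trans hH.le
    have hred := hH.reduction_q hG hb1 (s := s)
    have : Fact q.Prime := ⟨hq⟩
    set A := W.filter fun x => ¬ q ∣ addOrderOf x with hA
    -- `A` and `V` are disjoint because 0 is not a term; a zero-sum in each would give two disjoint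
    -- ones in `W`.
    have hAz : ¬ HasZeroSums 1 A := fun h => hW.not_hasZeroSums <| by
      refine (hVz.add h).mono ?_
      rw [← Multiset.filter_add_not (fun x => addOrderOf x ∣ q ^ E.b) W]
      refine add_le_add le_rfl (Multiset.le_filter.2 ⟨Multiset.filter_le _ _, fun x hx h => ?_⟩)
      rw [hA, Multiset.mem_filter] at hx
      have h1 : addOrderOf x = 1 :=
        (Nat.Coprime.pow_right _ ((hq.coprime_iff_not_dvd).2 hx.2).symm).eq_one_of_dvd h
      exact hW.zero_notMem (AddMonoid.addOrderOf_eq_one_iff.1 h1 ▸ hx.1)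
    have hAle := hM _ hred.drop_le _ hred.shape_drop A
      (fun x hx => hred.mem x (hW.mem x (Multiset.mem_filter.1 hx).1) (Multiset.mem_filter.1 hx).2)
      hAz
    -- Among 3q - 1 elements of the q-torsion there is a zero-sum of length at most q, and the
    -- remaining 2q - 1 or more contain another. Since (3q - 2)/q = 2(q - 1)/q + 1, the surplus over
    -- k* is exactly u = 1.
    obtain ⟨n, Q, -, hn, hQ, hQm, hcr⟩ := exists_average (p := q) (t := 1) (R := 3 * q - 2) H
      hW.mem hW.zero_notMem hW.not_hasZeroSums fun M hMm hMc => by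
        obtain ⟨T, hT, hT0, hTs, hTc⟩ := hG.short_q M (fun x hx => (hMm x hx).2) (by omega)
        obtain ⟨U, rfl⟩ := Multiset.le_iff_exists_add.1 hT
        rw [Multiset.card_add] at hMc
        exact (hasZeroSums_one.2 ⟨T, le_rfl, hT0, hTs⟩).add
          (hG.zeroSum_q U (fun x hx => (hMm x (by simp [hx])).2) (by omega))
    have h2 := hP (Nat.one_le_iff_ne_zero.2 hb') _ hred.shape_map _ _ hQm hQ
    rw [Nat.cast_sub hn, Nat.cast_sub (by omega)] at h2
    push_cast at h2
    have h3 : crossSum Q ≤ kBound C q ℓ s (E.setRankTwo (E.b - 1) (E.b' - 1)) +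
        (3 * q - 2 - n) + e := by
      refine h2.trans ?_
      split_ifs <;> linarith
    have hid := hred.kBound_eq
    rw [if_neg hb', Nat.cast_mul, Nat.cast_sub hq.one_le] at hid
    push_cast at hid
    have hq1 : (1 : ℝ) ≤ q := by exact_mod_cast hq.one_le
    have hq0 : (q : ℝ) ≠ 0 := by linarith
    have h4 : 0 ≤ 1 - 1 / (q : ℝ) := by
      rw [sub_nonneg, div_le_one (by linarith)]; exact hq1
    have h5 := mul_le_mul_of_nonneg_left hAle h4
    have h6 := mul_le_mul_of_nonneg_left h3 (by positivity : 0 ≤ 1 / (q : ℝ))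
    have h7 : (1 / (q : ℝ)) * (kBound C q ℓ s (E.setRankTwo (E.b - 1) (E.b' - 1)) +
        (3 * q - 2 - n) + e) = (1 / q) * kBound C q ℓ s (E.setRankTwo (E.b - 1) (E.b' - 1)) +
        2 * (q - 1) / q + 1 - n / q + e / q := by field_simp; ring
    have h8 : e / q ≤ e := div_le_self he hq1
    simp only [Nat.cast_zero, zero_add]
    rw [hcr, hid]
    linarith
  · have h1 := hM _ E.rankTwoPart_le _
      (hH.restrict hG (E' := E.rankTwoPart) (Or.inl ⟨rfl, rfl⟩)) V (fun x hx => by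
        rw [hV, Multiset.mem_filter] at hx
        refine ⟨hW.mem x hx.1, addOrderOf_dvd_iff_nsmul_eq_zero.1 ?_⟩
        simpa [Exponents.period, Exponents.rankTwoPart] using hx.2) hVz
    rw [kBound_eq_of_c rfl] at h1
    simp only [Exponents.rankTwoPart, pow_zero, div_one, sub_self, Finset.sum_const_zero,
      zero_add] at h1
    simp only [Nat.cast_zero]
    linarith

end Packing

/-! ### Sequences without elements of order two and their slack -/

section Slack

open scoped Classical

/-- A zero-sum free sequence without elements of order two which contains every even order at most
once. -/
structure IsTwoGood {G : Type*} [AddCommGroup G] (S : Multiset G) : Prop where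
  zeroSumFree : ¬ HasZeroSums 1 S
  card_lt : ∀ d, 2 ∣ d → (S.filter fun x => addOrderOf x = d).card < 2
  two_nsmul : ∀ x ∈ S, 2 • x ≠ 0

theorem IsTwoGood.mono {G : Type*} [AddCommGroup G] {S T : Multiset G} (h : IsTwoGood S)
    (hT : T ≤ S) : IsTwoGood T :=
  ⟨fun h' => h.zeroSumFree (h'.mono hT), fun d hd => (Multiset.card_le_card
    (Multiset.filter_le_filter _ hT)).trans_lt (h.card_lt d hd),
    fun x hx => h.two_nsmul x (Multiset.mem_of_le hT hx)⟩

/-- The cross number of the sequences in question stays below the bound by at least `L`. -/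
def SlackBound (G : Type*) [AddCommGroup G] (C : Finset ℕ) (q ℓ s : ℕ) (E : Exponents)
    (L : ℝ) : Prop :=
  ∀ H : AddSubgroup G, Shape H C q ℓ E → ∀ S : Multiset G, (∀ x ∈ S, x ∈ H) →
    IsTwoGood S → L ≤ kBound C q ℓ s E - crossSum S

variable {G : Type*} [AddCommGroup G]

theorem SlackBound.mono {C : Finset ℕ} {q ℓ s : ℕ} {E : Exponents} {L L' : ℝ}
    (h : SlackBound G C q ℓ s E L) (hL : L' ≤ L) : SlackBound G C q ℓ s E L' :=
  fun H hH S hS h2 => hL.trans (h H hH S hS h2)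

theorem SlackBound.congr {C : Finset ℕ} {q ℓ s : ℕ} {E E' : Exponents} {L : ℝ}
    (h : SlackBound G C q ℓ s E L) (hβ : ∀ p ∈ C, E.β p = E'.β p) (hb : E.b = E'.b)
    (hb' : E.b' = E'.b') (hc : E.c = E'.c) : SlackBound G C q ℓ s E' L := by
  intro H hH S hS h2
  have h1 : kBound C q ℓ s E' = kBound C q ℓ s E := by
    rw [kBound, kBound, hb, hb', hc]
    congr 2
    exact Finset.sum_congr rfl fun p hp => by rw [hβ p hp]
  rw [h1]
  refine h H ⟨hb ▸ hb' ▸ hH.le, fun x hx => ?_, hb' ▸ hH.zeroSum⟩ S hS h2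
  have h3 := hH.kill x hx
  have h4 : ∏ p ∈ C, p ^ E'.β p = ∏ p ∈ C, p ^ E.β p :=
    Finset.prod_congr rfl fun p hp => by rw [hβ p hp]
  rwa [h4, ← hb, ← hc] at h3

theorem SlackBound.step [Finite G] {H : AddSubgroup G} {C : Finset ℕ} {q ℓ s : ℕ}
    {E Ed Ep : Exponents} {r R : ℕ} (hR : Reduction H C q ℓ s E r R Ed Ep) {e L : ℝ} (he : 0 ≤ e)
    (hP : PackBound G C q ℓ s Ep e) (hL : SlackBound G C q ℓ s Ed L) {S : Multiset G}
    (hS : ∀ x ∈ S, x ∈ H) (h2 : IsTwoGood S) :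
    (1 - 1 / (r : ℝ)) * L - e / r ≤ kBound C q ℓ s E - crossSum S :=
  hR.le_slack he hP hS h2.zeroSumFree (hL _ hR.shape_drop _ (fun x hx => by
    rw [Multiset.mem_filter] at hx
    exact hR.mem x (hS x hx.1) hx.2) (h2.mono (Multiset.filter_le _ _)))

/-- The part of `E` at the primes in `D`. -/
def Exponents.chainPart (E : Exponents) (D : Finset ℕ) : Exponents :=
  ⟨fun p => if p ∈ D then E.β p else 0, 0, 0, 0⟩

theorem Exponents.chainPart_le (E : Exponents) (D : Finset ℕ) : (E.chainPart D).Le E :=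
  ⟨fun p => by simp only [chainPart]; split_ifs <;> simp, Nat.zero_le _, Nat.zero_le _,
    Nat.zero_le _⟩

theorem recipProd_chainPart {C D : Finset ℕ} (E : Exponents) :
    recipProd C (E.chainPart D).β = recipProd (C.filter (· ∈ D)) E.β := by
  rw [recipProd, recipProd, Finset.prod_filter]
  refine Finset.prod_congr rfl fun p _ => ?_
  simp only [Exponents.chainPart]
  split_ifs <;> simp

theorem excess_chainPart {C D : Finset ℕ} (hD : D ⊆ C) (E : Exponents) (y : ℝ) :
    excess C (E.chainPart D).β y = excess D E.β y := by
  rw [excess, excess, ← Finset.sum_subset hD]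
  · refine Finset.sum_congr rfl fun p hp => ?_
    rw [recipProd_chainPart, Finset.filter_filter]
    have : C.filter (fun a => p < a ∧ a ∈ D) = D.filter (p < ·) := by
      ext a; simp only [Finset.mem_filter]; exact ⟨fun h => ⟨h.2.2, h.2.1⟩, fun h => ⟨hD h.1, h.2, h.1⟩⟩
    rw [this]
    simp [Exponents.chainPart, hp]
  · intro p _ hp
    simp [Exponents.chainPart, hp]

/-- The inductive hypothesis for sequences with few disjoint zero-sum subsequences. -/
def PackBelow (G : Type*) [AddCommGroup G] (C : Finset ℕ) (q ℓ s : ℕ) (E : Exponents) : Prop :=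
  ∀ E' : Exponents, E'.Le E → E'.size C < E.size C → E'.c = 0 → ∀ e : ℝ, 0 ≤ e →
    excess C E'.β (recipSum q E'.b) ≤ 1 + e → PackBound G C q ℓ s E' e

theorem SlackBound.insert_prime [Finite G] {C : Finset ℕ} {q ℓ s : ℕ} (hG : ChainGroup G C q ℓ s)
    {E : Exponents} (hP : PackBelow G C q ℓ s E) {D : Finset ℕ} {r : ℕ} (hr : r ∈ C)
    (hrD : r ∉ D) (hβ : 1 ≤ E.β r) {e L : ℝ} (he : 0 ≤ e)
    (hZ : excess C (E.chainPart (insert r D)).β 1 ≤ 1 + e)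
    (hL : SlackBound G C q ℓ s (E.chainPart D) L) :
    SlackBound G C q ℓ s (E.chainPart (insert r D)) ((1 - 1 / (r : ℝ)) * L - e / r) := by
  intro H hH S hS h2
  have hβ' : (E.chainPart (insert r D)).β r = E.β r := by simp [Exponents.chainPart]
  have hR := hH.reduction_chain hG hr (s := s) (by rw [hβ']; exact hβ)
  have hEd : (E.chainPart (insert r D)).setChain r 0 = E.chainPart D := by
    simp only [Exponents.setChain, Exponents.chainPart, Exponents.mk.injEq, and_true]
    funext p
    by_cases hp : p = r
    · subst hp; simp [hrD]
    · simp [hp]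
  rw [hEd] at hR
  refine SlackBound.step hR he (hP _ (hR.map_le.trans (E.chainPart_le _)) ?_ rfl e he ?_) hL hS h2
  · exact hR.map_size_lt.trans_le ((E.chainPart_le _).size_le C)
  · refine le_trans ?_ hZ
    exact excess_mono (fun p hp => (hG.prime p hp).two_le) (one_le_recipSum _ _)
      (recipSum_zero q).le fun p _ => hR.map_le.β p

/-- The step L ↦ (1 - 1/r)L - e/r multiplies L + e by 1 - 1/r. Combined with (1 - T)(1 - 1/r) ≥ 1 -
T - 1/r and 1/r ≤ `recipSum r a - 1`, this turns iterated steps into a sum of losses. -/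
theorem one_sub_mul_le {r : ℕ} (hr : 2 ≤ r) {a : ℕ} (ha : 1 ≤ a) {M T e : ℝ} (hM : 0 ≤ M)
    (hT : 0 ≤ T) : M * (1 - (T + (recipSum r a - 1))) - e ≤
      (1 - 1 / (r : ℝ)) * (M * (1 - T) - e) - e / r := by
  have h1 := one_add_le_recipSum (p := r) ha
  have h2 : (0 : ℝ) ≤ 1 / r := by positivity
  have : (1 - 1 / (r : ℝ)) * (M * (1 - T) - e) - e / r =
      M * (1 - (T + 1 / r)) + M * (T * (1 / r)) - e := by ring
  rw [this]
  have h3 : 0 ≤ M * (T * (1 / r)) := by positivity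
  have h4 : M * (1 - (T + (recipSum r a - 1))) ≤ M * (1 - (T + 1 / r)) :=
    mul_le_mul_of_nonneg_left (by linarith) hM
  linarith

theorem SlackBound.union [Finite G] {C : Finset ℕ} {q ℓ s : ℕ} (hG : ChainGroup G C q ℓ s)
    {E : Exponents} (hP : PackBelow G C q ℓ s E) {D : Finset ℕ} {e L : ℝ}
    (he : 0 ≤ e) (hLe : 0 ≤ L + e) (hZ : excess C E.β (recipSum q E.b) ≤ 1 + e)
    (hL : SlackBound G C q ℓ s (E.chainPart D) L) {D' : Finset ℕ} (hD' : D' ⊆ C)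
    (hdisj : Disjoint D' D) (hβ : ∀ p ∈ D', 1 ≤ E.β p) :
    SlackBound G C q ℓ s (E.chainPart (D' ∪ D))
      ((L + e) * (1 - ∑ p ∈ D', (recipSum p (E.β p) - 1)) - e) := by
  have hC2 : ∀ p ∈ C, 2 ≤ p := fun p hp => (hG.prime p hp).two_le
  induction D' using Finset.induction_on with
  | empty => simpa using hL
  | insert r D' hr ih =>
    have hrC := hD' (Finset.mem_insert_self r D')
    have hβr := hβ r (Finset.mem_insert_self r D')
    have hsub := (Finset.subset_insert r D').trans hD'
    rw [Finset.disjoint_insert_left] at hdisj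
    have h1 := ih hsub hdisj.2 fun p hp => hβ p (Finset.mem_insert_of_mem hp)
    rw [Finset.insert_union]
    refine (h1.insert_prime hG hP hrC ?_ hβr he ?_).mono ?_
    · simp [hr, hdisj.1]
    · refine le_trans ?_ hZ
      exact excess_mono hC2 le_rfl (one_le_recipSum _ _) fun p _ => (E.chainPart_le _).β p
    · rw [Finset.sum_insert hr, add_comm (recipSum r (E.β r) - 1)]
      exact one_sub_mul_le (hC2 r hrC) hβr hLe
        (Finset.sum_nonneg fun p _ => by linarith [one_le_recipSum p (E.β p)])

theorem sum_le_recipProd_sub_one (D : Finset ℕ) (β : ℕ → ℕ) :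
    ∑ p ∈ D, (recipSum p (β p) - 1) ≤ recipProd D β - 1 := by
  induction D using Finset.induction_on with
  | empty => simp [recipProd]
  | insert a C ha ih =>
    rw [Finset.sum_insert ha, recipProd, Finset.prod_insert ha]
    have h2 := one_le_recipProd C β
    rw [recipProd] at h2 ih
    nlinarith [one_le_recipSum a (β a)]

/-- If the slack at the primes in `D` is large enough, then it stays nonnegative when all other
primes are added. -/
theorem SlackBound.complete [Finite G] {C : Finset ℕ} {q ℓ s : ℕ} (hG : ChainGroup G C q ℓ s)
    {E : Exponents} (hP : PackBelow G C q ℓ s E) (hc : E.c ≤ 1) (hb : E.b' ≤ E.b)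
    {D : Finset ℕ} {e L F : ℝ} (he : 0 ≤ e) (hLe : 0 ≤ L + e)
    (hZ : excess C E.β (recipSum q E.b) ≤ 1 + e)
    (hL : SlackBound G C q ℓ s (E.chainPart D) L) {D' : Finset ℕ} (hD' : D' ⊆ C)
    (hdisj : Disjoint D' D) (hβ : ∀ p ∈ D', 1 ≤ E.β p)
    (hcov : ∀ p ∈ C, 1 ≤ E.β p → p ∈ D' ∪ D)
    (hF : recipProd D' E.β * recipSum q E.b * recipSum ℓ 1 ≤ F) (hfin : e ≤ (L + e) * (2 - F)) :
    SlackBound G C q ℓ s E 0 := by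
  set T := ∑ p ∈ D', (recipSum p (E.β p) - 1) with hT
  have hT0 : 0 ≤ T := Finset.sum_nonneg fun p _ => by linarith [one_le_recipSum p (E.β p)]
  have hTX := sum_le_recipProd_sub_one D' E.β
  have hX1 := one_le_recipProd D' E.β
  have hy1 := one_le_recipSum q E.b
  have hz1 := one_le_recipSum ℓ 1
  have hb0 : E.b = 0 → E.b' = 0 := by omega
  -- The chain primes are restored first, then q, and ℓ last: `PackBelow` only covers exponents with
  -- c = 0, and removing ℓ produces such exponents.
  have h1 : SlackBound G C q ℓ s ((E.setRankTwo 0 0).dropElementary) ((L + e) * (1 - T) - e) := by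
    refine (hL.union hG hP he hLe hZ hD' hdisj hβ).congr (fun p hp => ?_) rfl rfl rfl
    simp only [Exponents.chainPart, Exponents.setRankTwo, Exponents.dropElementary]
    split_ifs with h
    · rfl
    · by_contra h0
      exact h (hcov p hp (by omega))
  have h2 : SlackBound G C q ℓ s E.dropElementary
      ((L + e) * (1 - (T + (recipSum q E.b - 1))) - e) := by
    rcases Nat.eq_zero_or_pos E.b with h0 | h0
    · refine (h1.congr (E' := E.dropElementary) (fun p hp => rfl) h0.symm
        (hb0 h0).symm rfl).mono (le_of_eq ?_)
      rw [h0, recipSum_zero]; ring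
    · intro H hH S hS h2
      have hR := hH.reduction_q hG (s := s) h0
      refine (one_sub_mul_le hG.prime_q.two_le h0 hLe hT0).trans (SlackBound.step hR he
        (hP _ (hR.map_le.trans E.dropElementary_le) ?_ rfl e he ?_) h1 hS h2)
      · exact hR.map_size_lt.trans_le (E.dropElementary_le.size_le C)
      · refine le_trans ?_ hZ
        exact excess_mono (fun p hp => (hG.prime p hp).two_le) (one_le_recipSum _ _)
          (recipSum_mono hR.map_le.b) fun p _ => hR.map_le.β p
  -- For factors at least one, the sum of the x_i - 1 is at most the product minus one. Hence the
  -- total loss is controlled by the same product as the width condition.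
  have hFT : T + (recipSum q E.b - 1) + (recipSum ℓ 1 - 1) ≤ F - 1 := by
    refine le_trans ?_ (sub_le_sub_right hF 1)
    have h3 : recipProd D' E.β + recipSum q E.b - 1 ≤ recipProd D' E.β * recipSum q E.b := by
      nlinarith
    have h4 : 1 ≤ recipProd D' E.β * recipSum q E.b := by nlinarith
    nlinarith
  have h5 : 0 ≤ (L + e) * (1 - (T + (recipSum q E.b - 1) + (recipSum ℓ 1 - 1))) - e := by
    nlinarith
  rcases Nat.eq_zero_or_pos E.c with h0 | h0
  · refine (h2.congr (E' := E) (fun p hp => rfl) rfl rfl h0.symm).mono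
      (h5.trans (sub_le_sub_right (mul_le_mul_of_nonneg_left (by linarith) hLe) e))
  · intro H hH S hS h2'
    have hR := hH.reduction_l hG (s := s) (by omega)
    refine h5.trans ((one_sub_mul_le hG.prime_l.two_le le_rfl hLe (by linarith)).trans
      (SlackBound.step hR he (hP _ hR.map_le hR.map_size_lt rfl e he hZ) h2 hS h2'))

/-- Only the orders 4, 8, ..., 2^(a+1) occur, each at most once. Their reciprocals sum to 1/2 -
2^(-a-1), against k* = 1 - 2^(-a-1). -/
theorem slackBound_two {C : Finset ℕ} {q ℓ s : ℕ} {E : Exponents} (h2C : 2 ∈ C) (hβ : 1 ≤ E.β 2) :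
    SlackBound G C q ℓ s (E.chainPart {2}) (1 / 2) := by
  intro H hH S hS h2
  obtain ⟨a, ha⟩ := Nat.exists_eq_add_of_le' hβ
  have hper : (∏ p ∈ C, p ^ (E.chainPart {2}).β p) = 2 ^ (a + 1) := by
    rw [Finset.prod_eq_single_of_mem 2 h2C]
    · simp [Exponents.chainPart, ha]
    · intro p _ hp; simp [Exponents.chainPart, hp]
  have hk : kBound C q ℓ s (E.chainPart {2}) = 1 - 1 / (2 : ℝ) ^ (a + 1) := by
    rw [kBound_eq_of_c rfl, Finset.sum_eq_single_of_mem 2 h2C]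
    · simp [Exponents.chainPart, ha]
    · intro p _ hp; simp [Exponents.chainPart, hp]
  have hord : ∀ x ∈ S, addOrderOf x ∈ (2 ^ (a + 1)).divisors := fun x hx => by
    have := hH.addOrderOf_dvd (hS x hx)
    rw [hper] at this
    exact Nat.mem_divisors.2 ⟨by simpa [Exponents.chainPart] using this, by positivity⟩
  have hz : ∀ k ≤ 1, crossSum (S.filter fun x => addOrderOf x = 2 ^ k) = 0 := fun k hk => by
    rw [Multiset.filter_eq_nil.2, crossSum_zero]
    intro x hx hx2
    refine h2.two_nsmul x hx (addOrderOf_dvd_iff_nsmul_eq_zero.1 ?_)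
    rw [hx2]
    exact (pow_dvd_pow 2 hk).trans (by simp)
  rw [hk, crossSum_eq_sum hord, Nat.sum_divisors_prime_pow Nat.prime_two, Finset.sum_range_succ',
    Finset.sum_range_succ', hz 0 zero_le_one, hz (0 + 1) le_rfl]
  have h3 := sum_range_one_sub (q := 2) le_rfl a
  have h4 : ∑ k ∈ Finset.range a, crossSum (S.filter fun x => addOrderOf x = 2 ^ (k + 1 + 1)) ≤
      ∑ k ∈ Finset.range a, (1 / 2) * ((((2 : ℕ) : ℝ) - 1) / ((2 : ℕ) : ℝ) ^ (k + 1)) := by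
    refine Finset.sum_le_sum fun k _ => ?_
    rw [crossSum_filter_order]
    have h5 := h2.card_lt (2 ^ (k + 1 + 1)) (dvd_pow_self 2 (by omega))
    have h6 : ((S.filter fun x => addOrderOf x = 2 ^ (k + 1 + 1)).card : ℝ) ≤ 1 := by
      exact_mod_cast Nat.lt_succ_iff.1 h5
    calc _ ≤ (1 : ℝ) / (2 ^ (k + 1 + 1) : ℕ) := by gcongr
      _ = _ := by push_cast; rw [pow_succ _ (k + 1)]; field_simp; ring
  rw [← Finset.mul_sum, h3] at h4
  push_cast at h4
  rw [pow_succ]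
  have : 1 / ((2 : ℝ) ^ a * 2) = (1 / 2) * (1 / 2 ^ a) := by field_simp
  linarith

end Slack

/-! ### The width condition and the two cases of the main induction -/

section Induction

open scoped Classical

/-- Every prime of `P` is small compared to the larger ones, with an additional factor `z`. -/
def WideOn (P : Finset ℕ) (β : ℕ → ℕ) (z : ℝ) : Prop :=
  ∀ p ∈ P, recipProd (P.filter (p < ·)) β * z ≤ p / (p - 1)

theorem WideOn.of_insert {a : ℕ} {P : Finset ℕ} (ha : ∀ x ∈ P, a < x) {β : ℕ → ℕ} {z : ℝ}
    (h : WideOn (insert a P) β z) : recipProd P β * z ≤ a / (a - 1) ∧ WideOn P β z := by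
  refine ⟨?_, fun p hp => ?_⟩
  · have := h a (by simp)
    rwa [filter_lt_insert ha] at this
  · have := h p (by simp [hp])
    rwa [Finset.filter_insert, if_neg (ha p hp).not_gt] at this

theorem exists_insert_min {P : Finset ℕ} (h : P.Nonempty) :
    ∃ a P', P = insert a P' ∧ ∀ x ∈ P', a < x :=
  ⟨P.min' h, P.erase (P.min' h), (Finset.insert_erase (P.min'_mem h)).symm,
    fun _ hx => P.min'_lt_of_mem_erase_min' h hx⟩

theorem WideOn.excess_le {P : Finset ℕ} (hP : ∀ p ∈ P, 2 ≤ p) {β : ℕ → ℕ} {y z : ℝ}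
    (h : WideOn P β z) (hyz : y ≤ z) : excess P β y ≤ recipProd P β - 1 := by
  refine excess_le_recipProd_sub_one hP fun p hp _ => ?_
  have h1 := h p hp
  have h2 := one_le_recipProd (P.filter (p < ·)) β
  have h3 : recipProd (P.filter (p < ·)) β * y ≤ p / (p - 1) := by nlinarith
  have h4 : (2 : ℝ) ≤ p := by exact_mod_cast hP p hp
  rw [le_div_iff₀ (by linarith)] at h3
  linarith

theorem excess_insert_le {a : ℕ} {P : Finset ℕ} (ha : ∀ x ∈ P, a < x) {β : ℕ → ℕ} {y : ℝ}
    (hy : 1 ≤ y) : excess (insert a P) β y ≤ (recipProd P β * y - 1) + excess P β y := by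
  rw [excess_insert ha]
  have h1 := one_le_recipProd P β
  have h2 : 0 ≤ recipProd P β * y - 1 := by nlinarith
  exact add_le_add (mul_le_of_le_one_left h2 (one_sub_pow_le_one a (β a))) le_rfl

/-- Without the prime two the excess is at most one. -/
theorem WideOn.excess_le_one {P : Finset ℕ} (hP : ∀ p ∈ P, 3 ≤ p) {β : ℕ → ℕ} {y z : ℝ}
    (h : WideOn P β z) (hy : 1 ≤ y) (hyz : y ≤ z) : excess P β y ≤ 1 := by
  rcases P.eq_empty_or_nonempty with rfl | hne
  · simp [excess]
  obtain ⟨a, P, rfl, ha⟩ := exists_insert_min hne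
  obtain ⟨h1, h2⟩ := h.of_insert ha
  have h3 := h2.excess_le (fun p hp => (by have := hP p (by simp [hp]); omega)) hyz
  have h4 := excess_insert_le ha (β := β) hy
  have h5 := one_le_recipProd P β
  have h6 : (3 : ℝ) ≤ a := by exact_mod_cast hP a (by simp)
  -- The least prime contributes at most 3/2 - 1, and by `WideOn.excess_le` the others together
  -- contribute at most 3/2 - 1 as well.
  have h7 : (a : ℝ) / (a - 1) ≤ 3 / 2 := by
    rw [div_le_div_iff₀ (by linarith) (by norm_num)]; linarith
  nlinarith

variable {G : Type*} [AddCommGroup G]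

/-- The width condition for the exponents `E`. -/
def Exponents.Wide (C : Finset ℕ) (q ℓ : ℕ) (E : Exponents) : Prop :=
  WideOn (C.filter fun p => 1 ≤ E.β p) E.β (recipSum q E.b * recipSum ℓ 1)

theorem recipProd_filter_one_le (C : Finset ℕ) (β : ℕ → ℕ) :
    recipProd (C.filter fun p => 1 ≤ β p) β = recipProd C β := by
  refine Finset.prod_subset (Finset.filter_subset _ _) fun p hp hp' => ?_
  have : β p = 0 := by
    by_contra h0
    exact hp' (Finset.mem_filter.2 ⟨hp, Nat.one_le_iff_ne_zero.2 h0⟩)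
  rw [this, recipSum_zero]

theorem excess_filter_one_le (C : Finset ℕ) (β : ℕ → ℕ) (y : ℝ) :
    excess (C.filter fun p => 1 ≤ β p) β y = excess C β y := by
  rw [excess, excess, Finset.sum_filter]
  refine Finset.sum_congr rfl fun p _ => ?_
  split_ifs with h
  · rw [Finset.filter_filter, ← recipProd_filter_one_le (C.filter (p < ·)), Finset.filter_filter]
    simp only [and_comm]
  · have : β p = 0 := by omega
    simp [this]

/-- Lowering exponents shrinks every product, and a prime whose exponent drops to zero carries no
condition any more. -/
theorem Exponents.Wide.mono {C : Finset ℕ} {q ℓ : ℕ} {E E' : Exponents} (h : E.Wide C q ℓ)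
    (hE : E'.Le E) : E'.Wide C q ℓ := by
  intro p hp
  rw [Finset.mem_filter] at hp
  refine le_trans ?_ (h p (Finset.mem_filter.2 ⟨hp.1, hp.2.trans (hE.β p)⟩))
  have h1 := one_le_recipProd ((C.filter fun p => 1 ≤ E'.β p).filter (p < ·)) E'.β
  have h2 := one_le_recipSum q E'.b
  have h3 := one_le_recipSum ℓ 1
  have h4 := recipSum_mono (p := q) hE.b
  have h5 : recipProd ((C.filter fun p => 1 ≤ E'.β p).filter (p < ·)) E'.β ≤
      recipProd ((C.filter fun p => 1 ≤ E.β p).filter (p < ·)) E.β := by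
    refine recipProd_mono (fun x hx => ?_) fun x _ => hE.β x
    simp only [Finset.mem_filter] at hx ⊢
    exact ⟨⟨hx.1.1, hx.1.2.trans (hE.β x)⟩, hx.2⟩
  gcongr
  linarith

/-- The hypotheses shared by the cases of the induction. -/
structure InductionData (G : Type*) [AddCommGroup G] (C : Finset ℕ) (q ℓ s : ℕ)
    (E : Exponents) : Prop where
  group : ChainGroup G C q ℓ s
  c_le : E.c ≤ 1
  b'_le : E.b' ≤ E.b
  pack : PackBelow G C q ℓ s E
  main : ∀ E' : Exponents, E'.Le E → E'.size C < E.size C → MainBound G C q ℓ s E'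

/-- The packing bound is available with e = 0, so a single averaging at any prime present closes the
induction. The prime ℓ comes first, so that the image has c = 0. -/
theorem InductionData.mainBound_of_excess_le_one [Finite G] {C : Finset ℕ} {q ℓ s : ℕ}
    {E : Exponents} (h : InductionData G C q ℓ s E)
    (hZ : excess C E.β (recipSum q E.b) ≤ 1) : MainBound G C q ℓ s E := by
  intro H hH S hS h1
  have key : ∀ {r R : ℕ} {Ed Ep : Exponents}, Reduction H C q ℓ s E r R Ed Ep → Ep.c = 0 →
      crossSum S ≤ kBound C q ℓ s E := fun {r R Ed Ep} hR hc => by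
    have h2 := hR.le_slack le_rfl (h.pack _ hR.map_le hR.map_size_lt hc 0 le_rfl (by
      rw [add_zero]
      refine le_trans ?_ hZ
      exact excess_mono (fun p hp => (h.group.prime p hp).two_le) (one_le_recipSum _ _)
        (recipSum_mono hR.map_le.b) fun p _ => hR.map_le.β p)) hS h1 (L := 0) (by
      rw [sub_nonneg]
      exact h.main _ hR.drop_le hR.drop_size_lt _ hR.shape_drop _ (fun x hx => by
        rw [Multiset.mem_filter] at hx
        exact hR.mem x (hS x hx.1) hx.2) fun h' => h1 (h'.mono (Multiset.filter_le _ _)))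
    simpa using h2
  by_cases hc : E.c = 1
  · exact key (hH.reduction_l h.group hc) rfl
  have hc0 : E.c = 0 := by have := h.c_le; omega
  by_cases hb : 1 ≤ E.b
  · exact key (hH.reduction_q h.group hb) hc0
  have hb0 : E.b = 0 := by omega
  have hb0' : E.b' = 0 := by have := h.b'_le; omega
  by_cases hβ : ∃ p ∈ C, 1 ≤ E.β p
  · obtain ⟨p, hp, hβ⟩ := hβ
    exact key (hH.reduction_chain h.group hp hβ) hc0
  push Not at hβ
  have hβ0 : ∀ p ∈ C, E.β p = 0 := fun p hp => Nat.lt_one_iff.1 (hβ p hp)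
  have hS0 : S = 0 := by
    refine Multiset.eq_zero_of_forall_notMem fun x hx => h1 (.of_mem_zero (?_ : (0 : G) ∈ S))
    have h2 := hH.kill x (hS x hx)
    rw [Finset.prod_eq_one fun p hp => by rw [hβ0 p hp, pow_zero], hb0, hc0] at h2
    simp only [pow_zero, one_mul, one_nsmul] at h2
    exact h2 ▸ hx
  rw [hS0, crossSum_zero, kBound_eq_of_c hc0, hb0, hb0',
    Finset.sum_eq_zero fun p hp => by rw [hβ0 p hp]; simp]
  simp

/-- At the prime 2 one has R = 1. An element of order two gives n = 1 = R, so Q is zero-sum free and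
the main bound replaces the packing bound. Without such an element the dense sequence is
`IsTwoGood`. -/
theorem InductionData.mainBound_of_slackBound [Finite G] {C : Finset ℕ} {q ℓ s : ℕ}
    {E : Exponents} (h : InductionData G C q ℓ s E) (h2 : 2 ∈ C) (hβ : 1 ≤ E.β 2)
    (hL : SlackBound G C q ℓ s E 0) : MainBound G C q ℓ s E := by
  intro H hH S hS h1
  have hred : IsReduced H 0 S := ⟨hS, h1, fun T hT hT0 hTs => (h1
    (hasZeroSums_one.2 ⟨T, hT, hT0, hTs⟩)).elim⟩
  obtain ⟨W, hW, hWd, hle⟩ := exists_isDense h.group hH hred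
  refine hle.trans ?_
  by_cases hex : ∃ x ∈ W, 2 • x = 0
  · obtain ⟨x, hx, hx2⟩ := hex
    have hR := hH.reduction_chain h.group (s := s) h2 hβ
    have : Fact (Nat.Prime 2) := ⟨Nat.prime_two⟩
    obtain ⟨n, Q, hn, hnR, hQ, hQm, hc⟩ := exists_average (p := 2) (t := 0) (R := 2 - 1) H hW.mem
      hW.zero_notMem hW.not_hasZeroSums hR.zeroSum
    have hn1 : n = 2 - 1 := by
      refine le_antisymm hnR ?_
      rw [hn]
      exact Multiset.card_pos_iff_exists_mem.2 ⟨x, Multiset.mem_filter.2 ⟨hx, hx2⟩⟩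
    rw [hn1, Nat.sub_self, zero_add] at hQ
    have h3 := h.main _ hR.map_le hR.map_size_lt _ hR.shape_map Q hQm hQ
    have h4 := h.main _ hR.drop_le hR.drop_size_lt _ hR.shape_drop
      (W.filter fun x => ¬ 2 ∣ addOrderOf x) (fun x hx => by
        rw [Multiset.mem_filter] at hx
        exact hR.mem x (hW.mem x hx.1) hx.2)
      fun h' => hW.not_hasZeroSums (h'.mono (Multiset.filter_le _ _))
    rw [hR.kBound_eq, hc, hn1]
    push_cast
    linarith
  · push Not at hex
    have := hL H hH W hW.mem ⟨hW.not_hasZeroSums, hWd.card_lt 2 h2, hex⟩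
    linarith

end Induction

/-! ### Numerical verification according to the smallest chain primes -/

section Numerics

open scoped Classical

variable {G : Type*} [AddCommGroup G]

theorem recipSum_le_of_le {p k : ℕ} (hk : 2 ≤ k) (hp : k ≤ p) (a : ℕ) :
    recipSum p a ≤ k / (k - 1) := by
  refine (recipSum_le (hk.trans hp) a).trans ?_
  have h1 : (2 : ℝ) ≤ k := by exact_mod_cast hk
  have h2 : (k : ℝ) ≤ p := by exact_mod_cast hp
  rw [div_le_div_iff₀ (by linarith) (by linarith)]
  linarith

theorem div_sub_one_le {p k : ℕ} (hk : 2 ≤ k) (hp : k ≤ p) :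
    (p : ℝ) / (p - 1) ≤ k / (k - 1) := by
  have h1 : (2 : ℝ) ≤ k := by exact_mod_cast hk
  have h2 : (k : ℝ) ≤ p := by exact_mod_cast hp
  rw [div_le_div_iff₀ (by linarith) (by linarith)]
  linarith

theorem InductionData.complete [Finite G] {C : Finset ℕ} {q ℓ s : ℕ} {E : Exponents}
    (h : InductionData G C q ℓ s E) {D D' : Finset ℕ} {e L F : ℝ}
    (hD : C.filter (fun p => 1 ≤ E.β p) = D' ∪ D) (hdisj : Disjoint D' D)
    (hL : SlackBound G C q ℓ s (E.chainPart D) L) (he : 0 ≤ e) (hLe : 0 ≤ L + e)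
    (hZ : excess (D' ∪ D) E.β (recipSum q E.b) ≤ 1 + e)
    (hF : recipProd D' E.β * (recipSum q E.b * recipSum ℓ 1) ≤ F)
    (hfin : e ≤ (L + e) * (2 - F)) : SlackBound G C q ℓ s E 0 := by
  have hm : ∀ p ∈ D', p ∈ C ∧ 1 ≤ E.β p := fun p hp =>
    Finset.mem_filter.1 (hD ▸ Finset.mem_union_left D hp)
  refine hL.complete h.group h.pack h.c_le h.b'_le he hLe ?_ (D' := D') (fun p hp => (hm p hp).1)
    hdisj (fun p hp => (hm p hp).2) (fun p hp hβ => ?_) (by rw [mul_assoc]; exact hF) hfin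
  · rwa [← hD, excess_filter_one_le] at hZ
  · rw [← hD]; exact Finset.mem_filter.2 ⟨hp, hβ⟩

theorem InductionData.insert_prime [Finite G] {C : Finset ℕ} {q ℓ s : ℕ} {E : Exponents}
    (h : InductionData G C q ℓ s E) {D : Finset ℕ} {r : ℕ} {e L L' : ℝ}
    (hL : SlackBound G C q ℓ s (E.chainPart D) L)
    (hD : ∀ p ∈ insert r D, p ∈ C) (hr : r ∉ D) (hβ : 1 ≤ E.β r) (he : 0 ≤ e)
    (hZ : excess (insert r D) E.β 1 ≤ 1 + e) (hL' : L' ≤ (1 - 1 / (r : ℝ)) * L - e / r) :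
    SlackBound G C q ℓ s (E.chainPart (insert r D)) L' :=
  (hL.insert_prime h.group h.pack (hD r (by simp)) hr hβ he
    (by rw [excess_chainPart hD]; exact hZ)).mono hL'

theorem excess_pair_le (β : ℕ → ℕ) {y : ℝ} (hy : 1 ≤ y) :
    excess {3, 2} β y ≤ (recipSum 3 (β 3) * y - 1) + (y - 1) := by
  have h1 : ({3, 2} : Finset ℕ) = insert 2 (insert 3 ∅) := by rw [Finset.pair_comm]; rfl
  rw [h1]
  have h2 := excess_insert_le (a := 2) (P := insert 3 ∅) (by simp) (β := β) hy
  have h3 := excess_insert_le (a := 3) (P := ∅) (by simp) (β := β) hy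
  simp only [recipProd, excess, Finset.prod_empty, Finset.sum_empty, Finset.prod_insert
    (Finset.notMem_empty 3)] at h2 h3 ⊢
  linarith

theorem excess_triple_le (β : ℕ → ℕ) {r : ℕ} (hr : 3 < r) :
    excess {r, 3, 2} β 1 ≤ (recipSum 3 (β 3) * recipSum r (β r) - 1) +
      (1 - 1 / (3 : ℝ) ^ β 3) * (recipSum r (β r) - 1) := by
  have h1 : ({r, 3, 2} : Finset ℕ) = insert 2 (insert 3 (insert r ∅)) := by ext x; simp; tauto
  rw [h1]
  have h2 := excess_insert_le (a := 2) (P := insert 3 (insert r ∅))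
    (by simp; omega) (β := β) (y := 1) le_rfl
  rw [excess_insert (a := 3) (by simpa using hr), excess_insert (a := r) (by simp),
    recipProd_insert (a := 3) (by simpa using hr), recipProd_insert (a := r) (by simp)] at h2
  have h3 : excess ∅ β 1 = 0 := by simp [excess]
  have h4 : recipProd ∅ β = 1 := by simp [recipProd]
  simp only [h3, h4, mul_one, sub_self, mul_zero, add_zero, Nat.cast_ofNat] at h2
  exact h2

/-- The case in which two is the only chain prime below five. -/
theorem InductionData.slackBound_of_five_le [Finite G] {C : Finset ℕ} {q ℓ s : ℕ} {E : Exponents}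
    (h : InductionData G C q ℓ s E) {r : ℕ} {P : Finset ℕ} (hr : 5 ≤ r) (hP : ∀ x ∈ P, r < x)
    (hC : C.filter (fun p => 1 ≤ E.β p) = insert r P ∪ {2})
    (hL : SlackBound G C q ℓ s (E.chainPart {2}) (1 / 2))
    (hr' : recipProd P E.β * (recipSum q E.b * recipSum ℓ 1) ≤ r / (r - 1))
    (hW : WideOn P E.β (recipSum q E.b * recipSum ℓ 1)) : SlackBound G C q ℓ s E 0 := by
  have hy := one_le_recipSum q E.b
  have hl := one_le_recipSum ℓ 1
  have hX := one_le_recipProd P E.β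
  have hx := one_le_recipSum r (E.β r)
  have hx' : recipSum r (E.β r) ≤ 5 / 4 := by
    have := recipSum_le_of_le (k := 5) (by norm_num) hr (E.β r); norm_num at this; exact this
  have hr5 : (r : ℝ) / (r - 1) ≤ 5 / 4 := by
    have := div_sub_one_le (k := 5) (by norm_num) hr; norm_num at this; exact this
  set y := recipSum q E.b
  set X := recipProd P E.β
  set x := recipSum r (E.β r)
  have hz : y ≤ y * recipSum ℓ 1 := le_mul_of_one_le_right (by linarith) hl
  have hXz : X * (y * recipSum ℓ 1) ≤ 5 / 4 := hr'.trans hr5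
  have hXy : X * y ≤ 5 / 4 := le_trans (by gcongr) hXz
  have hXX : X ≤ X * y := le_mul_of_one_le_right (by linarith) hy
  have hrP : ∀ a ∈ insert r P, 2 < a := by
    intro a ha
    rcases Finset.mem_insert.1 ha with rfl | ha
    · omega
    · have := hP a ha; omega
  -- The excess is at most (25/16 - 1) + (5/4 - 1) + (5/4 - 1) = 1 + 1/16, and F = (5/4)².
  refine h.complete (e := 1 / 16) (L := 1 / 2) (F := 25 / 16) hC ?_ hL (by norm_num)
    (by norm_num) ?_ ?_ (by norm_num)
  · rw [Finset.disjoint_singleton_right]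
    exact fun h2 => lt_irrefl 2 (hrP 2 h2)
  · rw [Finset.union_comm, ← Finset.insert_eq]
    have h1 := excess_insert_le hrP (β := E.β) hy
    have h2 := excess_insert_le hP (β := E.β) hy
    have h3 := hW.excess_le (fun p hp => (by have := hP p hp; omega)) hz
    rw [recipProd_insert hP] at h1
    change _ ≤ x * X * y - 1 + _ at h1
    change _ ≤ X * y - 1 + _ at h2
    change _ ≤ X - 1 at h3
    have h4 : x * X * y ≤ 5 / 4 * (5 / 4) := by
      rw [mul_assoc]; gcongr
    linarith
  · rw [recipProd_insert hP, mul_assoc]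
    calc _ ≤ (5 / 4 : ℝ) * (5 / 4) := by gcongr
      _ = _ := by norm_num

/-- The case of the chain primes two and three. -/
theorem InductionData.slackBound_of_pair [Finite G] {C : Finset ℕ} {q ℓ s : ℕ} {E : Exponents}
    (h : InductionData G C q ℓ s E) (hC : C.filter (fun p => 1 ≤ E.β p) = {3, 2})
    (hL : SlackBound G C q ℓ s (E.chainPart {3, 2}) (1 / 3))
    (hr' : recipSum q E.b * recipSum ℓ 1 ≤ 3 / 2) : SlackBound G C q ℓ s E 0 := by
  have hm : ∀ p ∈ ({3, 2} : Finset ℕ), p ∈ C := fun p hp => (Finset.mem_filter.1 (hC ▸ hp)).1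
  have hq5 : 5 ≤ q := by
    have hq := h.group.prime_q
    have h2 := hq.two_le
    have h3 : q ≠ 2 := fun h' => h.group.q_notMem (h' ▸ hm 2 (by simp))
    have h4 : q ≠ 3 := fun h' => h.group.q_notMem (h' ▸ hm 3 (by simp))
    have h5 : q ≠ 4 := by rintro rfl; revert hq; decide
    omega
  have hy := one_le_recipSum q E.b
  have hy' : recipSum q E.b ≤ 5 / 4 := by
    have := recipSum_le_of_le (k := 5) (by norm_num) hq5 E.b; norm_num at this; exact this
  have hx' : recipSum 3 (E.β 3) ≤ 3 / 2 := by
    have := recipSum_le_of_le (k := 3) (by norm_num) le_rfl (E.β 3); norm_num at this; exact this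
  -- The excess is at most (15/8 - 1) + (5/4 - 1) = 1 + 1/8, from `recipSum 3` ≤ 3/2 and q ≥ 5.
  refine h.complete (D' := ∅) (e := 1 / 8) (L := 1 / 3) (F := 3 / 2) (by simpa using hC)
    (by simp) hL (by norm_num) (by norm_num) ?_ (by simpa [recipProd] using hr') (by norm_num)
  rw [Finset.empty_union]
  have := excess_pair_le E.β hy
  have : recipSum 3 (E.β 3) * recipSum q E.b ≤ 3 / 2 * (5 / 4) := by gcongr
  linarith

/-- The excess in the case that two, three and `r` are the smallest chain primes. -/
theorem WideOn.excess_triple_le {β : ℕ → ℕ} {r : ℕ} {P : Finset ℕ} (hr : 3 < r)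
    (hP : ∀ x ∈ P, r < x) {y z : ℝ} (hW : WideOn P β z) (hy : 1 ≤ y) (hyz : y ≤ z)
    (h2 : recipSum 3 (β 3) * (recipSum r (β r) * (recipProd P β * z)) ≤ 2) :
    excess (P ∪ {r, 3, 2}) β y ≤ 1 +
      (1 - 1 / (3 : ℝ) ^ β 3) * (recipSum r (β r) * (recipProd P β * y) - 1) +
      (1 - 1 / (r : ℝ) ^ β r) * (recipProd P β * y - 1) + (recipProd P β - 1) := by
  have h1 : P ∪ {r, 3, 2} = insert 2 (insert 3 (insert r P)) := by ext x; simp; tauto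
  have hP3 : ∀ x ∈ insert r P, 3 < x := by
    intro a ha
    rcases Finset.mem_insert.1 ha with rfl | ha
    · exact hr
    · exact hr.trans (hP a ha)
  have hP2 : ∀ x ∈ insert 3 (insert r P), 2 < x := by
    intro a ha
    rcases Finset.mem_insert.1 ha with rfl | ha
    · omega
    · have := hP3 a ha; omega
  have h3 := excess_insert_le hP2 (β := β) hy
  rw [excess_insert hP3, excess_insert hP, recipProd_insert hP3, recipProd_insert hP] at h3
  have h4 := hW.excess_le (fun p hp => (by have := hP p hp; omega)) hyz
  have hX := one_le_recipProd P β
  have hx := one_le_recipSum r (β r)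
  have hx3 := one_le_recipSum 3 (β 3)
  have h5 : recipSum 3 (β 3) * (recipSum r (β r) * (recipProd P β * y)) ≤ 2 :=
    le_trans (by gcongr) h2
  rw [h1]
  simp only [mul_assoc, Nat.cast_ofNat] at h3 ⊢
  linarith

/-- The case of the chain primes two and three with further chain primes. -/
theorem InductionData.slackBound_of_triple [Finite G] {C : Finset ℕ} {q ℓ s : ℕ} {E : Exponents}
    (h : InductionData G C q ℓ s E) {r : ℕ} {P : Finset ℕ} (hr : 5 ≤ r) (hr6 : r ≠ 6)
    (hP : ∀ x ∈ P, r < x)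
    (hC : C.filter (fun p => 1 ≤ E.β p) = P ∪ {r, 3, 2})
    (hL : SlackBound G C q ℓ s (E.chainPart {3, 2}) (1 / 3))
    (h2 : recipSum 3 (E.β 3) * (recipSum r (E.β r) *
      (recipProd P E.β * (recipSum q E.b * recipSum ℓ 1))) ≤ 2)
    (hr' : recipProd P E.β * (recipSum q E.b * recipSum ℓ 1) ≤ r / (r - 1))
    (hW : WideOn P E.β (recipSum q E.b * recipSum ℓ 1)) : SlackBound G C q ℓ s E 0 := by
  have hm : ∀ p ∈ ({r, 3, 2} : Finset ℕ), p ∈ C ∧ 1 ≤ E.β p := fun p hp =>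
    Finset.mem_filter.1 (hC ▸ Finset.mem_union_right P hp)
  have hmC : ∀ p ∈ ({r, 3, 2} : Finset ℕ), p ∈ C := fun p hp => (hm p hp).1
  have hβr := (hm r (by simp)).2
  have hβ3 := (hm 3 (by simp)).2
  have hr32 : r ∉ ({3, 2} : Finset ℕ) := by simp; omega
  have hdisj : Disjoint P {r, 3, 2} := by
    rw [Finset.disjoint_left]
    intro a ha ha'
    have := hP a ha
    simp at ha'
    omega
  have hy := one_le_recipSum q E.b
  have hl := one_le_recipSum ℓ 1
  have hX := one_le_recipProd P E.β
  have hz : recipSum q E.b ≤ recipSum q E.b * recipSum ℓ 1 :=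
    le_mul_of_one_le_right (by linarith) hl
  have hZ := hW.excess_triple_le (by omega) hP hy hz h2
  have hT := CrossNumber.excess_triple_le E.β (r := r) (by omega)
  have hx' : recipSum 3 (E.β 3) ≤ 3 / 2 := by
    have := recipSum_le_of_le (k := 3) (by norm_num) le_rfl (E.β 3); norm_num at this; exact this
  have hx3 : 4 / 3 ≤ recipSum 3 (E.β 3) := by
    have := one_add_le_recipSum (p := 3) hβ3; norm_num at this; exact this
  have hr1 := one_le_recipSum r (E.β r)
  have hXy : recipProd P E.β * recipSum q E.b ≤
      recipProd P E.β * (recipSum q E.b * recipSum ℓ 1) := by gcongr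
  have hXX : recipProd P E.β ≤ recipProd P E.β * recipSum q E.b :=
    le_mul_of_one_le_right (by linarith) hy
  have hc3 := one_sub_pow_le_one 3 (E.β 3)
  have hcr := one_sub_pow_le_one r (E.β r)
  have hcr' := sub_one_mul_recipSum (p := r) (by omega) (E.β r)
  have hc3' := sub_one_mul_recipSum (p := 3) (by norm_num) (E.β 3)
  set x₃ := recipSum 3 (E.β 3)
  set x := recipSum r (E.β r) with hxdef
  set f := recipProd P E.β * recipSum q E.b with hf
  set g := recipProd P E.β * (recipSum q E.b * recipSum ℓ 1) with hg
  have hf1 : 1 ≤ f := hX.trans hXX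
  have hxf : x * f ≤ x * g := by gcongr
  have hxf1 : 1 ≤ x * f := one_le_mul_of_one_le_of_one_le hr1 hf1
  push_cast at hc3 hc3'
  set c₃ := 1 - 1 / (3 : ℝ) ^ E.β 3
  set c := 1 - 1 / (r : ℝ) ^ E.β r
  have h6 : c₃ * (x - 1) ≤ x - 1 := mul_le_of_le_one_left (by linarith) hc3
  have h7 : c₃ * (x * f - 1) ≤ x * f - 1 := mul_le_of_le_one_left (by linarith) hc3
  have h8 : c * (f - 1) ≤ f - 1 := mul_le_of_le_one_left (by linarith) hcr
  by_cases hr7 : 7 ≤ r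
  · have hr7' : (r : ℝ) / (r - 1) ≤ 7 / 6 := by
      have := div_sub_one_le (k := 7) (by norm_num) hr7; norm_num at this; exact this
    have hx7 : x ≤ 7 / 6 := by
      have := recipSum_le_of_le (k := 7) (by norm_num) hr7 (E.β r); norm_num at this; exact this
    have hx7' : (1 : ℝ) / r ≤ 1 / 7 := by
      have : (7 : ℝ) ≤ r := by exact_mod_cast hr7
      gcongr
    have hx3x : x₃ * x ≤ 3 / 2 * (7 / 6) := by gcongr
    have hxf7 : x * f ≤ 7 / 6 * (7 / 6) := by gcongr; linarith
    -- With only 2, 3 and r present the excess is at most 3/4 + 1/6 < 1, so no error arises and the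
    -- slack becomes at least (6/7)(1/3).
    have hL' := h.insert_prime (e := 0) (L' := 2 / 7) hL hmC hr32 hβr le_rfl (by linarith)
      (by rw [zero_div, sub_zero]; linarith)
    exact h.complete (e := 26 / 36) (F := 7 / 6) hC hdisj hL' (by norm_num) (by norm_num)
      (by linarith) (by linarith) (by norm_num)
  obtain rfl : r = 5 := by omega
  have hx5 : x ≤ 5 / 4 := by
    have := recipSum_le_of_le (k := 5) (by norm_num) le_rfl (E.β 5); norm_num at this; exact this
  have hx5' : 6 / 5 ≤ x := by
    have := one_add_le_recipSum (p := 5) hβr; norm_num at this; exact this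
  norm_num at hr'
  push_cast at hcr'
  have hg1 : 1 ≤ g := hf1.trans hXy
  have hxg5 : 6 / 5 * g ≤ x * g := by gcongr
  -- For r = 5 the width condition at 2, x₃ · x · g ≤ 2, is needed. A larger `x₃` leaves less room
  -- for g; the minimal value `x₃` = 4/3 allows more, but then the coefficient `c₃` is only 2/3.
  by_cases hβ : 2 ≤ E.β 3
  · have hx9 : 13 / 9 ≤ x₃ := by
      have : recipSum 3 2 ≤ recipSum 3 (E.β 3) := recipSum_mono hβ
      rw [recipSum_succ, recipSum_one] at this
      norm_num at this; exact this
    have hxg : x * g ≤ 18 / 13 := by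
      have : 13 / 9 * (x * g) ≤ x₃ * (x * g) := by gcongr
      linarith
    have hg2 : g ≤ 15 / 13 := by linarith
    have hx3x : x₃ * x ≤ 3 / 2 * (5 / 4) := by gcongr
    have hL' := h.insert_prime (e := 1 / 8) (L' := 24 / 100) hL hmC hr32 hβr (by norm_num)
      (by linarith) (by norm_num)
    exact h.complete (e := 10 / 13) (F := 15 / 13) hC hdisj hL' (by norm_num) (by norm_num)
      (by linarith) hg2 (by norm_num)
  · have hβ1 : E.β 3 = 1 := by omega
    have hx31 : x₃ = 4 / 3 := by
      have : x₃ = recipSum 3 1 := by rw [← hβ1]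
      rw [this, recipSum_one]; norm_num
    rw [hx31] at hc3' h2 hT
    have hc31 : c₃ = 2 / 3 := by rw [hc3']; norm_num
    rw [hc31] at hT hZ
    have hxg : x * g ≤ 3 / 2 := by linarith
    have hg2 : g ≤ 5 / 4 := by linarith
    have hf2 : f ≤ 5 / 4 := hXy.trans hg2
    have hL' := h.insert_prime (e := 0) (L' := 4 / 15) hL hmC hr32 hβr le_rfl
      (by linarith) (by norm_num)
    refine h.complete (e := 47 / 60) (F := 5 / 4) hC hdisj hL' (by norm_num) (by norm_num)
      ?_ hg2 (by norm_num)
    rw [hcr'] at hZ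
    -- Controls the bilinear term 4(x - 1)(f - 1). The value 47/60 = 1/3 + 1/5 + 1/4 is attained at
    -- the corner x = 6/5, f = 5/4.
    have h9 : 0 ≤ (x - 6 / 5) * (5 / 4 - f) := mul_nonneg (by linarith) (by linarith)
    linarith

theorem InductionData.slackBound [Finite G] {C : Finset ℕ} {q ℓ s : ℕ} {E : Exponents}
    (h : InductionData G C q ℓ s E) (hW : E.Wide C q ℓ)
    (hZ : 1 < excess C E.β (recipSum q E.b)) :
    2 ∈ C ∧ 1 ≤ E.β 2 ∧ SlackBound G C q ℓ s E 0 := by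
  have hy := one_le_recipSum q E.b
  have hl := one_le_recipSum ℓ 1
  have hz : recipSum q E.b ≤ recipSum q E.b * recipSum ℓ 1 :=
    le_mul_of_one_le_right (by linarith) hl
  rw [← excess_filter_one_le] at hZ
  have hmem : ∀ p ∈ C.filter (fun p => 1 ≤ E.β p), p ∈ C ∧ 1 ≤ E.β p := fun p hp =>
    Finset.mem_filter.1 hp
  have hprime : ∀ p ∈ C.filter (fun p => 1 ≤ E.β p), p.Prime := fun p hp =>
    h.group.prime p (hmem p hp).1
  rw [Exponents.Wide] at hW
  have h2P : 2 ∈ C.filter (fun p => 1 ≤ E.β p) := by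
    by_contra h2
    refine hZ.not_ge (hW.excess_le_one (fun p hp => ?_) hy hz)
    have h3 := (hprime p hp).two_le
    have h4 : p ≠ 2 := fun h' => h2 (h' ▸ hp)
    omega
  obtain ⟨h2C, hβ2⟩ := hmem 2 h2P
  refine ⟨h2C, hβ2, ?_⟩
  have hL := slackBound_two (G := G) (q := q) (ℓ := ℓ) (s := s) h2C hβ2
  obtain ⟨a, P₁, hP₁, ha⟩ := exists_insert_min ⟨2, h2P⟩
  have ha2 : a = 2 := by
    have h3 := (hprime a (by rw [hP₁]; simp)).two_le
    rw [hP₁] at h2P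
    rcases Finset.mem_insert.1 h2P with h4 | h4
    · exact h4.symm
    · have := ha 2 h4; omega
  subst ha2
  rw [hP₁] at hW hZ
  obtain ⟨hW2, hW₁⟩ := hW.of_insert ha
  rw [show ((2 : ℕ) : ℝ) / ((2 : ℕ) - 1) = 2 by norm_num] at hW2
  have hprime₁ : ∀ p ∈ P₁, p.Prime := fun p hp => hprime p (by rw [hP₁]; simp [hp])
  rcases P₁.eq_empty_or_nonempty with rfl | hne
  · refine (hZ.not_ge ?_).elim
    have h3 := excess_insert_le ha (β := E.β) hy
    simp only [recipProd, excess, Finset.prod_empty, Finset.sum_empty] at h3 hW2 ⊢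
    linarith
  obtain ⟨r, P₂, rfl, hr⟩ := exists_insert_min hne
  obtain ⟨hWr, hW₂⟩ := hW₁.of_insert hr
  have hr2 := ha r (by simp)
  have hr4 : r ≠ 4 := by
    rintro rfl
    exact absurd (hprime₁ 4 (by simp)) (by decide)
  by_cases hr3 : 5 ≤ r
  · exact h.slackBound_of_five_le hr3 hr (by rw [hP₁, Finset.union_comm, Finset.insert_eq 2]) hL
      hWr hW₂
  obtain rfl : r = 3 := by omega
  rw [show ((3 : ℕ) : ℝ) / ((3 : ℕ) - 1) = 3 / 2 by norm_num] at hWr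
  have h3P : 3 ∈ C.filter (fun p => 1 ≤ E.β p) := by rw [hP₁]; simp
  -- For the primes 2 and 3 alone the excess is at most 1/2, so e = 0 and 1/3 = (1 - 1/3)(1/2).
  have hL3 : SlackBound G C q ℓ s (E.chainPart {3, 2}) (1 / 3) := by
    refine h.insert_prime (e := 0) hL ?_ (by simp) (hmem 3 h3P).2 le_rfl ?_ (by norm_num)
    · intro p hp
      simp only [Finset.mem_insert, Finset.mem_singleton] at hp
      rcases hp with rfl | rfl
      exacts [(hmem 3 h3P).1, h2C]
    · have h3 := excess_pair_le E.β (y := 1) le_rfl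
      have h4 := recipSum_le_of_le (p := 3) (k := 3) (by norm_num) le_rfl (E.β 3)
      norm_num at h4
      linarith
  rcases P₂.eq_empty_or_nonempty with rfl | hne
  · refine h.slackBound_of_pair (by rw [hP₁]; exact Finset.pair_comm 2 3) hL3 ?_
    simpa [recipProd] using hWr
  obtain ⟨r, P₃, rfl, hr'⟩ := exists_insert_min hne
  obtain ⟨hWr', hW₃⟩ := hW₂.of_insert hr'
  have hrp := hprime₁ r (by simp)
  have hr3' := hr r (by simp)
  have hr4' : r ≠ 4 := by rintro rfl; revert hrp; decide
  have hr6 : r ≠ 6 := by rintro rfl; revert hrp; decide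
  refine h.slackBound_of_triple (by omega) hr6 hr' ?_ hL3 ?_ hWr' hW₃
  · rw [hP₁]; ext x; simp; tauto
  · rw [recipProd_insert hr, recipProd_insert hr'] at hW2
    simpa only [mul_assoc] using hW2

/-- The bound holds for all subgroups of the ambient group. -/
theorem mainBound_and_packBound [Finite G] {C : Finset ℕ} {q ℓ s : ℕ}
    (hG : ChainGroup G C q ℓ s) (n : ℕ) : ∀ E : Exponents, E.size C < n → E.Wide C q ℓ →
      E.c ≤ 1 → E.b' ≤ E.b → MainBound G C q ℓ s E ∧ (E.c = 0 → ∀ e : ℝ, 0 ≤ e →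
        excess C E.β (recipSum q E.b) ≤ 1 + e → PackBound G C q ℓ s E e) := by
  induction n with
  | zero => intro E h; omega
  | succ n ih =>
    have hmono : ∀ E : Exponents, E.size C < n → E.Wide C q ℓ → E.c ≤ 1 →
        MainBound G C q ℓ s E := by
      intro E hE hW hc
      by_cases hb : E.b' ≤ E.b
      · exact (ih E hE hW hc hb).1
      · exact fun H hH => (hb hH.le).elim
    -- At each size the main bound comes first, from both bounds at smaller sizes; the packing bound
    -- at the same size then uses it.
    have hmain : ∀ E : Exponents, E.size C < n + 1 → E.Wide C q ℓ → E.c ≤ 1 →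
        MainBound G C q ℓ s E := by
      intro E hE hW hc
      by_cases hb : E.b' ≤ E.b
      · have hI : InductionData G C q ℓ s E := by
          refine ⟨hG, hc, hb, fun E' hE' hlt hc' e he hZ => ?_, fun E' hE' hlt =>
            hmono E' (by omega) (hW.mono hE') (hE'.c.trans hc)⟩
          by_cases hb' : E'.b' ≤ E'.b
          · exact (ih E' (by omega) (hW.mono hE') (by omega) hb').2 hc' e he hZ
          · exact fun H hH => (hb' hH.le).elim
        by_cases hZ : excess C E.β (recipSum q E.b) ≤ 1
        · exact hI.mainBound_of_excess_le_one hZ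
        · obtain ⟨h2, hβ, hL⟩ := hI.slackBound hW (not_le.1 hZ)
          exact hI.mainBound_of_slackBound h2 hβ hL
      · exact fun H hH => (hb hH.le).elim
    intro E hE hW hc hb
    refine ⟨hmain E hE hW hc, fun hc0 e he hZ => packBound_of_mainBound hG hc0 he hZ
      (fun E' hE' => hmain E' ((hE'.size_le C).trans_lt hE) (hW.mono hE') (hE'.c.trans hc))
      fun hb1 => ?_⟩
    have hle : (E.setRankTwo (E.b - 1) (E.b' - 1)).Le E :=
      Exponents.setRankTwo_le (Nat.sub_le _ _) (Nat.sub_le _ _)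
    refine (ih _ ?_ (hW.mono hle) hc (Nat.sub_le_sub_right hb 1)).2 hc0 e he (le_trans ?_ hZ)
    · simp only [Exponents.size, Exponents.setRankTwo] at hE ⊢
      omega
    · exact excess_mono (fun p hp => (hG.prime p hp).two_le) (one_le_recipSum _ _)
        (recipSum_mono hle.b) fun p _ => hle.β p

end Numerics

/-! ### The lower bound and the passage between multisets and indexed sequences -/

section LowerBound

open scoped Classical

variable {G : Type*} [AddCommGroup G]

theorem not_hasZeroSums_add_replicate {V : AddSubgroup G} {M : Multiset G} (hM : ∀ x ∈ M, x ∈ V)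
    (h1 : ¬ HasZeroSums 1 M) {g : G} {n : ℕ} (hg : ∀ j, 1 ≤ j → j ≤ n → j • g ∉ V) :
    ¬ HasZeroSums 1 (M + Multiset.replicate n g) := by
  intro h
  obtain ⟨T, hT, hT0, hTs⟩ := hasZeroSums_one.1 h
  obtain ⟨j, hj, hTj⟩ := Multiset.le_replicate_iff.1 (tsub_le_iff_left.2 hT)
  have hdec : Multiset.replicate j g + T ∩ M = T := by rw [← hTj, Multiset.sub_add_inter]
  rcases Nat.eq_zero_or_pos j with rfl | hj0
  · refine h1 (hasZeroSums_one.2 ⟨T, ?_, hT0, hTs⟩)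
    rw [← hdec]
    simpa using Multiset.inter_le_right
  · refine hg j hj0 hj ?_
    rw [← hdec, Multiset.sum_add, Multiset.sum_replicate] at hTs
    rw [eq_neg_of_add_eq_zero_left hTs]
    exact V.neg_mem (AddSubgroup.multiset_sum_mem _ _ fun x hx =>
      hM x (Multiset.mem_of_le Multiset.inter_le_right hx))

/-- The elements supported on `D` and at `i`, with the component at `i` killed by `n`. -/
def partialSubgroup {ι : Type*} (A : ι → Type*) [∀ i, AddCommGroup (A i)] (D : Finset ι) (i : ι)
    (n : ℕ) : AddSubgroup ((i : ι) → A i) where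
  carrier := {x | (∀ j ∉ insert i D, x j = 0) ∧ n • x i = 0}
  zero_mem' := by simp
  add_mem' := fun {x y} hx hy => ⟨fun j hj => by simp [hx.1 j hj, hy.1 j hj], by
    simp [hx.2, hy.2]⟩
  neg_mem' := fun {x} hx => ⟨fun j hj => by simp [hx.1 j hj], by simp [hx.2]⟩

theorem addOrderOf_single {ι : Type*} {A : ι → Type*} [∀ i, AddCommGroup (A i)] (i : ι)
    (a : A i) : addOrderOf (Pi.single i a) = addOrderOf a :=
  addOrderOf_injective (AddMonoidHom.single A i) (Pi.single_injective i) a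

theorem exists_zeroSumFree_pi {ι : Type*} (q e : ι → ℕ) (hq : ∀ i, (q i).Prime) (D : Finset ι) :
    ∃ M : Multiset ((i : ι) → ZMod (q i ^ e i)), ¬ HasZeroSums 1 M ∧
      (∀ x ∈ M, ∀ j ∉ D, x j = 0) ∧ crossSum M = ∑ i ∈ D, (1 - 1 / (q i : ℝ) ^ e i) := by
  induction D using Finset.induction_on with
  | empty =>
    refine ⟨0, fun h => ?_, by simp, by simp⟩
    obtain ⟨T, hT, hT0, -⟩ := hasZeroSums_one.1 h
    exact hT0 (Multiset.le_zero.1 hT)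
  | insert i D hi ih =>
    obtain ⟨M, hM1, hMD, hMc⟩ := ih
    have key : ∀ k ≤ e i, ∃ M : Multiset ((i : ι) → ZMod (q i ^ e i)), ¬ HasZeroSums 1 M ∧
        (∀ x ∈ M, x ∈ partialSubgroup (fun i => ZMod (q i ^ e i)) D i (q i ^ k)) ∧
        crossSum M = (1 - 1 / (q i : ℝ) ^ k) + ∑ i ∈ D, (1 - 1 / (q i : ℝ) ^ e i) := by
      intro k
      induction k with
      | zero =>
        refine fun _ => ⟨M, hM1, fun x hx => ⟨fun j hj => hMD x hx j fun h => hj (by simp [h]), ?_⟩,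
          by simp [hMc]⟩
        rw [hMD x hx i hi, nsmul_zero]
      | succ k ih =>
        intro hk
        obtain ⟨M, hM1, hMV, hMc⟩ := ih (by omega)
        have hqi := hq i
        have hq2 := hqi.two_le
        -- An element of order q^(k+1). The multiples j • a with 1 ≤ j < q are not killed by q^k, so
        -- adding q - 1 copies preserves zero-sum freeness.
        set a : ZMod (q i ^ e i) := ((q i ^ (e i - (k + 1)) : ℕ) : ZMod (q i ^ e i)) with ha
        have hord : addOrderOf a = q i ^ (k + 1) := by
          rw [ha, ZMod.addOrderOf_coe _ (pow_ne_zero _ hqi.ne_zero),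
            Nat.gcd_eq_right (pow_dvd_pow _ (Nat.sub_le _ _)), Nat.pow_div (Nat.sub_le _ _) hqi.pos,
            Nat.sub_sub_self hk]
        refine ⟨M + Multiset.replicate (q i - 1) (Pi.single i a),
          not_hasZeroSums_add_replicate hMV hM1 fun j hj1 hj2 hj => ?_, fun x hx => ?_, ?_⟩
        · have h1 := hj.2
          rw [Pi.smul_apply, Pi.single_eq_same, ← mul_nsmul', ← addOrderOf_dvd_iff_nsmul_eq_zero,
            hord, pow_succ] at h1
          have h2 := Nat.dvd_of_mul_dvd_mul_left (pow_pos hqi.pos k) h1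
          have := Nat.le_of_dvd (by omega) h2
          omega
        · rcases Multiset.mem_add.1 hx with hx | hx
          · refine ⟨(hMV x hx).1, ?_⟩
            rw [pow_succ', mul_nsmul', (hMV x hx).2, nsmul_zero]
          · rw [Multiset.eq_of_mem_replicate hx]
            refine ⟨fun j hj => Pi.single_eq_of_ne (fun h => hj (by simp [h])) _, ?_⟩
            rw [Pi.single_eq_same, ← hord, addOrderOf_nsmul_eq_zero]
        · have h1 : crossSum (Multiset.replicate (q i - 1)
              (Pi.single i a : (i : ι) → ZMod (q i ^ e i))) =
              ((q i : ℝ) - 1) / (q i : ℝ) ^ (k + 1) := by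
            rw [crossSum_eq_of_order (d := q i ^ (k + 1)) fun x hx => by
              rw [Multiset.eq_of_mem_replicate hx, addOrderOf_single, hord],
              Multiset.card_replicate, Nat.cast_sub hqi.one_le]
            push_cast
            rfl
          have h2 := sum_range_one_sub hq2 k
          have h3 := sum_range_one_sub hq2 (k + 1)
          rw [Finset.sum_range_succ, h2] at h3
          rw [crossSum_add, hMc, h1]
          linarith
    obtain ⟨M, hM1, hMV, hMc⟩ := key (e i) le_rfl
    exact ⟨M, hM1, fun x hx => (hMV x hx).1, by rw [hMc, Finset.sum_insert hi]⟩

/-- The multiset of the terms of an indexed sequence. -/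
def IndexedSeq.toMultiset (S : IndexedSeq G) : Multiset G := S.val.map fun x => (x.1 : G)

theorem IndexedSeq.crossSum_toMultiset (S : IndexedSeq G) :
    crossSum S.toMultiset = S.crossNumber := by
  rw [crossSum, toMultiset, Multiset.map_map]
  rfl

theorem IndexedSeq.IsZeroSumFree.not_hasZeroSums {S : IndexedSeq G} (hS : S.IsZeroSumFree) :
    ¬ HasZeroSums 1 S.toMultiset := by
  intro h
  obtain ⟨T, hT, hT0, hTs⟩ := hasZeroSums_one.1 h
  obtain ⟨A, hA, rfl⟩ := exists_le_map_eq _ hT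
  refine hS ⟨A, Multiset.nodup_of_le hA S.nodup⟩ (Finset.val_le_iff.1 hA) ?_ hTs
  rw [Finset.nonempty_iff_ne_empty, Ne, ← Finset.val_eq_zero]
  rintro rfl
  simp at hT0

theorem crossSum_mem_of_not_hasZeroSums {M : Multiset G} (hM : ¬ HasZeroSums 1 M) :
    crossSum M ∈ zeroSumFreeCrossNumbers G := by
  have h0 : ∀ g ∈ M, g ≠ 0 := fun g hg h => hM (.of_mem_zero (h ▸ hg))
  lift M to Multiset {g : G // g ≠ 0} using h0
  have hmap : ∀ T : IndexedSeq G, T.toMultiset = (T.val.map Prod.fst).map Subtype.val :=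
    fun T => by rw [IndexedSeq.toMultiset, Multiset.map_map]; rfl
  refine ⟨M.toEnumFinset, fun T hT hTne hTs => hM (hasZeroSums_one.2 ⟨T.toMultiset, ?_, ?_, hTs⟩),
    ?_⟩
  · rw [hmap]
    exact Multiset.map_le_map (Multiset.map_fst_le_of_subset_toEnumFinset hT)
  · rw [IndexedSeq.toMultiset, Ne, Multiset.map_eq_zero, Finset.val_eq_zero]
    exact hTne.ne_empty
  · rw [← IndexedSeq.crossSum_toMultiset, hmap, Multiset.map_toEnumFinset_fst]

theorem crossSum_map_equiv {G' : Type*} [AddCommGroup G'] (f : G ≃+ G') (M : Multiset G) :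
    crossSum (M.map f) = crossSum M := by
  rw [crossSum, crossSum, Multiset.map_map]
  simp

theorem sum_le_littleCrossNumber [Finite G] {ι : Type*} [Fintype ι] (q e : ι → ℕ)
    (hq : ∀ i, (q i).Prime) (f : G ≃+ ((i : ι) → ZMod (q i ^ e i))) :
    ∑ i, (1 - 1 / (q i : ℝ) ^ e i) ≤ littleCrossNumber G := by
  obtain ⟨M, hM1, -, hMc⟩ := exists_zeroSumFree_pi q e hq Finset.univ
  rw [← hMc, ← crossSum_map_equiv f.symm]
  refine (isGreatest_littleCrossNumber G).2 (crossSum_mem_of_not_hasZeroSums fun h => hM1 ?_)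
  have := h.map_one (f : G →+ ((i : ι) → ZMod (q i ^ e i)))
  simpa [Multiset.map_map, Function.comp_def] using this

end LowerBound

/-! ### Verification of the hypotheses for the given group -/

section Assembly

open scoped Classical

theorem factorization_prod_pow {J : Finset ℕ} {p a : ℕ → ℕ} (hp : ∀ j ∈ J, (p j).Prime)
    (hinj : ∀ i ∈ J, ∀ j ∈ J, p i = p j → i = j) {k : ℕ} (hk : k ∈ J) :
    (∏ j ∈ J, p j ^ a j).factorization (p k) = a k := by
  rw [Nat.factorization_prod fun j hj => pow_ne_zero _ (hp j hj).ne_zero, Finset.sum_apply',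
    Finset.sum_eq_single_of_mem k hk, (hp k hk).factorization_pow, Finsupp.single_eq_same]
  intro j hj hjk
  rw [(hp j hj).factorization_pow, Finsupp.single_eq_of_ne]
  exact fun h => hjk (hinj j hj k hk h.symm)

theorem recipSum_eq_div {q : ℕ} (hq : 2 ≤ q) (a : ℕ) :
    recipSum q a = ((q : ℝ) ^ (a + 1) - 1) / ((q : ℝ) ^ (a + 1) - (q : ℝ) ^ a) := by
  have h2 : (2 : ℝ) ≤ q := by exact_mod_cast hq
  have h1 : (q : ℝ) - 1 ≠ 0 := by linarith
  have h3 : (q : ℝ) ^ a ≠ 0 := by positivity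
  have h4 : (q : ℝ) ^ (a + 1) - (q : ℝ) ^ a = (q : ℝ) ^ a * (q - 1) := by ring
  rw [recipSum_eq hq, h4]
  field_simp
  ring

/-- Listed primes with exponent zero contribute the factor 1, so the product over prime factors may
run over all listed primes. -/
theorem IsWide.prod_recipSum_le {x : ℕ} {J : Finset ℕ} {p a : ℕ → ℕ}
    (hp : ∀ j ∈ J, (p j).Prime) (hinj : ∀ i ∈ J, ∀ j ∈ J, p i = p j → i = j)
    (h : IsWide x (∏ j ∈ J, p j ^ a j)) : ∏ j ∈ J, recipSum (p j) (a j) ≤ x / (x - 1) := by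
  refine le_trans (le_of_eq ?_) h.2
  set n := ∏ j ∈ J, p j ^ a j with hn
  have h1 : ∏ q ∈ n.primeFactors, (((q : ℝ) ^ (n.factorization q + 1) - 1) /
      ((q : ℝ) ^ (n.factorization q + 1) - (q : ℝ) ^ n.factorization q)) =
      ∏ q ∈ n.primeFactors, recipSum q (n.factorization q) :=
    Finset.prod_congr rfl fun q hq =>
      (recipSum_eq_div (Nat.prime_of_mem_primeFactors hq).two_le _).symm
  rw [h1, Finset.prod_subset (s₁ := n.primeFactors) (s₂ := J.image p),
    Finset.prod_image fun i hi j hj => hinj i hi j hj]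
  · exact Finset.prod_congr rfl fun j hj => by rw [factorization_prod_pow hp hinj hj]
  · intro q hq
    have hqp := Nat.prime_of_mem_primeFactors hq
    have := Nat.dvd_of_mem_primeFactors hq
    rw [hn, hqp.prime.dvd_finsetProd_iff] at this
    obtain ⟨j, hj, hqj⟩ := this
    exact Finset.mem_image.2 ⟨j, hj,
      ((Nat.prime_dvd_prime_iff_eq hqp (hp j hj)).1 (hqp.dvd_of_dvd_pow hqj)).symm⟩
  · intro q _ hq
    rw [← Nat.support_factorization, Finsupp.notMem_support_iff] at hq
    rw [hq, recipSum_zero]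

theorem card_torsion_le {G : Type*} [AddCommGroup G] {ι : Type*} [Fintype ι] (q e : ι → ℕ)
    (hq : ∀ i, (q i).Prime) (f : G ≃+ ((i : ι) → ZMod (q i ^ e i))) {x d : ℕ} (hx : x.Prime)
    (hd : (Finset.univ.filter fun i => q i = x).card ≤ d) :
    Nat.card (nsmulAddMonoidHom x : G →+ G).ker ≤ x ^ d := by
  have h1 : Nat.card (nsmulAddMonoidHom x : G →+ G).ker = _ := card_torsion q e hq f x
  rw [h1]
  refine le_trans ?_ (Nat.pow_le_pow_right hx.pos hd)
  rw [Finset.card_filter, ← Finset.prod_pow_eq_pow_sum]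
  refine Finset.prod_le_prod' fun i _ => ?_
  split_ifs with h
  · rw [pow_one]; exact Nat.gcd_le_right _ hx.pos
  · rw [pow_zero]
    exact (Nat.Coprime.pow_left _ ((Nat.coprime_primes (hq i) hx).2 h)).le

/-- The index type of the cyclic components. -/
abbrev ComponentIndex (m s : ℕ) : Type := Finset.Icc 1 (m + 1) ⊕ (Unit ⊕ Fin s)

/-- The primes of the cyclic components. -/
def componentPrime (m s : ℕ) (p : ℕ → ℕ) : ComponentIndex m s → ℕ
  | .inl i => p i
  | .inr (.inl _) => p (m + 1)
  | .inr (.inr _) => p (m + 2)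

/-- The exponents of the cyclic components. -/
def componentExponent (m s : ℕ) (α : ℕ → ℕ) (α' : ℕ) : ComponentIndex m s → ℕ
  | .inl i => α i
  | .inr (.inl _) => α'
  | .inr (.inr _) => 1

/-- The given decomposition as a single product of cyclic groups. -/
noncomputable def componentEquiv (m s : ℕ) (p α : ℕ → ℕ) (α' : ℕ) :
    ((i : Finset.Icc 1 (m + 1)) → ZMod (p i ^ α i)) × ZMod (p (m + 1) ^ α') ×
      (Fin s → ZMod (p (m + 2))) ≃+
    ((i : ComponentIndex m s) → ZMod (componentPrime m s p i ^ componentExponent m s α α' i)) where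
  toFun x
    | .inl i => x.1 i
    | .inr (.inl _) => x.2.1
    | .inr (.inr j) => ZMod.ringEquivCongr (pow_one _).symm (x.2.2 j)
  invFun y := (fun i => y (.inl i), y (.inr (.inl ())),
    fun j => (ZMod.ringEquivCongr (pow_one (p (m + 2))).symm).symm (y (.inr (.inr j))))
  left_inv x := Prod.ext rfl (Prod.ext rfl (funext fun _ => RingEquiv.symm_apply_apply _ _))
  right_inv y := by
    funext i
    rcases i with i | i | i
    · rfl
    · rfl
    · exact RingEquiv.apply_symm_apply _ _
  map_add' x y := by
    funext i
    rcases i with i | i | i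
    · rfl
    · rfl
    · exact map_add _ _ _

theorem card_filter_componentPrime {m s : ℕ} {p : ℕ → ℕ} {x : ℕ} :
    (Finset.univ.filter fun i => componentPrime m s p i = x).card =
      ((Finset.Icc 1 (m + 1)).filter fun i => p i = x).card +
        ((if p (m + 1) = x then 1 else 0) + if p (m + 2) = x then s else 0) := by
  have h : ∑ a : Fin s, (if componentPrime m s p (.inr (.inr a)) = x then 1 else 0) =
      if p (m + 2) = x then s else 0 := by
    split_ifs with h
    · exact (Finset.sum_congr rfl fun a _ => if_pos h).trans (by simp)
    · exact Finset.sum_eq_zero fun a _ => if_neg h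
  have h' : ∑ a : Unit, (if componentPrime m s p (.inr (.inl a)) = x then 1 else 0) =
      if p (m + 1) = x then 1 else 0 := Fintype.sum_unique _
  rw [Finset.card_filter, Finset.card_filter, Fintype.sum_sum_type, Fintype.sum_sum_type,
    ← Finset.sum_coe_sort (Finset.Icc 1 (m + 1)) fun i => if p i = x then 1 else 0,
    h, h']
  rfl

variable {G : Type*} [AddCommGroup G] [Finite G]

theorem chainGroup_of_components {m s : ℕ} {p α : ℕ → ℕ} {α' : ℕ}
    (hp : ∀ i ∈ Finset.Icc 1 (m + 2), (p i).Prime)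
    (hinj : ∀ i ∈ Finset.Icc 1 (m + 2), ∀ j ∈ Finset.Icc 1 (m + 2), p i = p j → i = j)
    (f : G ≃+ ((i : ComponentIndex m s) →
      ZMod (componentPrime m s p i ^ componentExponent m s α α' i))) :
    ChainGroup G ((Finset.Icc 1 m).image p) (p (m + 1)) (p (m + 2)) s := by
  have hq : ∀ i, (componentPrime m s p i).Prime := by
    rintro (⟨i, hi⟩ | i | i)
    · exact hp i (Finset.Icc_subset_Icc_right (by omega) hi)
    · exact hp _ (by simp)
    · exact hp _ (by simp)
  have hcard : ∀ k ∈ Finset.Icc 1 (m + 2),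
      ((Finset.Icc 1 (m + 1)).filter fun i => p i = p k).card ≤ if k = m + 2 then 0 else 1 := by
    intro k hk
    split_ifs with h
    · rw [Nat.le_zero, Finset.card_eq_zero, Finset.filter_eq_empty_iff]
      intro i hi h'
      have := hinj i (Finset.Icc_subset_Icc_right (by omega) hi) k hk h'
      rw [Finset.mem_Icc] at hi
      omega
    · refine Finset.card_le_one.2 fun i hi j hj => ?_
      rw [Finset.mem_filter] at hi hj
      exact hinj i (Finset.Icc_subset_Icc_right (by omega) hi.1) j
        (Finset.Icc_subset_Icc_right (by omega) hj.1) (hi.2.trans hj.2.symm)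
  have hne : ∀ i ∈ Finset.Icc 1 (m + 2), ∀ j ∈ Finset.Icc 1 (m + 2), i ≠ j → p i ≠ p j :=
    fun i hi j hj h h' => h (hinj i hi j hj h')
  have hm1 : m + 1 ∈ Finset.Icc 1 (m + 2) := by simp
  have hm2 : m + 2 ∈ Finset.Icc 1 (m + 2) := by simp
  have hmem : ∀ i ∈ Finset.Icc 1 m, i ∈ Finset.Icc 1 (m + 2) := fun i hi =>
    Finset.Icc_subset_Icc_right (by omega) hi
  have hker : ∀ k, ∀ x ∈ (nsmulAddMonoidHom k : G →+ G).ker, k • x = 0 := fun _ _ hx => hx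
  have hcq : Nat.card (nsmulAddMonoidHom (p (m + 1)) : G →+ G).ker ≤ p (m + 1) ^ 2 := by
    refine card_torsion_le _ _ hq f (hp _ hm1) ?_
    rw [card_filter_componentPrime, if_pos rfl, if_neg (hne _ hm2 _ hm1 (by omega))]
    have := hcard _ hm1
    simp at this ⊢
    omega
  have hqq := (hp _ hm1).two_le
  have : Fact (p (m + 1)).Prime := ⟨hp _ hm1⟩
  refine ⟨fun x hx => ?_, hp _ hm1, hp _ hm2, fun h => ?_, fun h => ?_, hne _ hm1 _ hm2 (by omega),
    fun x hx M hM hMc => ?_, fun M hM hMc => ?_, fun M hM hMc => ?_, fun M hM hMc => ?_⟩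
  · obtain ⟨i, hi, rfl⟩ := Finset.mem_image.1 hx
    exact hp i (hmem i hi)
  · obtain ⟨i, hi, h⟩ := Finset.mem_image.1 h
    have := hinj i (hmem i hi) _ hm1 h
    rw [Finset.mem_Icc] at hi
    omega
  · obtain ⟨i, hi, h⟩ := Finset.mem_image.1 h
    have := hinj i (hmem i hi) _ hm2 h
    rw [Finset.mem_Icc] at hi
    omega
  · obtain ⟨i, hi, rfl⟩ := Finset.mem_image.1 hx
    have : Fact (p i).Prime := ⟨hp i (hmem i hi)⟩
    have h2 := (hp i (hmem i hi)).two_le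
    have h3 := Finset.mem_Icc.1 hi
    refine hasZeroSums_of_torsion (p := p i) (hker _) (d := 1)
      (card_torsion_le _ _ hq f (hp i (hmem i hi)) ?_) M hM (by omega)
    rw [card_filter_componentPrime, if_neg (hne _ hm2 _ (hmem i hi) (by omega)),
      if_neg (hne _ hm1 _ (hmem i hi) (by omega))]
    refine (hcard i (hmem i hi)).trans ?_
    rw [if_neg (by omega)]
  · exact hasZeroSums_of_torsion (p := p (m + 1)) (hker _) hcq M hM (by omega)
  · exact exists_short_zeroSum (hker _) hcq M hM (by omega)
  · have : Fact (p (m + 2)).Prime := ⟨hp _ hm2⟩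
    refine hasZeroSums_of_torsion (p := p (m + 2)) (hker _) (d := s)
      (card_torsion_le _ _ hq f (hp _ hm2) ?_) M hM hMc
    rw [card_filter_componentPrime, if_neg (hne _ hm1 _ hm2 (by omega)), if_pos rfl]
    have := hcard _ hm2
    simp at this ⊢
    exact this

theorem eq_zero_of_coprime_nsmul {A : Type*} [AddCommGroup A] {x : A} {a b : ℕ}
    (hab : a.Coprime b) (ha : a • x = 0) (hb : b • x = 0) : x = 0 := by
  have := Nat.dvd_gcd (addOrderOf_dvd_of_nsmul_eq_zero ha) (addOrderOf_dvd_of_nsmul_eq_zero hb)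
  rwa [hab.gcd_eq_one, Nat.dvd_one, AddMonoid.addOrderOf_eq_one_iff] at this

theorem nsmul_zmod_eq_zero {n k : ℕ} (h : n ∣ k) (x : ZMod n) : k • x = 0 := by
  rw [nsmul_eq_mul, (ZMod.natCast_eq_zero_iff k n).2 h, zero_mul]

/-- The exponents of the group in question, as a function of the primes. -/
def groupExponents (m : ℕ) (p α : ℕ → ℕ) (α' : ℕ) : Exponents :=
  ⟨fun x => ∑ i ∈ (Finset.Icc 1 m).filter (fun i => p i = x), α i, α (m + 1), α', 1⟩

theorem groupExponents_β {m : ℕ} {p α : ℕ → ℕ} {α' : ℕ}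
    (hinj : ∀ i ∈ Finset.Icc 1 (m + 2), ∀ j ∈ Finset.Icc 1 (m + 2), p i = p j → i = j) {k : ℕ}
    (hk : k ∈ Finset.Icc 1 m) : (groupExponents m p α α').β (p k) = α k := by
  have : (Finset.Icc 1 m).filter (fun i => p i = p k) = {k} := by
    ext i
    rw [Finset.mem_filter, Finset.mem_singleton]
    constructor
    · exact fun h => hinj i (Finset.Icc_subset_Icc_right (by omega) h.1) k
        (Finset.Icc_subset_Icc_right (by omega) hk) h.2
    · rintro rfl
      exact ⟨hk, rfl⟩
  simp [groupExponents, this]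

theorem shape_of_components {m s : ℕ} {p α : ℕ → ℕ} {α' : ℕ}
    (hp : ∀ i ∈ Finset.Icc 1 (m + 2), (p i).Prime)
    (hinj : ∀ i ∈ Finset.Icc 1 (m + 2), ∀ j ∈ Finset.Icc 1 (m + 2), p i = p j → i = j)
    (hα : α' ≤ α (m + 1))
    (f : G ≃+ ((i : ComponentIndex m s) →
      ZMod (componentPrime m s p i ^ componentExponent m s α α' i))) :
    Shape (⊤ : AddSubgroup G) ((Finset.Icc 1 m).image p) (p (m + 1)) (p (m + 2))
      (groupExponents m p α α') := by
  have hm1 : m + 1 ∈ Finset.Icc 1 (m + 2) := by simp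
  have hm2 : m + 2 ∈ Finset.Icc 1 (m + 2) := by simp
  have hpq := hp _ hm1
  have : Fact (p (m + 1)).Prime := ⟨hpq⟩
  refine ⟨hα, fun x _ => ?_, fun M hM hMc => ?_⟩
  · rw [← f.map_eq_zero_iff, map_nsmul]
    funext i
    rw [Pi.smul_apply, Pi.zero_apply]
    refine nsmul_zmod_eq_zero ?_ _
    rcases i with ⟨i, hi⟩ | i | i
    · change p i ^ α i ∣ _
      rw [Finset.mem_Icc] at hi
      rcases Nat.lt_or_ge m i with h | h
      · obtain rfl : i = m + 1 := by omega
        exact (Dvd.intro _ rfl : _ ∣ _ * _).mul_left _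
      · have him : i ∈ Finset.Icc 1 m := Finset.mem_Icc.2 ⟨hi.1, h⟩
        refine Dvd.dvd.mul_right ?_ _
        have := Finset.dvd_prod_of_mem (fun x => x ^ (groupExponents m p α α').β x)
          (Finset.mem_image_of_mem p him)
        rwa [groupExponents_β hinj him] at this
    · change p (m + 1) ^ α' ∣ _
      exact ((pow_dvd_pow _ hα).mul_right _).mul_left _
    · change p (m + 2) ^ 1 ∣ _
      exact (Dvd.intro_left _ rfl : _ ∣ _ * _).mul_left _
  · set q := p (m + 1)
    -- `K` embeds in the q-torsion of the component of order q^α(m+1): components at other primes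
    -- have no q-torsion, and multiplication by q^α' kills the smaller q-component. Hence |K| ≤ q.
    let K : AddSubgroup G := (nsmulAddMonoidHom q : G →+ G).ker ⊓
      (nsmulAddMonoidHom (q ^ α') : G →+ G).range
    let i₀ : ComponentIndex m s := .inl ⟨m + 1, by simp⟩
    have hinjK : ∀ x ∈ K, f x i₀ = 0 → x = 0 := by
      rintro x ⟨hx1, y, rfl⟩ h0
      rw [← f.map_eq_zero_iff]
      funext i
      have h1 : ∀ j, q • (f (nsmulAddMonoidHom (q ^ α') y) j) = 0 := fun j => by
        have h2 : q • nsmulAddMonoidHom (q ^ α') y = 0 := hx1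
        have h3 := congrFun (congrArg f h2) j
        rw [map_nsmul, map_zero] at h3
        exact h3
      have h2 : ∀ j k, p k ^ componentExponent m s α α' j = componentPrime m s p j ^
          componentExponent m s α α' j → k ∈ Finset.Icc 1 (m + 2) → k ≠ m + 1 →
          f (nsmulAddMonoidHom (q ^ α') y) j = 0 := fun j k hjk hk hk1 => by
        refine eq_zero_of_coprime_nsmul (Nat.Coprime.pow_right
          (componentExponent m s α α' j) ((Nat.coprime_primes hpq (hp k hk)).2 fun h =>
          hk1 (hinj _ hm1 _ hk h).symm)) (h1 j) ?_
        rw [hjk]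
        exact nsmul_zmod_eq_zero dvd_rfl _
      rcases i with ⟨i, hi⟩ | i | i
      · rcases eq_or_ne i (m + 1) with rfl | hne
        · exact h0
        · exact h2 _ i rfl (Finset.Icc_subset_Icc_right (by omega) hi) hne
      · rw [nsmulAddMonoidHom_apply, map_nsmul]
        exact nsmul_zmod_eq_zero (dvd_refl (q ^ α')) _
      · exact h2 _ (m + 2) rfl hm2 (by omega)
    let g : K → (nsmulAddMonoidHom q : ZMod (q ^ α (m + 1)) →+ ZMod (q ^ α (m + 1))).ker :=
      fun x => ⟨f x i₀, by
        have h2 : q • (x : G) = 0 := x.2.1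
        have h3 := congrFun (congrArg f h2) i₀
        rw [map_nsmul, map_zero] at h3
        exact h3⟩
    have hg : Function.Injective g := by
      intro x y hxy
      have h1 : f x i₀ = f y i₀ := congrArg Subtype.val hxy
      have h2 := hinjK (x - y) (K.sub_mem x.2 y.2) (by
        rw [map_sub, Pi.sub_apply, h1, sub_self])
      exact Subtype.ext (sub_eq_zero.1 h2)
    have hNZ : NeZero (q ^ α (m + 1)) := ⟨pow_ne_zero _ hpq.ne_zero⟩
    have hcard : Nat.card K ≤ q ^ 1 := by
      refine (Nat.card_le_card_of_injective g hg).trans ?_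
      rw [IsAddCyclic.card_nsmulAddMonoidHom_ker, Nat.card_zmod, pow_one]
      exact Nat.gcd_le_right _ hpq.pos
    refine hasZeroSums_of_torsion (p := q) (K := K) (fun x hx => hx.1) hcard M (fun x hx => ?_) ?_
    · obtain ⟨h1, y, -, h2⟩ := hM x hx
      exact ⟨h1, y, h2.symm⟩
    · have := hpq.two_le
      omega

/-- The hypothesis is ordered by index, `WideOn` by size. Among indices with positive exponent the
orders agree: for i < k the condition at i gives 1 + 1/p_k < p_i/(p_i - 1), hence p_i < p_k. -/
theorem wide_of_components {m : ℕ} {p α : ℕ → ℕ} {α' : ℕ}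
    (hp : ∀ i ∈ Finset.Icc 1 (m + 2), (p i).Prime)
    (hinj : ∀ i ∈ Finset.Icc 1 (m + 2), ∀ j ∈ Finset.Icc 1 (m + 2), p i = p j → i = j)
    (hwide : ∀ i ∈ Finset.Icc 1 m,
      IsWide (p i) ((∏ j ∈ Finset.Icc (i + 1) (m + 1), p j ^ α j) * p (m + 2))) :
    (groupExponents m p α α').Wide ((Finset.Icc 1 m).image p) (p (m + 1)) (p (m + 2)) := by
  have hsub : ∀ {i j : ℕ}, 1 ≤ i → j ≤ m + 2 → Finset.Icc i j ⊆ Finset.Icc 1 (m + 2) :=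
    fun hi hj => Finset.Icc_subset_Icc hi hj
  have hle : ∀ i ∈ Finset.Icc 1 m, (∏ j ∈ Finset.Icc (i + 1) m, recipSum (p j) (α j)) *
      (recipSum (p (m + 1)) (α (m + 1)) * recipSum (p (m + 2)) 1) ≤ p i / (p i - 1) := by
    intro i hi
    rw [Finset.mem_Icc] at hi
    -- The last prime enters the width condition with exponent 1, whatever the value of α there.
    set a : ℕ → ℕ := fun j => if j = m + 2 then 1 else α j with ha
    have h1 : ∏ j ∈ Finset.Icc (i + 1) (m + 2), p j ^ a j =
        (∏ j ∈ Finset.Icc (i + 1) (m + 1), p j ^ α j) * p (m + 2) := by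
      rw [Finset.prod_Icc_succ_top (by omega)]
      congr 1
      · refine Finset.prod_congr rfl fun j hj => ?_
        rw [Finset.mem_Icc] at hj
        simp [ha, show j ≠ m + 2 by omega]
      · simp [ha]
    have h2 := hwide i (Finset.mem_Icc.2 hi)
    rw [← h1] at h2
    have h3 := h2.prod_recipSum_le (fun j hj => hp j (hsub (by omega) le_rfl hj))
      fun j hj k hk => hinj j (hsub (by omega) le_rfl hj) k (hsub (by omega) le_rfl hk)
    rw [Finset.prod_Icc_succ_top (by omega), Finset.prod_Icc_succ_top (by omega), mul_assoc] at h3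
    refine le_trans (le_of_eq ?_) h3
    congr 1
    · refine Finset.prod_congr rfl fun j hj => ?_
      rw [Finset.mem_Icc] at hj
      simp [ha, show j ≠ m + 2 by omega]
    · simp [ha]
  have hlt : ∀ i ∈ Finset.Icc 1 m, ∀ k ∈ Finset.Icc 1 m, i < k → 1 ≤ α k → p i < p k := by
    intro i hi k hk hik hαk
    have h1 := hle i hi
    have hk' := Finset.mem_Icc.1 hk
    have hpi := hp i (hsub le_rfl (by omega) hi)
    have hpk := hp k (hsub le_rfl (by omega) hk)
    have h2 : recipSum (p k) (α k) ≤ ∏ j ∈ Finset.Icc (i + 1) m, recipSum (p j) (α j) := by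
      rw [← Finset.prod_erase_mul _ _ (Finset.mem_Icc.2 ⟨hik, hk'.2⟩ : k ∈ Finset.Icc (i + 1) m)]
      refine le_mul_of_one_le_left (by linarith [one_le_recipSum (p k) (α k)]) ?_
      exact Finset.prod_induction _ (fun x => 1 ≤ x)
        (fun _ _ ha hb => one_le_mul_of_one_le_of_one_le ha hb) le_rfl
        fun _ _ => one_le_recipSum _ _
    have h3 := one_add_le_recipSum (p := p k) hαk
    have h4 : 1 < recipSum (p (m + 1)) (α (m + 1)) * recipSum (p (m + 2)) 1 := by
      have h5 := one_le_recipSum (p (m + 1)) (α (m + 1))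
      have h6 : (0 : ℝ) < 1 / p (m + 2) := by
        have := (hp (m + 2) (by simp)).pos
        positivity
      rw [recipSum_one]
      nlinarith
    have hi2 : (2 : ℝ) ≤ p i := by exact_mod_cast hpi.two_le
    have hk0 : (0 : ℝ) < p k := by exact_mod_cast hpk.pos
    have h7 : 1 + 1 / (p k : ℝ) < p i / (p i - 1) := by
      have : 0 < 1 / (p k : ℝ) := by positivity
      nlinarith
    have h8 : (p i : ℝ) < p k + 1 := by
      rw [show 1 + 1 / (p k : ℝ) = (p k + 1) / p k by field_simp,
        div_lt_div_iff₀ hk0 (by linarith)] at h7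
      linarith
    have h9 : p i < p k + 1 := by exact_mod_cast h8
    refine lt_of_le_of_ne (by omega) fun h => ?_
    have := hinj i (hsub le_rfl (by omega) hi) k (hsub le_rfl (by omega) hk) h
    omega
  intro x hx
  rw [Finset.mem_filter] at hx
  obtain ⟨i, hi, rfl⟩ := Finset.mem_image.1 hx.1
  have hαi : 1 ≤ α i := by
    have := hx.2
    rwa [groupExponents_β hinj hi] at this
  refine le_trans ?_ (hle i hi)
  have h1 := one_le_recipSum (p (m + 1)) (α (m + 1))
  have h2 := one_le_recipSum (p (m + 2)) 1
  refine mul_le_mul_of_nonneg_right ?_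
    (mul_nonneg (zero_le_one.trans h1) (zero_le_one.trans h2))
  have h3 : ∏ j ∈ Finset.Icc (i + 1) m, recipSum (p j) (α j) =
      recipProd ((Finset.Icc (i + 1) m).image p) (groupExponents m p α α').β := by
    have hs : Finset.Icc (i + 1) m ⊆ Finset.Icc 1 m := Finset.Icc_subset_Icc (by omega) le_rfl
    rw [recipProd, Finset.prod_image fun j hj k hk => hinj j (hsub (by omega) (by omega) hj) k
      (hsub (by omega) (by omega) hk)]
    exact Finset.prod_congr rfl fun j hj => by rw [groupExponents_β hinj (hs hj)]
  rw [h3]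
  refine recipProd_mono (fun y hy => ?_) fun _ _ => le_rfl
  simp only [Finset.mem_filter] at hy
  obtain ⟨k, hk, rfl⟩ := Finset.mem_image.1 hy.1.1
  refine Finset.mem_image_of_mem p (Finset.mem_Icc.2 ⟨?_, (Finset.mem_Icc.1 hk).2⟩)
  by_contra! h
  rcases (Nat.lt_succ_iff.1 h).eq_or_lt with rfl | h
  · exact lt_irrefl _ hy.2
  · exact lt_asymm hy.2 (hlt k hk i hi h hαi)

theorem sum_components_eq {m s : ℕ} {p α : ℕ → ℕ} {α' : ℕ}
    (hinj : ∀ i ∈ Finset.Icc 1 (m + 2), ∀ j ∈ Finset.Icc 1 (m + 2), p i = p j → i = j) :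
    ∑ i, (1 - 1 / (componentPrime m s p i : ℝ) ^ componentExponent m s α α' i) =
      kBound ((Finset.Icc 1 m).image p) (p (m + 1)) (p (m + 2)) s (groupExponents m p α α') := by
  have h1 : ∑ x ∈ (Finset.Icc 1 m).image p, (1 - 1 / (x : ℝ) ^ (groupExponents m p α α').β x) =
      ∑ i ∈ Finset.Icc 1 m, (1 - 1 / (p i : ℝ) ^ α i) := by
    rw [Finset.sum_image fun j hj k hk => hinj j (Finset.Icc_subset_Icc_right (by omega) hj) k
      (Finset.Icc_subset_Icc_right (by omega) hk)]
    exact Finset.sum_congr rfl fun j hj => by rw [groupExponents_β hinj hj]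
  rw [kBound, h1, Fintype.sum_sum_type, Fintype.sum_sum_type]
  simp only [componentPrime, componentExponent, groupExponents]
  rw [Finset.sum_coe_sort (Finset.Icc 1 (m + 1)) fun i => 1 - 1 / (p i : ℝ) ^ α i,
    Finset.sum_Icc_succ_top (by omega)]
  simp
  ring

theorem littleCrossNumber_eq_kStar {m s : ℕ} {p α : ℕ → ℕ} {α' : ℕ}
    (hp : ∀ i ∈ Finset.Icc 1 (m + 2), (p i).Prime)
    (hinj : ∀ i ∈ Finset.Icc 1 (m + 2), ∀ j ∈ Finset.Icc 1 (m + 2), p i = p j → i = j)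
    (hwide : ∀ i ∈ Finset.Icc 1 m,
      IsWide (p i) ((∏ j ∈ Finset.Icc (i + 1) (m + 1), p j ^ α j) * p (m + 2)))
    (hα : α' ≤ α (m + 1))
    (e : G ≃+ ((i : Finset.Icc 1 (m + 1)) → ZMod (p i ^ α i)) × ZMod (p (m + 1) ^ α') ×
      (Fin s → ZMod (p (m + 2)))) : littleCrossNumber G = kStar G := by
  have hq : ∀ i, (componentPrime m s p i).Prime := by
    rintro (⟨i, hi⟩ | i | i)
    · exact hp i (Finset.Icc_subset_Icc_right (by omega) hi)
    · exact hp _ (by simp)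
    · exact hp _ (by simp)
  have f := e.trans (componentEquiv m s p α α')
  have hk := kStar_eq _ _ hq f
  refine le_antisymm ?_ (hk.trans_le (sum_le_littleCrossNumber _ _ hq f))
  rw [hk, sum_components_eq hinj]
  obtain ⟨S, hS, hSc⟩ := (isGreatest_littleCrossNumber G).1
  rw [← hSc, ← IndexedSeq.crossSum_toMultiset]
  exact (mainBound_and_packBound (chainGroup_of_components hp hinj f) _
    (groupExponents m p α α') (Nat.lt_succ_self _) (wide_of_components hp hinj hwide) le_rfl hα).1
    ⊤ (shape_of_components hp hinj hα f) _ (fun _ _ => trivial) hS.not_hasZeroSums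

end Assembly

end CrossNumber

theorem mainTheorem5
    (r : ℕ) (hr : 2 ≤ r) (p : ℕ → ℕ) (α : ℕ → ℕ) (α' s : ℕ)
    (hp : ∀ i ∈ Finset.Icc 1 r, (p i).Prime)
    (hdistinct : ∀ i ∈ Finset.Icc 1 r, ∀ j ∈ Finset.Icc 1 r, p i = p j → i = j)
    (hwide : ∀ i ∈ Finset.Icc 1 (r - 2),
      CrossNumber.IsWide (p i) ((∏ j ∈ Finset.Icc (i + 1) (r - 1), p j ^ α j) * p r))
    (hα : α' ≤ α (r - 1))
    {G : Type*} [AddCommGroup G] [Finite G]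
    (e : G ≃+ ((i : Finset.Icc 1 (r - 1)) → ZMod (p i ^ α i)) ×
      ZMod (p (r - 1) ^ α') × (Fin s → ZMod (p r))) :
    CrossNumber.littleCrossNumber G = CrossNumber.kStar G := by
  -- With r = m + 2 the truncated differences r - 1 and r - 2 reduce to m + 1 and m.
  obtain ⟨m, rfl⟩ := Nat.exists_eq_add_of_le' hr
  exact CrossNumber.littleCrossNumber_eq_kStar hp hdistinct hwide hα e
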